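/- **Setting.** Let $\Sigma$ be a finite non-empty alphabet and $w\ge 1$. A $(\Sigma,w)$-*layer* is a tuple $(\ell,r,T,I,J,\iota,\phi)$ with $\ell,r\subseteq\{0,\dots,w-1\}$ (left and right states), $T\subseteq \ell\times\Sigma\times r$ (transitions), $I\subseteq \ell$ (initial states), $J\subseteq r$ (final states) and flags $\iota,\phi\in\{0,1\}$ such that $I=\emptyset$ if $\iota=0$ and $J=\emptyset$ if $\phi=0$. Let $\mathcal B(\Sigma,w)$ be the finite set of all layers. A $(\Sigma,w)$-*ODD* of length $k\ge1$ is a string $D=D_1\cdots D_k$ of layers such that the left states of $D_{i+1}$ are the right states of $D_i$ for $1\le i<k$, exactly the first layer has $\iota=1$, and exactly the last layer has $\phi=1$. It accepts $x_1\cdots x_k\in\Sigma^k$ if there are states $p_0,\dots,p_k$ with $p_0\in I(D_1)$, $p_k\in J(D_k)$ and $(p_{i-1},x_i,p_i)\in T(D_i)$ for all $i$; its language $\mathcal L(D)$ is the set of accepted strings together with the length $k$. The *width* of $D$ is $\max\{|\ell(D_1)|,\dots,|\ell(D_k)|,|r(D_k)|\}$, its *number of states* is $|\ell(D_1)|+\sum_{i=1}^k|r(D_i)|$,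 and its *number of transitions* is $\sum_{i=1}^k|T(D_i)|$. A $(\Sigma,w)$-*second-order finite automaton* (SOFA) is a (possibly nondeterministic) finite automaton $F$ over the alphabet $\mathcal B(\Sigma,w)$, with a non-empty finite set $Q$ of states and a set $\Delta$ of transitions, such that every string in its language $\mathcal L(F)$ is a $(\Sigma,w)$-ODD. Its *size* is $|F|=|Q|+|\Delta|\cdot\log_2|\mathcal B(\Sigma,w)|$. Running times are numbers of unit-cost steps (register and memory accesses, arithmetic operations, assignments, tests) of programs on a word RAM; a program that runs in time $T$ uses words of $O(\log T)$ bits. Symbols and states are numbered; layers, ODDs and automata are given explicitly, by the characteristic vectors of their sets and, for an automaton, by a list of its transitions. All algorithms are uniform: $\Sigma$, $w$, $B$ and $F$ are part of the input, and the constants hidden in $O(\cdot)$ are absolute. **Theorem.** Let $B$ be a $(\Sigma,w)$-ODD of length $k$ and let $F$ be a $(\Sigma,w)$-SOFA. One can decide in time $2^{O(|\Sigma|\cdot w\cdot 2^w)}\cdot|F|\cdot k$ whether there is an ODD $B'\in\mathcal L(F)$ with $\mathcal L(B')=\mathcal L(B)$. Suppose that such an ODD exists. 1. One can construct in time $2^{O(|\Sigma|\cdot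 w\cdot 2^w)}\cdot|F|\cdot k$ an ODD $B'\in\mathcal L(F)$ with $\mathcal L(B')=\mathcal L(B)$ whose width is minimum among all ODDs in $\mathcal L(F)$ with the same language as $B$. 2. One can construct in time $2^{O(|\Sigma|\cdot w\cdot 2^w)}\cdot|F|\cdot k^2\cdot\log_2(k+1)$ an ODD $B'\in\mathcal L(F)$ with $\mathcal L(B')=\mathcal L(B)$ whose number of states is minimum among all ODDs in $\mathcal L(F)$ with the same language as $B$. 3. One can construct in time $2^{O(|\Sigma|\cdot w\cdot 2^w)}\cdot|F|\cdot k^2\cdot\log_2(k+1)$ an ODD $B'\in\mathcal L(F)$ with $\mathcal L(B')=\mathcal L(B)$ whose number of transitions is minimum among all ODDs in $\mathcal L(F)$ with the same language as $B$. -/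

import Mathlib

universe u v

/-! ### Layers and ordered decision diagrams -/

/-- A `(Sig, w)`-layer: left and right states (subsets of `{0, …, w-1}`), transitions, initial and
final states and two Boolean flags. -/
@[ext]
structure Layer (Sig : Type u) (w : ℕ) where
  left : Finset (Fin w)
  right : Finset (Fin w)
  trans : Finset (Fin w × Sig × Fin w)
  initStates : Finset (Fin w)
  finStates : Finset (Fin w)
  initFlag : Bool
  finFlag : Bool
  trans_mem : ∀ t ∈ trans, t.1 ∈ left ∧ t.2.2 ∈ right
  initStates_subset : initStates ⊆ left
  finStates_subset : finStates ⊆ right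
  initFlag_false : initFlag = false → initStates = ∅
  finFlag_false : finFlag = false → finStates = ∅

/-- There are only finitely many layers, so that they form an alphabet. -/
instance Layer.instFinite (Sig : Type u) (w : ℕ) [Finite Sig] : Finite (Layer Sig w) := by
  refine Finite.of_injective
    (fun L : Layer Sig w =>
      (L.left, L.right, L.trans, L.initStates, L.finStates, L.initFlag, L.finFlag)) ?_
  intro L M h
  simp only [Prod.mk.injEq] at h
  obtain ⟨h1, h2, h3, h4, h5, h6, h7⟩ := h
  exact Layer.ext h1 h2 h3 h4 h5 h6 h7

/-- A string of layers is an ordered decision diagram: it is non-empty, consecutive layers fit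
together, exactly the first layer has its initial flag set, and exactly the last one has its final
flag set. -/
structure IsODD {Sig : Type u} {w : ℕ} (D : List (Layer Sig w)) : Prop where
  ne_nil : D ≠ []
  glue : ∀ (i : ℕ) (h : i + 1 < D.length), D[i + 1].left = D[i].right
  initFlag_iff : ∀ (i : ℕ) (h : i < D.length), D[i].initFlag = true ↔ i = 0
  finFlag_iff : ∀ (i : ℕ) (h : i < D.length), D[i].finFlag = true ↔ i + 1 = D.length

/-- `D` accepts the string `x`: there is a sequence `p 0, …, p k` of states (`k` the length of `D`)
that starts in an initial state of the first layer, ends in a final state of the last layer, and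
whose `i`-th step is a transition of the `i`-th layer labelled by the `i`-th symbol of `x`. -/
def ODDAccepts {Sig : Type u} {w : ℕ} (D : List (Layer Sig w)) (x : List Sig) : Prop :=
  ∃ (hlen : x.length = D.length) (hne : D ≠ []) (p : ℕ → Fin w),
    p 0 ∈ (D.head hne).initStates ∧
    p D.length ∈ (D.getLast hne).finStates ∧
    ∀ (i : ℕ) (h : i < D.length), (p i, x[i], p (i + 1)) ∈ D[i].trans

/-- The language of an ODD, typed with its length. -/
def oddLang {Sig : Type u} {w : ℕ} (D : List (Layer Sig w)) : ℕ × Set (List Sig) :=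
  (D.length, {x | ODDAccepts D x})

/-- The width of an ODD: the largest size of a set of left states of one of its layers or of the
set of right states of its last layer. -/
def oddWidth {Sig : Type u} {w : ℕ} (D : List (Layer Sig w)) : ℕ :=
  max ((D.map fun L => L.left.card).foldr max 0)
    ((D.getLast?.map fun L => L.right.card).getD 0)

/-- The number of states of an ODD. -/
def oddNumStates {Sig : Type u} {w : ℕ} (D : List (Layer Sig w)) : ℕ :=
  (D.head?.map fun L => L.left.card).getD 0 + (D.map fun L => L.right.card).sum

/-- The number of transitions of an ODD. -/
def oddNumTrans {Sig : Type u} {w : ℕ} (D : List (Layer Sig w)) : ℕ :=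
  (D.map fun L => L.trans.card).sum

/-! ### Finite automata and second-order finite automata -/

/-- The set of transitions of a finite automaton. -/
def faTransitions {A : Type u} {Q : Type v} (F : NFA A Q) : Set (Q × A × Q) :=
  {t | t.2.2 ∈ F.step t.1 t.2.1}

/-- The size of a finite automaton with (finite) state set `Q` over the (finite) alphabet `A`:
the number of states plus the number of transitions times the (binary) logarithm of `|A|`. -/
noncomputable def faSize {A : Type u} {Q : Type v} (F : NFA A Q) : ℝ :=
  (Nat.card Q : ℝ) + ((faTransitions F).ncard : ℝ) * Real.logb 2 (Nat.card A)

/-- A second-order finite automaton: a finite automaton over the alphabet of layers, all of whose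
accepted strings are ODDs. -/
def IsSOFA {Sig : Type u} {Q : Type v} {w : ℕ} (F : NFA (Layer Sig w) Q) : Prop :=
  ∀ D ∈ F.accepts, IsODD D

/-- The ODDs in the language of `F` that have the same language as `B`. -/
def equivODDs {Sig : Type u} {Q : Type v} {w : ℕ} (F : NFA (Layer Sig w) Q)
    (B : List (Layer Sig w)) : Set (List (Layer Sig w)) :=
  {D | D ∈ F.accepts ∧ oddLang D = oddLang B}

/-! ### The machine model: programs on a word RAM, with a step count -/

/-- The arithmetic instructions of the machine (on natural numbers). -/
inductive BinOp where
  | add | sub | mul | div | mod | lt | eq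

def BinOp.eval : BinOp → ℕ → ℕ → ℕ
  | .add, a, b => a + b
  | .sub, a, b => a - b
  | .mul, a, b => a * b
  | .div, a, b => a / b
  | .mod, a, b => a % b
  | .lt, a, b => if a < b then 1 else 0
  | .eq, a, b => if a = b then 1 else 0

/-- Expressions: constants, registers, memory cells (with an arbitrary computed address) and
arithmetic. -/
inductive Expr where
  | const (n : ℕ)
  | reg (x : ℕ)
  | load (addr : Expr)
  | op (o : BinOp) (a b : Expr)

/-- Programs: assignments to registers and to memory cells, composition, branching and loops. -/
inductive Prog where
  | skip
  | assign (x : ℕ) (e : Expr)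
  | store (addr e : Expr)
  | seq (p q : Prog)
  | ite (e : Expr) (p q : Prog)
  | while (e : Expr) (p : Prog)

/-- The state of the machine: its registers and its random access memory. -/
structure Store where
  reg : ℕ → ℕ
  mem : ℕ → ℕ

/-- The value of an expression. -/
def Expr.eval (σ : Store) : Expr → ℕ
  | .const n => n
  | .reg x => σ.reg x
  | .load a => σ.mem (a.eval σ)
  | .op o a b => o.eval (a.eval σ) (b.eval σ)

/-- The number of steps for the evaluation of an expression: one for each constant, register
access, memory access and arithmetic operation in it. -/
def Expr.cost : Expr → ℕ
  | .const _ => 1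
  | .reg _ => 1
  | .load a => a.cost + 1
  | .op _ a b => a.cost + b.cost + 1

/-- All values (in particular all addresses) that occur in the evaluation of an expression are
words of `W` bits. -/
def Expr.Fits (W : ℕ) (σ : Store) : Expr → Prop
  | .const n => n < 2 ^ W
  | .reg x => σ.reg x < 2 ^ W
  | .load a => a.Fits W σ ∧ σ.mem (a.eval σ) < 2 ^ W
  | .op o a b => a.Fits W σ ∧ b.Fits W σ ∧ o.eval (a.eval σ) (b.eval σ) < 2 ^ W

/-- `Exec W p σ t τ`: on a machine with words of `W` bits, the program `p`, started in state `σ`,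
halts after exactly `t` steps in state `τ`, and never handles a number that does not fit into a
word. -/
inductive Exec (W : ℕ) : Prog → Store → ℕ → Store → Prop where
  | skip (σ : Store) : Exec W .skip σ 1 σ
  | assign (σ : Store) (x : ℕ) (e : Expr) (he : e.Fits W σ) :
      Exec W (.assign x e) σ (e.cost + 1)
        ⟨Function.update σ.reg x (e.eval σ), σ.mem⟩
  | store (σ : Store) (a e : Expr) (ha : a.Fits W σ) (he : e.Fits W σ) :
      Exec W (.store a e) σ (a.cost + e.cost + 1)
        ⟨σ.reg, Function.update σ.mem (a.eval σ) (e.eval σ)⟩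
  | seq {p q : Prog} {σ τ ρ : Store} {t₁ t₂ : ℕ} (hp : Exec W p σ t₁ τ) (hq : Exec W q τ t₂ ρ) :
      Exec W (.seq p q) σ (t₁ + t₂) ρ
  | iteTrue {e : Expr} {p q : Prog} {σ τ : Store} {t : ℕ} (he : e.Fits W σ)
      (hne : e.eval σ ≠ 0) (hp : Exec W p σ t τ) : Exec W (.ite e p q) σ (e.cost + 1 + t) τ
  | iteFalse {e : Expr} {p q : Prog} {σ τ : Store} {t : ℕ} (he : e.Fits W σ)
      (hz : e.eval σ = 0) (hq : Exec W q σ t τ) : Exec W (.ite e p q) σ (e.cost + 1 + t) τ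
  | whileFalse {e : Expr} {p : Prog} {σ : Store} (he : e.Fits W σ) (hz : e.eval σ = 0) :
      Exec W (.while e p) σ (e.cost + 1) σ
  | whileTrue {e : Expr} {p : Prog} {σ τ ρ : Store} {t₁ t₂ : ℕ} (he : e.Fits W σ)
      (hne : e.eval σ ≠ 0) (hp : Exec W p σ t₁ τ) (hw : Exec W (.while e p) τ t₂ ρ) :
      Exec W (.while e p) σ (e.cost + 1 + t₁ + t₂) ρ

/-- The initial state: the input stands in the first memory cells, everything else is `0`. -/
def Store.ofInput (input : List ℕ) : Store := ⟨fun _ => 0, fun i => input.getD i 0⟩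

/-- The list `out` stands in the memory, from the address in register `0` on. -/
def Store.Outputs (σ : Store) (out : List ℕ) : Prop :=
  ∀ (i : ℕ) (h : i < out.length), σ.mem (σ.reg 0 + i) = out[i]

/-- On the given input, `p` halts after at most `T` steps, on a machine with words of at most
`c · log₂ T` bits, in a state that satisfies `post`. -/
def RunsIn (p : Prog) (input : List ℕ) (c : ℕ) (T : ℝ) (post : Store → Prop) : Prop :=
  ∃ (W t : ℕ) (τ : Store), Exec W p (Store.ofInput input) t τ ∧
    (t : ℝ) ≤ T ∧ (W : ℝ) ≤ c * Real.logb 2 T ∧ post τ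

/-! ### The encoding of ODDs and automata as lists of numbers -/

open Classical in
/-- The truth value of a proposition as a number. -/
noncomputable def truthBit (P : Prop) : ℕ := if P then 1 else 0

/-- A layer is encoded by the characteristic vectors of its sets and its two flags. The symbols of
the alphabet are numbered by `eS`. -/
noncomputable def encodeLayer {Sig : Type u} {s w : ℕ} (eS : Sig ≃ Fin s) (L : Layer Sig w) :
    List ℕ :=
  (List.finRange w).map (fun p => truthBit (p ∈ L.left)) ++
  (List.finRange w).map (fun p => truthBit (p ∈ L.right)) ++
  (List.finRange w).map (fun p => truthBit (p ∈ L.initStates)) ++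
  (List.finRange w).map (fun p => truthBit (p ∈ L.finStates)) ++
  [L.initFlag.toNat, L.finFlag.toNat] ++
  (List.finRange w).flatMap fun p => (List.finRange s).flatMap fun a =>
    (List.finRange w).map fun q => truthBit ((p, eS.symm a, q) ∈ L.trans)

/-- An ODD is encoded by its length and the sequence of its layers. -/
noncomputable def encodeODD {Sig : Type u} {s w : ℕ} (eS : Sig ≃ Fin s)
    (D : List (Layer Sig w)) : List ℕ :=
  D.length :: D.flatMap (encodeLayer eS)

/-- The encoding of an automaton over the layer alphabet, whose states are numbered by `eQ` and
whose transitions are listed in `ts`: number of states, number of transitions, characteristic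
vectors of the sets of initial and of final states, list of transitions. -/
noncomputable def encodeFA {Sig : Type u} {Q : Type v} {s w n : ℕ} (eS : Sig ≃ Fin s)
    (eQ : Q ≃ Fin n) (F : NFA (Layer Sig w) Q) (ts : List (Q × Layer Sig w × Q)) : List ℕ :=
  [n, ts.length] ++
  (List.finRange n).map (fun i => truthBit (eQ.symm i ∈ F.start)) ++
  (List.finRange n).map (fun i => truthBit (eQ.symm i ∈ F.accept)) ++
  ts.flatMap fun t => (eQ t.1 : ℕ) :: (eQ t.2.2 : ℕ) :: encodeLayer eS t.2.1

/-- The input of the algorithms: the numbers `|Σ|` and `w`, the ODD `B` and the automaton `F`. -/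
noncomputable def encodeInput {Sig : Type u} {Q : Type v} {s w n : ℕ} (eS : Sig ≃ Fin s)
    (eQ : Q ≃ Fin n) (B : List (Layer Sig w)) (F : NFA (Layer Sig w) Q)
    (ts : List (Q × Layer Sig w × Q)) : List ℕ :=
  [s, w] ++ encodeODD eS B ++ encodeFA eS eQ F ts

/-- The final state holds (the encoding of) an ODD in the language of `F` with the same language as
`B` that minimizes `μ` among all of these. -/
def OutputsMinimizer {Sig : Type u} {Q : Type v} {s w : ℕ} (eS : Sig ≃ Fin s)
    (F : NFA (Layer Sig w) Q) (B : List (Layer Sig w)) (μ : List (Layer Sig w) → ℕ)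
    (τ : Store) : Prop :=
  ∃ D ∈ equivODDs F B, (∀ D' ∈ equivODDs F B, μ D ≤ μ D') ∧ τ.Outputs (encodeODD eS D)

/-! The subset construction turns an ODD into a layered deterministic automaton whose states are
coded by numbers below `2 ^ w`. Two ODDs B and D of the same length have the same language iff the
two start states are equivalent in the disjoint union of their deterministic automata, which has `2
* 2 ^ w` states. Such an equivalence has a certificate that can be checked locally: one colouring of
the `2 * 2 ^ w` states per level, such that the two start states share a colour on level 0, equal
colours on one level force equal colours of the successors on the next, and equal colours on the
last level force equal results.

A certificate suffices, because on every prefix of every word the states reached by B and D have the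
same colour (`LGraph.Path.sound`). It exists whenever the languages agree: colour states by their
residual languages, as in the Myhill–Nerode theorem (`exists_residual_colouring`,
`compatible_residualColouring`, `exists_path`).

Whether a layer fits between two colourings at step i depends only on that layer, the i-th layer of
B and the two colourings, and there are only 2^O(w·2^w) colourings. Hence the ODDs sought are the
label sequences of paths of length k in a graph whose nodes are pairs of a state of F and a
colouring and whose edges are triples of a transition and two colourings
(`LGraph.Path.mem_equivODDs`, `exists_path_of_mem_equivODDs`). That an accepted sequence of layers
is an ODD at all is guaranteed by F being a SOFA and is not checked by the graph.

Width, number of states and number of transitions are each obtained by combining weights of single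
layers with max or with + (`IsODD.oddWidth_eq`, `IsODD.oddNumStates_eq`, `oddNumTrans_eq`). Both
operations are monotone in the weight accumulated so far, so Bellman's dynamic programming over the
k levels finds an optimal path (`LGraph.Table.path`, `LGraph.Table.le_of_path`), and back pointers
recover it. The table takes time 2^O(|Σ|·w·2^w)·|F|·k for all three measures; the bounds with an
additional factor k·log(k+1) follow a fortiori.

To count machine steps, the algorithm is written in a small language of expressions with bounded
sums and statements with bounded loops, which is compiled to the machine. Two parameters control
everything: X bounds the contents of variables and memory cells, and L, a power 2^O(|Σ|·w·2^w),
bounds the ranges of all sums. Syntactic exponents then bound the values by powers of X, hence the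
word length by O(log X), and the time of one step of the algorithm by a power of L
(`SExpr.exec_compile`, `Runs.loop`, the rules for `Fast`). Since the exponents belong to fixed
programs, they disappear in the constant c. -/

/-! ### An expression language with bounded sums, compiled to the machine -/

/-- Expressions over variables and memory cells with bounded sums and local definitions. -/
inductive SExpr where
  | const (n : ℕ)
  | var (x : ℕ)
  | load (a : SExpr)
  | op (o : BinOp) (a b : SExpr)
  | sum (x n : ℕ) (b : SExpr)
  | bind (x : ℕ) (e b : SExpr)

namespace SExpr

/-- The value; `sum x n b` sums `b` over the values of `x` below that of the variable `n`. -/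
def eval (m : ℕ → ℕ) : SExpr → (ℕ → ℕ) → ℕ
  | const n, _ => n
  | var x, r => r x
  | load a, r => m (a.eval m r)
  | op o a b, r => o.eval (a.eval m r) (b.eval m r)
  | sum x n b, r => ∑ i ∈ Finset.range (r n), b.eval m (Function.update r x i)
  | bind x e b, r => b.eval m (Function.update r x (e.eval m r))

/-- An exponent that bounds the growth of values. -/
def size : SExpr → ℕ
  | const n => n + 1
  | var _ => 1
  | load a => a.size + 1
  | op _ a b => a.size + b.size
  | sum _ _ b => b.size + 1
  | bind _ e b => e.size * b.size

/-- An exponent that bounds the running time. -/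
def time : SExpr → ℕ
  | const _ => 1
  | var _ => 1
  | load a => a.time + 1
  | op _ a b => a.time + b.time + 1
  | sum _ _ b => b.time + 3
  | bind _ e b => e.time + b.time + 2

/-- Sums are bounded by variables in the range `[20, 30)`, all bound variables are below `20`. -/
def WF : SExpr → Prop
  | const _ => True
  | var _ => True
  | load a => a.WF
  | op _ a b => a.WF ∧ b.WF
  | sum x n b => x < 20 ∧ 20 ≤ n ∧ n < 30 ∧ b.WF
  | bind x e b => x < 20 ∧ e.WF ∧ b.WF

/-- The compiler: variables live in the even registers, the value is left in the odd register
number `d`, and only odd registers from there on are used as scratch space. -/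
def compile : ℕ → SExpr → Prog
  | d, const n => .assign (2 * d + 1) (.const n)
  | d, var x => .assign (2 * d + 1) (.reg (2 * x))
  | d, load a => .seq (compile d a) (.assign (2 * d + 1) (.load (.reg (2 * d + 1))))
  | d, op o a b => .seq (compile d a) (.seq (compile (d + 1) b)
      (.assign (2 * d + 1) (.op o (.reg (2 * d + 1)) (.reg (2 * (d + 1) + 1)))))
  | d, sum x n b =>
      .seq (.assign (2 * d + 1) (.const 0)) <|
      .seq (.assign (2 * (d + 1) + 1) (.reg (2 * x))) <|
      .seq (.assign (2 * (d + 2) + 1) (.reg (2 * n))) <|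
      .seq (.assign (2 * x) (.const 0)) <|
      .seq (.while (.op .lt (.reg (2 * x)) (.reg (2 * (d + 2) + 1)))
        (.seq (compile (d + 3) b) <|
         .seq (.assign (2 * d + 1) (.op .add (.reg (2 * d + 1)) (.reg (2 * (d + 3) + 1))))
          (.assign (2 * x) (.op .add (.reg (2 * x)) (.const 1)))))
      (.assign (2 * x) (.reg (2 * (d + 1) + 1)))
  | d, bind x e b =>
      .seq (compile d e) <|
      .seq (.assign (2 * (d + 1) + 1) (.reg (2 * x))) <|
      .seq (.assign (2 * x) (.reg (2 * d + 1))) <|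
      .seq (compile (d + 2) b) <|
      .seq (.assign (2 * d + 1) (.reg (2 * (d + 2) + 1)))
      (.assign (2 * x) (.reg (2 * (d + 1) + 1)))

theorem size_pos : ∀ e : SExpr, 1 ≤ e.size
  | const _ => by simp [size]
  | var _ => by simp [size]
  | load _ => by simp [size]
  | op _ a b => by have := size_pos a; simp only [size]; omega
  | sum _ _ _ => by simp [size]
  | bind _ e b => Nat.mul_pos (size_pos e) (size_pos b)

theorem time_pos : ∀ e : SExpr, 1 ≤ e.time
  | const _ => le_rfl
  | var _ => le_rfl
  | load _ => by simp [time]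
  | op _ _ _ => by simp [time]
  | sum _ _ _ => by simp [time]
  | bind _ _ _ => by simp only [time]; omega

end SExpr

/-! ### Value bounds and correctness of compiled expressions -/

/-- Lets costs and values of composed parts be bounded by adding exponents, so that no additive
constants need to be tracked. -/
theorem add_le_pow_add {X a b : ℕ} (hX : 2 ≤ X) (ha : 1 ≤ a) (hb : 1 ≤ b) :
    X ^ a + X ^ b ≤ X ^ (a + b) := by
  have h1 : 2 ≤ X ^ a := hX.trans (Nat.le_self_pow (by omega) X)
  have h2 : 2 ≤ X ^ b := hX.trans (Nat.le_self_pow (by omega) X)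
  rw [pow_add]; nlinarith

theorem BinOp.eval_le {X a b u v : ℕ} (hX : 2 ≤ X) (ha : 1 ≤ a) (hb : 1 ≤ b)
    (hu : u ≤ X ^ a) (hv : v ≤ X ^ b) (o : BinOp) : o.eval u v ≤ X ^ (a + b) := by
  have h0 := add_le_pow_add hX ha hb
  have h1 : 0 < X ^ a := by positivity
  have h2 := Nat.div_le_self u v
  have h3 := Nat.mod_le u v
  cases o <;> simp only [BinOp.eval]
  · omega
  · omega
  · rw [pow_add]; exact Nat.mul_le_mul hu hv
  · omega
  · omega
  · split <;> omega
  · split <;> omega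

/-- Two bounds are kept apart because a local definition may put a large value into a variable, but
never into memory. Its body is then evaluated under the variable bound `Y ^ e.size`, which is why
the exponents multiply in that case. -/
theorem SExpr.eval_le {X : ℕ} (hX : 2 ≤ X) {m : ℕ → ℕ} (hm : ∀ a, m a ≤ X) :
    ∀ (e : SExpr) {r : ℕ → ℕ} {Y : ℕ}, X ≤ Y → (∀ x, r x ≤ Y) → e.eval m r ≤ Y ^ e.size
  | const n, r, Y, hXY, _ => by
      simp only [eval, size]
      have : n < 2 ^ n := Nat.lt_two_pow_self
      have h2 : 2 ^ n ≤ Y ^ n := Nat.pow_le_pow_left (hX.trans hXY) n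
      exact (this.le.trans h2).trans (Nat.pow_le_pow_right (by omega) (by omega))
  | var x, r, Y, _, hr => by simpa [eval, size] using hr x
  | load a, r, Y, hXY, _ => by
      simp only [eval, size]
      exact (hm _).trans (hXY.trans (Nat.le_self_pow (by omega) Y))
  | op o a b, r, Y, hXY, hr =>
      BinOp.eval_le (hX.trans hXY) a.size_pos b.size_pos (a.eval_le hX hm hXY hr)
        (b.eval_le hX hm hXY hr) o
  | sum x n b, r, Y, hXY, hr => by
      simp only [eval, size]
      refine (Finset.sum_le_card_nsmul _ _ (Y ^ b.size) fun i hi => ?_).trans ?_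
      · refine b.eval_le hX hm hXY fun y => ?_
        rw [Function.update_apply]
        split
        · exact (Finset.mem_range.1 hi).le.trans (hr n)
        · exact hr y
      · rw [Finset.card_range, smul_eq_mul, pow_succ, mul_comm]
        exact Nat.mul_le_mul_left _ (hr n)
  | bind x e b, r, Y, hXY, hr => by
      simp only [eval, size]
      rw [pow_mul]
      have hY : Y ≤ Y ^ e.size := Nat.le_self_pow (by have := e.size_pos; omega) Y
      refine b.eval_le hX hm (hXY.trans hY) fun y => ?_
      rw [Function.update_apply]
      split
      · exact e.eval_le hX hm hXY hr
      · exact (hr y).trans hY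

/-- The even registers, which hold the variables, and the memory. -/
def Store.user (σ : Store) : Store := ⟨fun x => σ.reg (2 * x), σ.mem⟩

/-- The result of the evaluation of a compiled expression. -/
structure SExpr.Result (σ τ : Store) (d val : ℕ) : Prop where
  mem : τ.mem = σ.mem
  even : ∀ x, τ.reg (2 * x) = σ.reg (2 * x)
  odd : ∀ i < d, τ.reg (2 * i + 1) = σ.reg (2 * i + 1)
  val : τ.reg (2 * d + 1) = val

theorem BinOp.lt_fits {W : ℕ} (hW : 0 < W) (a b : ℕ) : BinOp.lt.eval a b < 2 ^ W := by
  have : 1 < 2 ^ W := Nat.one_lt_two_pow (by omega)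
  simp only [BinOp.eval]; split <;> omega

/-- A subexpression that starts at scratch level d leaves all lower odd registers alone and restores
the even registers, so intermediate results survive nested evaluations. Well-formedness keeps bound
variables below 20, hence no binding can alter a sum bound in the range from 20 to 29. The
assumption `16 ≤ L` serves to absorb constant costs into one more factor L. -/
theorem SExpr.exec_compile {L W : ℕ} (hL : 16 ≤ L) :
    ∀ (e : SExpr) (d : ℕ) (σ : Store) (X : ℕ), 2 ≤ X → (∀ x, σ.reg (2 * x) ≤ X) →
      (∀ a, σ.mem a ≤ X) → X ^ e.size < 2 ^ W → e.WF → (∀ x, 20 ≤ x → x < 30 → σ.reg (2 * x) ≤ L) →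
      ∃ t τ, Exec W (e.compile d) σ t τ ∧ t ≤ L ^ e.time ∧
        SExpr.Result σ τ d (e.eval σ.mem fun x => σ.reg (2 * x))
  | const n, d, σ, X, hX, hr, hm, hW, hwf, hb => by
      refine ⟨_, _, .assign _ _ _ ?_, ?_, ?_⟩
      · exact (show n ≤ X ^ (n + 1) from (const n).eval_le (r := fun _ => 0) hX hm le_rfl
          (fun _ => Nat.zero_le _)).trans_lt hW
      · simp only [Expr.cost, time, pow_one]; omega
      · constructor <;> intros <;> simp [Function.update_apply, eval, Expr.eval] <;> omega
  | var n, d, σ, X, hX, hr, hm, hW, hwf, hb => by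
      refine ⟨_, _, .assign _ _ _ ?_, ?_, ?_⟩
      · exact ((hr n).trans (by simp [size])).trans_lt hW
      · simp only [Expr.cost, time, pow_one]; omega
      · constructor <;> intros <;> simp [Function.update_apply, eval, Expr.eval] <;> omega
  | load a, d, σ, X, hX, hr, hm, hW, hwf, hb => by
      have hWa : X ^ a.size < 2 ^ W :=
        (Nat.pow_le_pow_right (by omega) (by simp [size])).trans_lt hW
      obtain ⟨t, τ, he, ht, hτ⟩ := exec_compile hL a d σ X hX hr hm hWa hwf hb
      refine ⟨_, _, .seq he (.assign _ _ _ ?_), ?_, ?_⟩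
      · simp only [Expr.Fits, Expr.eval, hτ.mem, hτ.val]
        refine ⟨(a.eval_le hX hm le_rfl hr).trans_lt hWa, (hm _).trans_lt ?_⟩
        exact (Nat.le_self_pow (by have := a.size_pos; omega) X).trans_lt hWa
      · simp only [Expr.cost, time, pow_succ]
        have : L ≤ L ^ a.time := Nat.le_self_pow (by have := a.time_pos; omega) L
        nlinarith
      · constructor
        · exact hτ.mem
        · intro x
          simp only [Function.update_apply, ← hτ.even x]
          rw [if_neg (by omega)]
        · intro i hi
          simp only [Function.update_apply, ← hτ.odd i hi]
          rw [if_neg (by omega)]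
        · simp [Expr.eval, eval, hτ.val, hτ.mem]
  | op o a b, d, σ, X, hX, hr, hm, hW, hwf, hb => by
      have hWa : X ^ a.size < 2 ^ W :=
        (Nat.pow_le_pow_right (by omega) (by simp [size])).trans_lt hW
      have hWb : X ^ b.size < 2 ^ W :=
        (Nat.pow_le_pow_right (by omega) (by simp [size])).trans_lt hW
      obtain ⟨t, τ, he, ht, hτ⟩ := exec_compile hL a d σ X hX hr hm hWa hwf.1 hb
      have hre : (fun x => τ.reg (2 * x)) = fun x => σ.reg (2 * x) := funext hτ.even
      obtain ⟨t', τ', he', ht', hτ'⟩ := exec_compile hL b (d + 1) τ X hX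
        (fun x => by rw [hτ.even]; exact hr x) (fun x => by rw [hτ.mem]; exact hm x) hWb hwf.2
        fun x h h' => by rw [hτ.even]; exact hb x h h'
      have hv := hτ'.val
      rw [hτ.mem, hre] at hv
      have hv' := (hτ'.odd d (by omega)).trans hτ.val
      refine ⟨_, _, .seq he (.seq he' (.assign _ _ _ ?_)), ?_, ?_⟩
      · simp only [Expr.Fits, Expr.eval, hv, hv']
        exact ⟨(a.eval_le hX hm le_rfl hr).trans_lt hWa, (b.eval_le hX hm le_rfl hr).trans_lt hWb,
          ((op o a b).eval_le hX hm le_rfl hr).trans_lt hW⟩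
      · simp only [Expr.cost, time]
        have h1 := add_le_pow_add (X := L) (by omega) a.time_pos b.time_pos
        have h2 : L ≤ L ^ (a.time + b.time) := Nat.le_self_pow (by have := a.time_pos; omega) L
        rw [pow_succ]
        nlinarith
      · constructor
        · exact hτ'.mem.trans hτ.mem
        · intro x
          simp only [Function.update_apply, ← hτ.even x, ← hτ'.even x]
          rw [if_neg (by omega)]
        · intro i hi
          simp only [Function.update_apply, ← hτ.odd i hi, ← hτ'.odd i (by omega)]
          rw [if_neg (by omega)]
        · simp [Expr.eval, eval, hv, hv']
  | sum x n b, d, σ, X, hX, hr, hm, hW, hwf, hb => by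
      obtain ⟨hx20, hn20, hn30, hwf⟩ := hwf
      have hn := hb n hn20 hn30
      have hWb : X ^ b.size < 2 ^ W :=
        (Nat.pow_le_pow_right (by omega) (by simp [size])).trans_lt hW
      have hWX : X < 2 ^ W := (Nat.le_self_pow (by have := b.size_pos; omega) X).trans_lt hWb
      have hW0 : 0 < W := by
        rcases Nat.eq_zero_or_pos W with h | h
        · subst h; simp at hWX; omega
        · exact h
      set r : ℕ → ℕ := fun x => σ.reg (2 * x) with hrdef
      set S : ℕ → ℕ := fun i => ∑ j ∈ Finset.range i, b.eval σ.mem (Function.update r x j) with hS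
      have hbody : ∀ i < r n, ∀ y, Function.update r x i y ≤ X := by
        intro i hi y
        rw [Function.update_apply]
        split
        · exact hi.le.trans (hr n)
        · exact hr y
      have hSle : ∀ i ≤ r n, S i < 2 ^ W := by
        intro i hi
        refine lt_of_le_of_lt ?_ hW
        refine le_trans ?_ ((sum x n b).eval_le hX hm le_rfl hr)
        exact Finset.sum_le_sum_of_subset (Finset.range_mono hi)
      -- Induction on the number j of iterations left. Scratch level d holds the partial sum, d + 1
      -- the saved value of the bound variable and d + 2 the number of iterations.
      have loop : ∀ j i (τ : Store), i + j = r n → τ.mem = σ.mem → τ.reg (2 * x) = i →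
          (∀ y, y ≠ x → τ.reg (2 * y) = σ.reg (2 * y)) →
          (∀ i < d, τ.reg (2 * i + 1) = σ.reg (2 * i + 1)) →
          τ.reg (2 * d + 1) = S i → τ.reg (2 * (d + 1) + 1) = r x →
          τ.reg (2 * (d + 2) + 1) = r n →
          ∃ t τ', Exec W (.while (.op .lt (.reg (2 * x)) (.reg (2 * (d + 2) + 1)))
              (.seq (compile (d + 3) b) <|
              .seq (.assign (2 * d + 1) (.op .add (.reg (2 * d + 1)) (.reg (2 * (d + 3) + 1))))
              (.assign (2 * x) (.op .add (.reg (2 * x)) (.const 1))))) τ t τ' ∧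
            t ≤ j * (L ^ b.time + 12) + 4 ∧ τ'.mem = σ.mem ∧
            (∀ y, y ≠ x → τ'.reg (2 * y) = σ.reg (2 * y)) ∧
            (∀ i < d, τ'.reg (2 * i + 1) = σ.reg (2 * i + 1)) ∧
            τ'.reg (2 * d + 1) = S (r n) ∧ τ'.reg (2 * (d + 1) + 1) = r x := by
        intro j
        induction j with
        | zero =>
          intro i τ hi hmem hx hev hod hSi hsave hbnd
          refine ⟨_, τ, .whileFalse ?_ ?_, ?_, hmem, hev, hod, ?_, hsave⟩
          · simp only [Expr.Fits, Expr.eval, hx, hbnd]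
            have hnX : r n < 2 ^ W := (hr n).trans_lt hWX
            exact ⟨by omega, hnX, BinOp.lt_fits hW0 _ _⟩
          · simp [Expr.eval, BinOp.eval, hx, hbnd]; omega
          · simp [Expr.cost]
          · rw [hSi]; congr 1;
        | succ j ih =>
          intro i τ hi hmem hx hev hod hSi hsave hbnd
          have hreg : (fun y => τ.reg (2 * y)) = Function.update r x i := by
            funext y
            rw [Function.update_apply]
            split
            · subst_vars; rfl
            · exact hev y ‹_›
          obtain ⟨t, τ₁, he, ht, hτ⟩ := exec_compile hL b (d + 3) τ X hX
            (fun y => by rw [congrFun hreg y]; exact hbody i (by omega) y)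
            (fun a => by rw [hmem]; exact hm a) hWb hwf
            (fun y hy hy' => by
              rw [congrFun hreg y, Function.update_apply, if_neg (by omega)]
              exact hb y hy hy')
          have hval := hτ.val
          rw [hreg, hmem] at hval
          have hSi1 : S (i + 1) = S i + b.eval σ.mem (Function.update r x i) :=
            Finset.sum_range_succ _ _
          have hd1 := hτ.odd d (by omega)
          have hd2 := hτ.odd (d + 1) (by omega)
          have hd3 := hτ.odd (d + 2) (by omega)
          obtain ⟨t', τ', he', ht', hτ'⟩ := ih (i + 1)
            ⟨Function.update (Function.update τ₁.reg (2 * d + 1) (S (i + 1))) (2 * x) (i + 1),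
              τ₁.mem⟩ (by omega) (hτ.mem.trans hmem) (by simp)
            (fun y hy => by
              simp only [Function.update_apply]
              rw [if_neg (by omega), if_neg (by omega), hτ.even, hev y hy])
            (fun i' hi' => by
              simp only [Function.update_apply]
              rw [if_neg (by omega), if_neg (by omega), hτ.odd _ (by omega), hod _ hi'])
            (by simp only [Function.update_apply]
                rw [if_neg (by omega), if_pos trivial])
            (by simp only [Function.update_apply]
                rw [if_neg (by omega), if_neg (by omega), hd2, hsave])
            (by simp only [Function.update_apply]
                rw [if_neg (by omega), if_neg (by omega), hd3, hbnd])
          refine ⟨_, τ', .whileTrue (t₂ := t') ?_ ?_ (.seq he (.seq (.assign _ _ _ ?_)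
            (.assign _ _ _ ?_))) ?_, ?_, hτ'⟩
          · simp only [Expr.Fits, Expr.eval, hx, hbnd]
            have hnX : r n < 2 ^ W := (hr n).trans_lt hWX
            exact ⟨by omega, hnX, BinOp.lt_fits hW0 _ _⟩
          · simp [Expr.eval, BinOp.eval, hx, hbnd]; omega
          · simp only [Expr.Fits, Expr.eval, BinOp.eval, hd1, hSi, hval]
            have h1 := hSle (i + 1) (by omega)
            exact ⟨by omega, by omega, by omega⟩
          · have h1 : τ₁.reg (2 * x) = i := by rw [hτ.even, hx]
            simp only [Expr.Fits, Expr.eval, BinOp.eval, Function.update_apply]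
            rw [if_neg (by omega), h1]
            have := hr n
            have h2 : r n ≤ X := hr n
            exact ⟨by omega, by omega, by omega⟩
          · have h1 : τ₁.reg (2 * x) = i := by rw [hτ.even, hx]
            convert he' using 3
            · simp [Expr.eval, BinOp.eval, hd1, hSi, hval, hSi1]
            · simp only [Expr.eval, BinOp.eval, Function.update_apply]
              rw [if_neg (by omega), h1]
          · simp only [Expr.cost]
            nlinarith
      have hr0 : ∀ y, σ.reg (2 * y) < 2 ^ W := fun y => (hr y).trans_lt hWX
      have hz : 0 < 2 ^ W := by positivity
      obtain ⟨t, τ, he, ht, h1, h2, h3, h4, h5⟩ := loop (r n) 0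
        ⟨Function.update (Function.update (Function.update (Function.update σ.reg (2 * d + 1) 0)
          (2 * (d + 1) + 1) (r x)) (2 * (d + 2) + 1) (r n)) (2 * x) 0, σ.mem⟩
        (by omega) rfl (by simp)
        (fun y hy => by
          simp only [Function.update_apply]
          rw [if_neg (by omega), if_neg (by omega), if_neg (by omega), if_neg (by omega)])
        (fun i hi => by
          simp only [Function.update_apply]
          rw [if_neg (by omega), if_neg (by omega), if_neg (by omega), if_neg (by omega)])
        (by simp only [Function.update_apply]
            rw [if_neg (by omega), if_neg (by omega), if_neg (by omega), if_pos trivial]; simp [hS])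
        (by simp only [Function.update_apply]
            rw [if_neg (by omega), if_neg (by omega), if_pos trivial])
        (by simp only [Function.update_apply]
            rw [if_neg (by omega), if_pos trivial])
      refine ⟨_, _, .seq (.assign _ _ _ ?_) (.seq (.assign _ _ _ ?_) (.seq (.assign _ _ _ ?_)
        (.seq (.assign _ _ _ ?_) (.seq (t₁ := t) (τ := τ) ?_ (.assign _ _ _ ?_))))), ?_, ?_⟩
      · exact hz
      · simp only [Expr.Fits, Function.update_apply]
        rw [if_neg (by omega)]; exact hr0 x
      · simp only [Expr.Fits, Function.update_apply]
        rw [if_neg (by omega), if_neg (by omega)]; exact hr0 n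
      · exact hz
      · have e1 : Function.update σ.reg (2 * d + 1) 0 (2 * x) = r x :=
          Function.update_of_ne (by omega) _ _
        have e2 : Function.update (Function.update σ.reg (2 * d + 1) 0) (2 * (d + 1) + 1) (r x)
            (2 * n) = r n := by
          rw [Function.update_of_ne (by omega), Function.update_of_ne (by omega)]
        simp only [Expr.eval, e1, e2]
        exact he
      · simp only [Expr.Fits, h5]; exact hr0 x
      · simp only [Expr.cost, time]
        have h6 : L ≤ L ^ b.time := Nat.le_self_pow (by have := b.time_pos; omega) L
        have h7 : r n * (L ^ b.time + 12) ≤ L * (L ^ b.time + 12) := Nat.mul_le_mul_right _ hn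
        have h8 : L * L * L ^ b.time * 16 ≤ L ^ b.time * L ^ 3 := by
          rw [pow_succ, pow_two, mul_comm (L ^ b.time)]
          calc L * L * L ^ b.time * 16 ≤ L * L * L ^ b.time * L := Nat.mul_le_mul_left _ hL
            _ = _ := by ring
        rw [pow_add]
        nlinarith
      · constructor
        · exact h1
        · intro y
          simp only [Expr.eval, Function.update_apply]
          split
          · have : y = x := by omega
            subst this; exact h5
          · exact h2 y (by omega)
        · intro i hi
          simp only [Function.update_apply]
          rw [if_neg (by omega), h3 i hi]
        · simp only [Function.update_apply]
          rw [if_neg (by omega), h4, eval]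
  | bind x a b, d, σ, X, hX, hr, hm, hW, hwf, hb => by
      have hsa := a.size_pos
      have hsb := b.size_pos
      simp only [size] at hW
      have hWa : X ^ a.size < 2 ^ W :=
        (Nat.pow_le_pow_right (by omega) (Nat.le_mul_of_pos_right _ hsb)).trans_lt hW
      obtain ⟨t, τ, he, ht, hτ⟩ := exec_compile hL a d σ X hX hr hm hWa hwf.2.1 hb
      set r : ℕ → ℕ := fun x => σ.reg (2 * x) with hrdef
      set va := a.eval σ.mem r with hva
      have hXa : X ≤ X ^ a.size := Nat.le_self_pow (by omega) X
      have hvle : va ≤ X ^ a.size := a.eval_le hX hm le_rfl hr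
      set τ₁ : Store := ⟨Function.update (Function.update τ.reg (2 * (d + 1) + 1) (r x)) (2 * x) va,
        τ.mem⟩ with hτ₁
      have hreg : (fun y => τ₁.reg (2 * y)) = Function.update r x va := by
        funext y
        simp only [hτ₁, Function.update_apply]
        by_cases h : y = x
        · rw [if_pos (by omega), if_pos h]
        · rw [if_neg (by omega), if_neg (by omega), if_neg h, hτ.even]
      rw [pow_mul] at hW
      -- The body runs under the enlarged bound `X ^ a.size`; the bound L on sum ranges is
      -- unaffected, since the variable defined lies below 20.
      obtain ⟨t', τ', he', ht', hτ'⟩ := exec_compile hL b (d + 2) τ₁ (X ^ a.size) (hX.trans hXa)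
        (fun y => by
          rw [congrFun hreg y, Function.update_apply]
          split
          · exact hvle
          · exact (hr y).trans hXa)
        (fun y => by simp only [hτ₁, hτ.mem]; exact (hm y).trans hXa) hW
        hwf.2.2
        (fun y hy hy' => by
          rw [congrFun hreg y, Function.update_apply, if_neg (by have := hwf.1; omega)]
          exact hb y hy hy')
      have hval := hτ'.val
      rw [hreg, show τ₁.mem = σ.mem from hτ.mem] at hval
      have hs := hτ'.odd (d + 1) (by omega)
      have hs' : τ₁.reg (2 * (d + 1) + 1) = r x := by
        simp only [hτ₁, Function.update_apply]
        rw [if_neg (by omega), if_pos trivial]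
      have hWX : X < 2 ^ W := (hXa.trans (Nat.le_self_pow (by omega) _)).trans_lt hW
      refine ⟨_, _, .seq he (.seq (.assign _ _ _ ?_) (.seq (.assign _ _ _ ?_)
        (.seq (t₁ := t') (τ := τ') ?_ (.seq (.assign _ _ _ ?_) (.assign _ _ _ ?_))))), ?_, ?_⟩
      · simp only [Expr.Fits, hτ.even]; exact (hr x).trans_lt hWX
      · simp only [Expr.Fits, Function.update_apply]
        rw [if_neg (by omega), hτ.val]; exact hvle.trans_lt hWa
      · convert he' using 1
        simp only [hτ₁, Expr.eval, hτ.even, Function.update_apply]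
        rw [if_neg (by omega), hτ.val]
      · simp only [Expr.Fits, hval]
        refine (b.eval_le (hX) hm hXa fun y => ?_).trans_lt hW
        rw [Function.update_apply]
        split
        · exact hvle
        · exact (hr y).trans hXa
      · simp only [Expr.Fits, Function.update_apply]
        rw [if_neg (by omega), hs, hs']; exact (hr x).trans_lt hWX
      · simp only [Expr.cost, time]
        have h1 := add_le_pow_add (X := L) (by omega) a.time_pos b.time_pos
        have h2 : L ≤ L ^ (a.time + b.time) := Nat.le_self_pow (by have := a.time_pos; omega) L
        have h3 : 2 ≤ L ^ 2 := by nlinarith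
        have h4 := Nat.mul_le_mul_left (L ^ (a.time + b.time)) h3
        rw [pow_add]
        linarith
      · constructor
        · exact hτ'.mem.trans hτ.mem
        · intro y
          simp only [Expr.eval, Function.update_apply]
          by_cases h : y = x
          · subst h
            rw [if_pos rfl, if_neg (by omega), hs, hs']
          · rw [if_neg (by omega), if_neg (by omega), congrFun (funext hτ'.even) y,
              congrFun hreg y, Function.update_apply, if_neg h]
        · intro i hi
          simp only [Function.update_apply]
          rw [if_neg (by omega), if_neg (by omega), hτ'.odd _ (by omega)]
          simp only [hτ₁, Function.update_apply]
          rw [if_neg (by omega), if_neg (by omega), hτ.odd _ (by omega)]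
        · simp only [Expr.eval, Function.update_apply]
          rw [if_neg (by omega), if_pos trivial, hval, eval]

/-! ### A loop language and its Hoare logic -/

/-- Statements: assignments to variables and memory cells, branching and bounded loops. -/
inductive Stm where
  | skip
  | asg (x : ℕ) (e : SExpr)
  | put (a e : SExpr)
  | seq (p q : Stm)
  | ite (e : SExpr) (p q : Stm)
  | loop (x n : ℕ) (p : Stm)

namespace Stm

/-- The exponent for the word length: words are long enough for the statement once `X ^ p.size < 2 ^
W`. The summand for loops makes room for X itself, with which the counter is compared. -/
def size : Stm → ℕ
  | skip => 1
  | asg _ e => e.size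
  | put a e => a.size + e.size
  | seq p q => p.size + q.size
  | ite e p q => e.size + p.size + q.size
  | loop _ _ p => p.size + 2

/-- Variables are the even registers, and every expression is evaluated into scratch register 1, or
3 for the second operand of a store. A statement thus never depends on earlier scratch contents,
which is why the logic below only sees the even registers and the memory. -/
def compile : Stm → Prog
  | skip => .skip
  | asg x e => .seq (e.compile 0) (.assign (2 * x) (.reg 1))
  | put a e => .seq (a.compile 0) (.seq (e.compile 1) (.store (.reg 1) (.reg 3)))
  | seq p q => .seq p.compile q.compile
  | ite e p q => .seq (e.compile 0) (.ite (.reg 1) p.compile q.compile)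
  | loop x n p => .seq (.assign (2 * x) (.const 0))
      (.while (.op .lt (.reg (2 * x)) (.reg (2 * n)))
        (.seq p.compile (.assign (2 * x) (.op .add (.reg (2 * x)) (.const 1)))))

end Stm

/-- The store after an assignment to a variable. -/
def Store.setReg (s : Store) (x v : ℕ) : Store := ⟨Function.update s.reg x v, s.mem⟩

/-- The store after an assignment to a memory cell. -/
def Store.setMem (s : Store) (a v : ℕ) : Store := ⟨s.reg, Function.update s.mem a v⟩

/-- All variables and memory cells are at most `X`, the variables that bound sums at most `L`. -/
structure Store.Le (X L : ℕ) (s : Store) : Prop where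
  reg : ∀ x, s.reg x ≤ X
  mem : ∀ a, s.mem a ≤ X
  bnd : ∀ x, 20 ≤ x → x < 30 → s.reg x ≤ L

/-- Started in `s`, the compiled statement halts within `T` steps in a store satisfying `post`. -/
def Runs (X : ℕ) (p : Stm) (T : ℕ) (s : Store) (post : Store → Prop) : Prop :=
  ∀ W, X ^ p.size < 2 ^ W → ∀ σ : Store, σ.user = s →
    ∃ t τ, Exec W p.compile σ t τ ∧ t ≤ T ∧ post τ.user

namespace Runs

variable {X L T T' : ℕ} {s : Store} {post mid : Store → Prop}

theorem weaken (h : Runs X p T s post) (hT : T ≤ T') {post' : Store → Prop}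
    (hp : ∀ s, post s → post' s) : Runs X p T' s post' := fun W hW σ hσ =>
  let ⟨t, τ, he, ht, hτ⟩ := h W hW σ hσ
  ⟨t, τ, he, ht.trans hT, hp _ hτ⟩

theorem skip (h : post s) : Runs X .skip 1 s post := fun _ _ σ hσ =>
  ⟨1, σ, .skip σ, le_rfl, hσ ▸ h⟩

theorem asg (hX : 2 ≤ X) (hL : 16 ≤ L) {x : ℕ} {e : SExpr} (hs : s.Le X L) (hwf : e.WF)
    (h : post (s.setReg x (e.eval s.mem s.reg))) :
    Runs X (.asg x e) (L ^ e.time + 2) s post := by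
  rintro W hW σ rfl
  obtain ⟨t, τ, he, ht, hτ⟩ := e.exec_compile hL 0 σ X hX hs.reg hs.mem hW hwf hs.bnd
  refine ⟨_, _, .seq he (.assign _ _ _ ?_), ?_, ?_⟩
  · simp only [Expr.Fits, hτ.val]
    exact (e.eval_le hX hs.mem le_rfl hs.reg).trans_lt hW
  · simp only [Expr.cost]; omega
  · convert h using 1
    simp only [Store.user, Store.setReg, Store.mk.injEq]
    refine ⟨?_, hτ.mem⟩
    funext y
    simp only [Function.update_apply, Expr.eval]
    by_cases hy : y = x
    · rw [if_pos (by omega), if_pos hy]; exact hτ.val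
    · rw [if_neg (by omega), if_neg hy]; exact hτ.even y

theorem put (hX : 2 ≤ X) (hL : 16 ≤ L) {a e : SExpr} (hs : s.Le X L) (hwa : a.WF) (hwe : e.WF)
    (h : post (s.setMem (a.eval s.mem s.reg) (e.eval s.mem s.reg))) :
    Runs X (.put a e) (L ^ a.time + L ^ e.time + 3) s post := by
  rintro W hW σ rfl
  simp only [Stm.size] at hW
  have hWa : X ^ a.size < 2 ^ W := (Nat.pow_le_pow_right (by omega) (by omega)).trans_lt hW
  have hWe : X ^ e.size < 2 ^ W := (Nat.pow_le_pow_right (by omega) (by omega)).trans_lt hW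
  obtain ⟨t, τ, he, ht, hτ⟩ := a.exec_compile hL 0 σ X hX hs.reg hs.mem hWa hwa hs.bnd
  have hre : (fun x => τ.reg (2 * x)) = σ.user.reg := funext hτ.even
  obtain ⟨t', τ', he', ht', hτ'⟩ := e.exec_compile hL 1 τ X hX
    (fun x => by rw [congrFun hre x]; exact hs.reg x) (fun x => by rw [hτ.mem]; exact hs.mem x)
    hWe hwe (fun x => by rw [congrFun hre x]; exact hs.bnd x)
  have h1 : τ'.reg 1 = a.eval σ.mem σ.user.reg := (hτ'.odd 0 (by omega)).trans hτ.val
  have h3 : τ'.reg 3 = e.eval σ.mem σ.user.reg := by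
    have := hτ'.val
    rwa [hτ.mem, hre] at this
  refine ⟨_, _, .seq he (.seq he' (.store _ _ _ ?_ ?_)), ?_, ?_⟩
  · simp only [Expr.Fits, h1]
    exact (a.eval_le hX hs.mem le_rfl hs.reg).trans_lt hWa
  · simp only [Expr.Fits, h3]
    exact (e.eval_le hX hs.mem le_rfl hs.reg).trans_lt hWe
  · simp only [Expr.cost]; omega
  · convert h using 1
    simp only [Store.user, Store.setMem, Store.mk.injEq, Expr.eval, h1, h3, hτ'.mem, hτ.mem]
    exact ⟨funext fun x => (hτ'.even x).trans (hτ.even x), trivial⟩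

theorem seq {p q : Stm} (hX : 2 ≤ X) (hp : Runs X p T s mid)
    (hq : ∀ s', mid s' → Runs X q T' s' post) : Runs X (.seq p q) (T + T') s post := by
  rintro W hW σ hσ
  simp only [Stm.size] at hW
  obtain ⟨t, τ, he, ht, hτ⟩ := hp W
    ((Nat.pow_le_pow_right (by omega) (by omega)).trans_lt hW) σ hσ
  obtain ⟨t', τ', he', ht', hτ'⟩ := hq _ hτ W
    ((Nat.pow_le_pow_right (by omega) (by omega)).trans_lt hW) τ rfl
  exact ⟨_, τ', .seq he he', by omega, hτ'⟩

theorem ite (hX : 2 ≤ X) (hL : 16 ≤ L) {e : SExpr} {p q : Stm} (hs : s.Le X L) (hwf : e.WF)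
    (hp : e.eval s.mem s.reg ≠ 0 → Runs X p T s post)
    (hq : e.eval s.mem s.reg = 0 → Runs X q T s post) :
    Runs X (.ite e p q) (L ^ e.time + 2 + T) s post := by
  rintro W hW σ rfl
  simp only [Stm.size] at hW
  have hWe : X ^ e.size < 2 ^ W := (Nat.pow_le_pow_right (by omega) (by omega)).trans_lt hW
  obtain ⟨t, τ, he, ht, hτ⟩ := e.exec_compile hL 0 σ X hX hs.reg hs.mem hWe hwf hs.bnd
  have hu : τ.user = σ.user := by
    simp only [Store.user, hτ.mem, Store.mk.injEq, and_true]
    exact funext hτ.even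
  have hf : (Expr.reg 1).Fits W τ := by
    have := hτ.val
    simp only [Expr.Fits]
    rw [show τ.reg 1 = _ from hτ.val]
    exact (e.eval_le hX hs.mem le_rfl hs.reg).trans_lt hWe
  by_cases h0 : e.eval σ.user.mem σ.user.reg = 0
  · obtain ⟨t', τ', he', ht', hτ'⟩ := hq h0 W
      ((Nat.pow_le_pow_right (by omega) (by omega)).trans_lt hW) τ hu
    refine ⟨_, τ', .seq he (.iteFalse hf (hτ.val.trans h0) he'), ?_, hτ'⟩
    simp only [Expr.cost]; omega
  · obtain ⟨t', τ', he', ht', hτ'⟩ := hp h0 W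
      ((Nat.pow_le_pow_right (by omega) (by omega)).trans_lt hW) τ hu
    refine ⟨_, τ', .seq he (.iteTrue hf (fun h => h0 (hτ.val.symm.trans h)) he'), ?_, hτ'⟩
    simp only [Expr.cost]; omega

/-- The rule for loops: `Inv i` is the invariant before the iteration with value `i` of the loop
variable `x`; it may not depend on the value of `x` itself. -/
theorem loop (hX : 2 ≤ X) {x n N : ℕ} {p : Stm} (Inv : ℕ → Store → Prop) (hn : s.reg n = N)
    (hNX : N ≤ X) (hxn : x ≠ n) (h0 : Inv 0 (s.setReg x 0))
    (hstep : ∀ i < N, ∀ s, s.reg x = i → s.reg n = N → Inv i s →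
      Runs X p T s fun s' => s'.reg x = i ∧ s'.reg n = N ∧ Inv (i + 1) (s'.setReg x (i + 1)))
    (hpost : ∀ s', s'.reg x = N → s'.reg n = N → Inv N s' → post s') :
    Runs X (.loop x n p) (N * (T + 8) + 8) s post := by
  rintro W hW σ rfl
  simp only [Stm.size] at hW
  have hWp : X ^ p.size < 2 ^ W := (Nat.pow_le_pow_right (by omega) (by omega)).trans_lt hW
  have hWX : X < 2 ^ W := lt_of_le_of_lt (Nat.le_self_pow (by omega) X) hW
  have hW0 : 0 < W := by
    rcases Nat.eq_zero_or_pos W with h | h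
    · subst h; simp at hWX; omega
    · exact h
  -- Induction on the number j of remaining iterations; the body has to preserve both the counter
  -- and the bound.
  have main : ∀ j i (τ : Store), i + j = N → τ.user.reg x = i → τ.user.reg n = N →
      Inv i τ.user → ∃ t τ', Exec W (.while (.op .lt (.reg (2 * x)) (.reg (2 * n)))
        (.seq p.compile (.assign (2 * x) (.op .add (.reg (2 * x)) (.const 1))))) τ t τ' ∧
        t ≤ j * (T + 8) + 4 ∧ post τ'.user := by
    intro j
    induction j with
    | zero =>
      intro i τ hi hx hn' hI
      refine ⟨_, τ, .whileFalse ?_ ?_, ?_, ?_⟩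
      · have h1 : τ.reg (2 * x) = i := hx
        have h2 : τ.reg (2 * n) = N := hn'
        simp only [Expr.Fits, Expr.eval, h1, h2]
        exact ⟨by omega, by omega, BinOp.lt_fits hW0 _ _⟩
      · have h1 : τ.reg (2 * x) = i := hx
        have h2 : τ.reg (2 * n) = N := hn'
        simp [Expr.eval, BinOp.eval, h1, h2]; omega
      · simp [Expr.cost]
      · have : i = N := by omega
        subst this
        exact hpost _ hx hn' hI
    | succ j ih =>
      intro i τ hi hx hn' hI
      obtain ⟨t, τ₁, he, ht, h1, h2, h3⟩ := hstep i (by omega) _ hx hn' hI W hWp τ rfl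
      have hu : (Store.mk (Function.update τ₁.reg (2 * x) (i + 1)) τ₁.mem).user
          = τ₁.user.setReg x (i + 1) := by
        simp only [Store.user, Store.setReg, Store.mk.injEq, and_true]
        funext y
        simp only [Function.update_apply]
        by_cases hy : y = x
        · rw [if_pos (by omega), if_pos hy]
        · rw [if_neg (by omega), if_neg hy]
      obtain ⟨t', τ', he', ht', hτ'⟩ := ih (i + 1)
        ⟨Function.update τ₁.reg (2 * x) (i + 1), τ₁.mem⟩ (by omega)
        (by simp [Store.user])
        (by rw [hu]; simpa [Store.setReg, Function.update_apply, Ne.symm hxn])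
        (by rw [hu]; exact h3)
      have hx1 : τ.reg (2 * x) = i := hx
      have hn1 : τ.reg (2 * n) = N := hn'
      have hx2 : τ₁.reg (2 * x) = i := h1
      refine ⟨_, τ', .whileTrue (t₂ := t') ?_ ?_ (.seq he (.assign _ _ _ ?_)) ?_, ?_, hτ'⟩
      · simp only [Expr.Fits, Expr.eval, hx1, hn1]
        exact ⟨by omega, by omega, BinOp.lt_fits hW0 _ _⟩
      · simp [Expr.eval, BinOp.eval, hx1, hn1]; omega
      · simp only [Expr.Fits, Expr.eval, BinOp.eval, hx2]
        exact ⟨by omega, by omega, by omega⟩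
      · simp only [Expr.eval, BinOp.eval, hx2]; exact he'
      · simp only [Expr.cost]
        rw [Nat.succ_mul]
        omega
  have hu : (Store.mk (Function.update σ.reg (2 * x) 0) σ.mem).user = σ.user.setReg x 0 := by
    simp only [Store.user, Store.setReg, Store.mk.injEq, and_true]
    funext y
    simp only [Function.update_apply]
    by_cases hy : y = x
    · rw [if_pos (by omega), if_pos hy]
    · rw [if_neg (by omega), if_neg hy]
  obtain ⟨t, τ, he, ht, hτ⟩ := main N 0 ⟨Function.update σ.reg (2 * x) 0, σ.mem⟩ (by omega)
    (by simp [Store.user])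
        (by rw [hu]; simpa [Store.setReg, Function.update_apply, Ne.symm hxn])
    (by rw [hu]; exact h0)
  refine ⟨_, τ, .seq (.assign _ _ _ ?_) he, ?_, hτ⟩
  · simp [Expr.Fits]
  · simp only [Expr.cost]; omega

end Runs

/-! ### Deterministic runs of ODDs on sets of states coded as numbers -/

section Runs

variable {Sig : Type u} {w : ℕ}

/-- Some state in the set coded by `S`, or some initial state, has an `a`-transition to `q`. -/
def Layer.Hit (L : Layer Sig w) (S : ℕ) (a : Sig) (q : Fin w) : Prop :=
  ∃ p : Fin w, (S.testBit p ∨ p ∈ L.initStates) ∧ (p, a, q) ∈ L.trans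

open Classical in
/-- The code of the set of states reached from the set coded by `S`; after a layer with final flag
it is replaced by the truth value of acceptance. -/
noncomputable def Layer.next (L : Layer Sig w) (S : ℕ) (a : Sig) : ℕ :=
  if L.finFlag then truthBit (∃ q, L.Hit S a q ∧ q ∈ L.finStates)
  else ∑ q : Fin w, truthBit (L.Hit S a q) * 2 ^ (q : ℕ)

theorem truthBit_le (P : Prop) : truthBit P ≤ 1 := by unfold truthBit; split <;> simp

theorem truthBit_eq_one {P : Prop} : truthBit P = 1 ↔ P := by unfold truthBit; split <;> simp_all

theorem truthBit_eq_zero {P : Prop} : truthBit P = 0 ↔ ¬P := by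
  unfold truthBit; split <;> simp_all

theorem truthBit_congr {P P' : Prop} (h : P ↔ P') : truthBit P = truthBit P' := by rw [propext h]

theorem sum_bits_lt (f : ℕ → ℕ) (hf : ∀ q, f q ≤ 1) (w : ℕ) :
    ∑ q ∈ Finset.range w, f q * 2 ^ q < 2 ^ w := by
  induction w with
  | zero => simp
  | succ w ih =>
    rw [Finset.sum_range_succ, pow_succ]
    have := Nat.mul_le_mul_right (2 ^ w) (hf w)
    omega

theorem testBit_sum_bits (f : ℕ → ℕ) (hf : ∀ q, f q ≤ 1) (w i : ℕ) :
    (∑ q ∈ Finset.range w, f q * 2 ^ q).testBit i = true ↔ i < w ∧ f i = 1 := by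
  induction w with
  | zero => simp
  | succ w ih =>
    have hlt := sum_bits_lt f hf w
    rw [Finset.sum_range_succ]
    set x := ∑ q ∈ Finset.range w, f q * 2 ^ q
    rcases Nat.le_one_iff_eq_zero_or_eq_one.1 (hf w) with h | h
    · rw [h, zero_mul, add_zero, ih]
      constructor
      · rintro ⟨h1, h2⟩; exact ⟨by omega, h2⟩
      · rintro ⟨h1, h2⟩
        refine ⟨?_, h2⟩
        rcases Nat.lt_succ_iff_lt_or_eq.1 h1 with h3 | h3
        · exact h3
        · subst h3; omega
    · rw [h, one_mul, add_comm]
      rcases lt_trichotomy i w with h1 | h1 | h1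
      · rw [Nat.testBit_two_pow_add_gt h1, ih]
        constructor
        · rintro ⟨h1, h2⟩; exact ⟨by omega, h2⟩
        · rintro ⟨_, h2⟩; exact ⟨h1, h2⟩
      · subst h1
        rw [Nat.testBit_two_pow_add_eq, Nat.testBit_lt_two_pow hlt]
        simp [h]
      · rw [Nat.testBit_lt_two_pow]
        · simp; omega
        · have : 2 ^ (w + 1) ≤ 2 ^ i := Nat.pow_le_pow_right (by omega) (by omega)
          rw [pow_succ] at this; omega

theorem Layer.sum_hit_eq (L : Layer Sig w) (S : ℕ) (a : Sig) :
    ∑ q : Fin w, truthBit (L.Hit S a q) * 2 ^ (q : ℕ) =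
      ∑ q ∈ Finset.range w, truthBit (∃ h : q < w, L.Hit S a ⟨q, h⟩) * 2 ^ q := by
  rw [Finset.sum_range]
  refine Finset.sum_congr rfl fun q _ => ?_
  congr 1
  exact truthBit_congr ⟨fun h => ⟨q.2, h⟩, fun ⟨_, h⟩ => h⟩

/-- Positivity of w is needed for layers with final flag, whose result can be the truth value 1. -/
theorem Layer.next_lt (L : Layer Sig w) (hw : 0 < w) (S : ℕ) (a : Sig) : L.next S a < 2 ^ w := by
  unfold next
  split
  · have h1 : 1 < 2 ^ w := Nat.one_lt_two_pow (by omega)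
    exact (truthBit_le _).trans_lt h1
  · rw [L.sum_hit_eq]
    exact sum_bits_lt _ (fun _ => truthBit_le _) w

theorem Layer.testBit_next (L : Layer Sig w) (hL : L.finFlag = false) (S : ℕ) (a : Sig)
    (q : Fin w) : (L.next S a).testBit q = true ↔ L.Hit S a q := by
  unfold next
  rw [if_neg (by simp [hL]), L.sum_hit_eq, testBit_sum_bits _ (fun _ => truthBit_le _),
    truthBit_eq_one]
  exact ⟨fun ⟨_, _, h⟩ => h, fun h => ⟨q.2, q.2, h⟩⟩

/-- The code of the set reached from the set coded by `S` by reading `x`. -/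
noncomputable def runLayers (D : List (Layer Sig w)) (S : ℕ) (x : List Sig) : ℕ :=
  (D.zip x).foldl (fun S t => t.1.next S t.2) S

@[simp] theorem runLayers_nil (S : ℕ) (x : List Sig) :
    runLayers ([] : List (Layer Sig w)) S x = S := rfl

@[simp] theorem runLayers_cons (L : Layer Sig w) (D) (S : ℕ) (a : Sig) (x : List Sig) :
    runLayers (L :: D) S (a :: x) = runLayers D (L.next S a) x := rfl

theorem runLayers_concat (D : List (Layer Sig w)) (L : Layer Sig w) (S : ℕ) (a : Sig)
    (x : List Sig) (h : D.length = x.length) :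
    runLayers (D ++ [L]) S (x ++ [a]) = L.next (runLayers D S x) a := by
  simp [runLayers, List.zip_append h]

theorem runLayers_lt (hw : 0 < w) (D : List (Layer Sig w)) (S : ℕ) (hS : S < 2 ^ w)
    (x : List Sig) : runLayers D S x < 2 ^ w := by
  induction D generalizing S x with
  | nil => simpa
  | cons L D ih =>
    cases x with
    | nil => simpa [runLayers]
    | cons a x => exact ih _ (L.next_lt hw S a) x

/-- The start set S is arbitrary so that the induction can consume the first layer. Initial states
count in every layer by the definition of `Layer.Hit`; this is harmless because only the head has
any. The last layer turns the set reached into the truth value of acceptance. -/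
theorem runLayers_eq_truthBit (D : List (Layer Sig w)) (hne : D ≠ []) (S : ℕ) (x : List Sig)
    (hx : x.length = D.length)
    (hfin : ∀ (i : ℕ) (h : i < D.length), D[i].finFlag = true ↔ i + 1 = D.length)
    (hinit : ∀ (i : ℕ) (h : i < D.length), i ≠ 0 → D[i].initStates = ∅) :
    runLayers D S x = truthBit (∃ p : ℕ → Fin w,
      (S.testBit (p 0) = true ∨ p 0 ∈ (D.head hne).initStates) ∧
      p D.length ∈ (D.getLast hne).finStates ∧
      ∀ (i : ℕ) (h : i < D.length), (p i, x[i], p (i + 1)) ∈ D[i].trans) := by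
  induction D generalizing S x with
  | nil => exact absurd rfl hne
  | cons L D ih =>
    obtain _ | ⟨a, x⟩ := x
    · simp at hx
    rw [runLayers_cons]
    by_cases hD : D = []
    · subst hD
      obtain rfl : x = [] := by simpa using hx
      have hL : L.finFlag = true := by simpa using hfin 0 (by simp)
      simp only [runLayers_nil, Layer.next, hL, if_true]
      refine truthBit_congr ⟨?_, ?_⟩
      · rintro ⟨q, ⟨p, hp, hpq⟩, hq⟩
        refine ⟨fun i => if i = 0 then p else q, by simpa using hp, by simpa using hq, ?_⟩
        intro i hi
        obtain rfl : i = 0 := by simpa using hi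
        simpa using hpq
      · rintro ⟨p, h1, h2, h3⟩
        exact ⟨p 1, ⟨p 0, by simpa using h1, by simpa using h3 0 (by simp)⟩, by simpa using h2⟩
    · have hpos : 0 < D.length := List.length_pos_iff.2 hD
      have hL : L.finFlag = false := by
        have := hfin 0 (by simp)
        simp only [List.length_cons, List.getElem_cons_zero] at this
        rw [← Bool.not_eq_true, this]; omega
      rw [ih hD _ x (by simpa using hx)
        (fun i h => by
          have := hfin (i + 1) (by simpa using h)
          simpa using this)
        (fun i h _ => hinit (i + 1) (by simpa using h) (by omega))]
      have hhead : (D.head hD).initStates = ∅ := by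
        rw [List.head_eq_getElem]
        exact hinit 1 (by simpa using hpos) (by omega)
      refine truthBit_congr ⟨?_, ?_⟩
      · rintro ⟨p, h1, h2, h3⟩
        rw [hhead] at h1
        simp only [Finset.notMem_empty, or_false] at h1
        rw [L.testBit_next hL] at h1
        obtain ⟨p0, h0, h01⟩ := h1
        -- Prepend to the run of the tail the state that witnesses the first hit.
        refine ⟨fun i => if i = 0 then p0 else p (i - 1), by simpa using h0, ?_, ?_⟩
        · rw [List.getLast_cons hD]; simpa using h2
        · intro i hi
          obtain _ | i := i
          · simpa using h01
          · simpa using h3 i (by simpa using hi)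
      · rintro ⟨p, h1, h2, h3⟩
        refine ⟨fun i => p (i + 1), .inl ?_, ?_, ?_⟩
        · rw [L.testBit_next hL]
          exact ⟨p 0, by simpa using h1, h3 0 (by simp)⟩
        · rw [List.getLast_cons hD] at h2; simpa using h2
        · intro i hi
          exact h3 (i + 1) (by simpa using hi)

/-- The run starts with the code 0 of the empty set, since the initial states enter with the first
layer. -/
theorem IsODD.runLayers_eq {D : List (Layer Sig w)} (hD : IsODD D) (x : List Sig)
    (hx : x.length = D.length) : runLayers D 0 x = truthBit (ODDAccepts D x) := by
  rw [runLayers_eq_truthBit D hD.ne_nil 0 x hx hD.finFlag_iff]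
  · refine truthBit_congr ⟨?_, ?_⟩
    · rintro ⟨p, h1, h2, h3⟩
      exact ⟨hx, hD.ne_nil, p, by simpa using h1, h2, h3⟩
    · rintro ⟨hlen, hne, p, h1, h2, h3⟩
      exact ⟨p, .inr h1, h2, h3⟩
  · intro i h h0
    refine D[i].initFlag_false ?_
    rw [← Bool.not_eq_true, hD.initFlag_iff]
    exact h0

theorem IsODD.oddLang_eq_iff {D B : List (Layer Sig w)} (hD : IsODD D) (hB : IsODD B) :
    oddLang D = oddLang B ↔ D.length = B.length ∧
      ∀ x : List Sig, x.length = B.length → runLayers D 0 x = runLayers B 0 x := by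
  simp only [oddLang, Prod.mk.injEq]
  refine and_congr_right fun hl => ?_
  constructor
  · intro h x hx
    rw [hD.runLayers_eq x (hx.trans hl.symm), hB.runLayers_eq x hx]
    exact truthBit_congr (Set.ext_iff.1 h x)
  · intro h
    ext x
    change ODDAccepts D x ↔ ODDAccepts B x
    by_cases hx : x.length = B.length
    · have := h x hx
      rw [hD.runLayers_eq x (hx.trans hl.symm), hB.runLayers_eq x hx] at this
      rw [← truthBit_eq_one (P := ODDAccepts D x), this, truthBit_eq_one]
    · constructor
      · rintro ⟨h1, _⟩; exact absurd (h1.trans hl) hx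
      · rintro ⟨h1, _⟩; exact absurd h1 hx

end Runs

/-! ### Colourings that witness the equality of two languages -/

section Colouring

variable {Sig : Type u} {w : ℕ}

/-- The colour of `u` in the colouring with code `c`. -/
def colour (w c u : ℕ) : ℕ := c / 2 ^ ((w + 1) * u) % (2 * 2 ^ w)

/-- The number of (codes of) colourings. -/
def numColourings (w : ℕ) : ℕ := 2 ^ ((w + 1) * (2 * 2 ^ w))

/-- Use the values of f as digits in base `2 ^ b`. This makes a colouring a single number and makes
the enumeration of all colourings a loop over an interval. -/
theorem exists_code (b : ℕ) (f : ℕ → ℕ) (n : ℕ) (hf : ∀ u < n, f u < 2 ^ b) :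
    ∃ c < 2 ^ (b * n), ∀ u < n, c / 2 ^ (b * u) % 2 ^ b = f u := by
  induction n with
  | zero => exact ⟨0, by simp, by simp⟩
  | succ n ih =>
    obtain ⟨c, hc, h⟩ := ih fun u hu => hf u (by omega)
    refine ⟨c + 2 ^ (b * n) * f n, ?_, fun u hu => ?_⟩
    · have h1 := hf n (by omega)
      calc c + 2 ^ (b * n) * f n < 2 ^ (b * n) * (f n + 1) := by rw [mul_add]; omega
        _ ≤ 2 ^ (b * n) * 2 ^ b := Nat.mul_le_mul_left _ h1
        _ = _ := by rw [← pow_add]; rfl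
    · rcases Nat.lt_succ_iff_lt_or_eq.1 hu with h1 | rfl
      · rw [← h u h1]
        obtain ⟨d, rfl⟩ := Nat.exists_eq_add_of_lt h1
        rw [show b * (u + d + 1) = b * u + (b * d + b) by ring, pow_add, mul_assoc,
          Nat.add_mul_div_left _ _ (by positivity), pow_add,
          show 2 ^ (b * d) * 2 ^ b * f (u + d + 1) = 2 ^ b * (2 ^ (b * d) * f (u + d + 1)) by ring,
          Nat.add_mul_mod_self_left]
      · rw [Nat.add_mul_div_left _ _ (by positivity), Nat.div_eq_of_lt hc, zero_add,
          Nat.mod_eq_of_lt (hf u (by omega))]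

theorem exists_colouring (w : ℕ) (f : ℕ → ℕ) (hf : ∀ u < 2 * 2 ^ w, f u < 2 * 2 ^ w) :
    ∃ c < numColourings w, ∀ u < 2 * 2 ^ w, colour w c u = f u := by
  have h2 : 2 * 2 ^ w = 2 ^ (w + 1) := by rw [pow_succ, mul_comm]
  unfold colour numColourings
  rw [h2] at hf ⊢
  exact exists_code (w + 1) f (2 ^ (w + 1)) hf

/-- A step of the disjoint union of the two deterministic automata. -/
noncomputable def pairNext (LB LD : Layer Sig w) (a : Sig) (u : ℕ) : ℕ :=
  if u < 2 ^ w then LB.next u a else 2 ^ w + LD.next (u - 2 ^ w) a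

/-- A run of the disjoint union of the two deterministic automata. -/
noncomputable def pairRun (B D : List (Layer Sig w)) (u : ℕ) (x : List Sig) : ℕ :=
  if u < 2 ^ w then runLayers B u x else 2 ^ w + runLayers D (u - 2 ^ w) x

theorem pairNext_lt (hw : 0 < w) (LB LD : Layer Sig w) (a : Sig) (u : ℕ) :
    pairNext LB LD a u < 2 * 2 ^ w := by
  unfold pairNext
  have h1 := LB.next_lt hw u a
  have h2 := LD.next_lt hw (u - 2 ^ w) a
  split <;> omega

/-- A step stays in its own half of the disjoint union: successors in the first automaton remain
below `2 ^ w`. -/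
theorem pairRun_cons (hw : 0 < w) (LB LD : Layer Sig w) (B D : List (Layer Sig w)) (u : ℕ) (a : Sig)
    (x : List Sig) :
    pairRun (LB :: B) (LD :: D) u (a :: x) = pairRun B D (pairNext LB LD a u) x := by
  have h1 := LB.next_lt hw u a
  unfold pairRun pairNext
  by_cases h : u < 2 ^ w
  · simp [h, h1]
  · simp [h]

/-- The colours of successors are determined by the colour of a state. -/
def Compatible (LB LD : Layer Sig w) (c c' : ℕ) : Prop :=
  ∀ u < 2 * 2 ^ w, ∀ v < 2 * 2 ^ w, ∀ a : Sig, colour w c u = colour w c v →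
    colour w c' (pairNext LB LD a u) = colour w c' (pairNext LB LD a v)

/-- The two start states have the same colour. -/
def ColourInitial (w c : ℕ) : Prop := colour w c 0 = colour w c (2 ^ w)

/-- Only states with the same result have the same colour. -/
def ColourFinal (w c : ℕ) : Prop :=
  ∀ u < 2 * 2 ^ w, ∀ v < 2 * 2 ^ w, colour w c u = colour w c v → u % 2 ^ w = v % 2 ^ w

/-- The states `u` and `v` have the same results on all strings. -/
def ResidualEq (B D : List (Layer Sig w)) (u v : ℕ) : Prop :=
  ∀ x : List Sig, x.length = B.length → pairRun B D u x % 2 ^ w = pairRun B D v x % 2 ^ w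

-- Colour each state by the least number with the same residual. This number is at most the state
-- itself, so there are enough colours.
open Classical in
theorem exists_residual_colouring (B D : List (Layer Sig w)) :
    ∃ c < numColourings w, ∀ u < 2 * 2 ^ w, ∀ v < 2 * 2 ^ w,
      (colour w c u = colour w c v ↔ ResidualEq B D u v) := by
  have hex : ∀ u, ∃ v, ResidualEq B D u v := fun u => ⟨u, fun _ _ => rfl⟩
  obtain ⟨c, hc, h⟩ := exists_colouring w (fun u => Nat.find (hex u)) fun u hu =>
    (Nat.find_min' (hex u) (fun _ _ => rfl)).trans_lt hu
  refine ⟨c, hc, fun u hu v hv => ?_⟩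
  rw [h u hu, h v hv]
  constructor
  · intro he x hx
    have h1 := Nat.find_spec (hex u) x hx
    have h2 := Nat.find_spec (hex v) x hx
    rw [h1, h2, he]
  · intro he
    congr 1
    funext y
    exact propext ⟨fun h x hx => (he x hx).symm.trans (h x hx), fun h x hx =>
      (he x hx).trans (h x hx)⟩

/-- The colouring by residuals. -/
noncomputable def residualColouring (B D : List (Layer Sig w)) : ℕ :=
  (exists_residual_colouring B D).choose

theorem residualColouring_lt (B D : List (Layer Sig w)) :
    residualColouring B D < numColourings w :=
  (exists_residual_colouring B D).choose_spec.1

theorem colour_residualColouring (B D : List (Layer Sig w)) {u v : ℕ} (hu : u < 2 * 2 ^ w)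
    (hv : v < 2 * 2 ^ w) : colour w (residualColouring B D) u = colour w (residualColouring B D) v ↔
      ResidualEq B D u v :=
  (exists_residual_colouring B D).choose_spec.2 u hu v hv

/-- Residuals are right invariant: a word that separates two a-successors yields, with a in front, a
word that separates the states. -/
theorem compatible_residualColouring (hw : 0 < w) (LB LD : Layer Sig w)
    (B D : List (Layer Sig w)) : Compatible LB LD (residualColouring (LB :: B) (LD :: D))
      (residualColouring B D) := by
  intro u hu v hv a h
  rw [colour_residualColouring _ _ hu hv] at h
  rw [colour_residualColouring _ _ (pairNext_lt hw ..) (pairNext_lt hw ..)]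
  intro x hx
  have := h (a :: x) (by simpa using hx)
  rwa [pairRun_cons hw, pairRun_cons hw] at this

/-- After the last layer only the empty word is left, and the residual of a state is its own value
without the tag for its half. -/
theorem colourFinal_residualColouring :
    ColourFinal w (residualColouring ([] : List (Layer Sig w)) []) := by
  intro u hu v hv h
  rw [colour_residualColouring _ _ hu hv] at h
  have := h [] rfl
  have hmod : ∀ u, (pairRun ([] : List (Layer Sig w)) [] u []) = u := by
    intro u
    simp only [pairRun, runLayers_nil]
    split <;> omega
  rwa [hmod, hmod] at this

/-- The start states are the codes 0 and `2 ^ w` of the empty set in the two halves; equality of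
their residuals is equality of the languages. -/
theorem colourInitial_residualColouring (B D : List (Layer Sig w))
    (h : ∀ x : List Sig, x.length = B.length → runLayers D 0 x = runLayers B 0 x) :
    ColourInitial w (residualColouring B D) := by
  have hM : 0 < 2 ^ w := by positivity
  unfold ColourInitial
  rw [colour_residualColouring _ _ (by omega) (by omega)]
  intro x hx
  simp only [pairRun, hM, if_true, lt_irrefl, if_false, Nat.sub_self, h x hx, Nat.add_mod_left]

end Colouring

/-! ### Optimal paths in layered graphs -/

/-- How the weights along a path are combined: by maxima or by sums. -/
def combine (b : Bool) (x y : ℕ) : ℕ := if b then max x y else x + y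

/-- The only property of max and + on which Bellman's principle relies. -/
theorem combine_mono (b : Bool) {x x' y : ℕ} (h : x ≤ x') : combine b x y ≤ combine b x' y := by
  unfold combine; split <;> omega

theorem combine_le_add (b : Bool) (x y : ℕ) : combine b x y ≤ x + y := by
  unfold combine; split <;> omega

/-- A graph with `V` nodes and `E` edges, of which `val i` may be used in the `i`-th step. -/
structure LGraph where
  V : ℕ
  E : ℕ
  src : ℕ → ℕ
  dst : ℕ → ℕ
  wt : ℕ → ℕ
  val : ℕ → ℕ → Prop
  start : ℕ → Prop
  useMax : Bool
  src_lt : ∀ e < E, src e < V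
  dst_lt : ∀ e < E, dst e < V
  start_lt : ∀ v, start v → v < V

namespace LGraph

variable (G : LGraph)

/-- `G.Path es v c`: the edges `es` form a path of weight `c` from a start node to `v`. -/
inductive Path : List ℕ → ℕ → ℕ → Prop where
  | nil {v : ℕ} : G.start v → Path [] v 0
  | snoc {es : List ℕ} {c e : ℕ} : Path es (G.src e) c → e < G.E → G.val es.length e →
      Path (es ++ [e]) (G.dst e) (combine G.useMax c (G.wt e))

/-- `dp i v` is `0` if `v` has not been reached in `i` steps, and otherwise one more than the weight
of the best path found, whose last edge is `bp i v`; the edges in `Done` have been processed. -/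
structure Table (Done : ℕ → ℕ → Prop) (dp bp : ℕ → ℕ → ℕ) : Prop where
  zero : ∀ v < G.V, dp 0 v = truthBit (G.start v)
  low : ∀ i e, Done i e → G.val i e → dp i (G.src e) ≠ 0 →
    dp (i + 1) (G.dst e) ≠ 0 ∧
      dp (i + 1) (G.dst e) ≤ combine G.useMax (dp i (G.src e) - 1) (G.wt e) + 1
  back : ∀ i, ∀ v < G.V, dp (i + 1) v ≠ 0 →
    Done i (bp (i + 1) v) ∧ G.val i (bp (i + 1) v) ∧ G.dst (bp (i + 1) v) = v ∧
      dp i (G.src (bp (i + 1) v)) ≠ 0 ∧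
      dp (i + 1) v = combine G.useMax (dp i (G.src (bp (i + 1) v)) - 1) (G.wt (bp (i + 1) v)) + 1

/-- The edges in steps before `i`, and the first `j` edges in step `i`. -/
def Before (i j : ℕ) (i' e : ℕ) : Prop := i' < i ∧ e < G.E ∨ i' = i ∧ e < j

theorem before_succ (i : ℕ) : G.Before i G.E = G.Before (i + 1) 0 := by
  funext i' e
  simp only [Before, eq_iff_iff]
  constructor
  · rintro (⟨h1, h2⟩ | ⟨h1, h2⟩)
    · exact .inl ⟨by omega, h2⟩
    · exact .inl ⟨by omega, h2⟩
  · rintro (⟨h1, h2⟩ | ⟨h1, h2⟩)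
    · by_cases h : i' = i
      · exact .inr ⟨h, h2⟩
      · exact .inl ⟨by omega, h2⟩
    · omega

variable {G} {dp bp : ℕ → ℕ → ℕ}

/-- Needed to show that table entries fit into machine words. -/
theorem Table.le {Done : ℕ → ℕ → Prop} (h : G.Table Done dp bp) {wmax : ℕ}
    (hD : ∀ i e, Done i e → e < G.E)
    (hw : ∀ e < G.E, G.wt e ≤ wmax) (i v : ℕ) (hv : v < G.V) : dp i v ≤ i * wmax + 1 := by
  induction i generalizing v with
  | zero => rw [h.zero v hv, zero_mul, zero_add]; exact truthBit_le _
  | succ i ih =>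
    by_cases h0 : dp (i + 1) v = 0
    · omega
    · obtain ⟨h1, -, -, -, h3⟩ := h.back i v hv h0
      have he := hD _ _ h1
      have h4 := ih _ (G.src_lt _ he)
      have h5 := combine_le_add G.useMax (dp i (G.src (bp (i + 1) v)) - 1) (G.wt (bp (i + 1) v))
      have h6 := hw _ he
      rw [Nat.succ_mul]
      omega

/-- The edge e may be passed over if it is unusable, if its source is unreached, or if its target is
already at least as good. -/
theorem Table.skip {i e : ℕ} (h : G.Table (G.Before i e) dp bp)
    (hskip : G.val i e → dp i (G.src e) ≠ 0 → dp (i + 1) (G.dst e) ≠ 0 ∧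
      dp (i + 1) (G.dst e) ≤ combine G.useMax (dp i (G.src e) - 1) (G.wt e) + 1) :
    G.Table (G.Before i (e + 1)) dp bp := by
  refine ⟨h.zero, ?_, ?_⟩
  · rintro i' e' (h1 | ⟨rfl, h1⟩)
    · exact h.low i' e' (.inl h1)
    · rcases Nat.lt_succ_iff_lt_or_eq.1 h1 with h2 | rfl
      · exact h.low _ _ (.inr ⟨rfl, h2⟩)
      · exact hskip
  · intro i' v hv h0
    obtain ⟨h1, h2⟩ := h.back i' v hv h0
    exact ⟨h1.imp id fun h3 => ⟨h3.1, by omega⟩, h2⟩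

/-- Relaxing an edge of step i changes only row i + 1, while the justification of every entry made
so far refers to rows up to i. Lowering one entry therefore invalidates neither the inequalities nor
the back pointers already established. -/
theorem Table.relax {i e : ℕ} (h : G.Table (G.Before i e) dp bp) {dp' bp' : ℕ → ℕ → ℕ}
    (hv : G.val i e) (hs : dp i (G.src e) ≠ 0) (hd : e < G.E)
    (hlt : dp (i + 1) (G.dst e) = 0 ∨
      combine G.useMax (dp i (G.src e) - 1) (G.wt e) + 1 < dp (i + 1) (G.dst e))
    (hdp : ∀ i', ∀ v < G.V, dp' i' v = if i' = i + 1 ∧ v = G.dst e then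
      combine G.useMax (dp i (G.src e) - 1) (G.wt e) + 1 else dp i' v)
    (hbp : ∀ i', ∀ v < G.V, bp' i' v = if i' = i + 1 ∧ v = G.dst e then e else bp i' v) :
    G.Table (G.Before i (e + 1)) dp' bp' := by
  have hrow : ∀ i' ≤ i, ∀ v < G.V, dp' i' v = dp i' v := fun i' hi v hv => by
    rw [hdp i' v hv, if_neg (by omega)]
  refine ⟨?_, ?_, ?_⟩
  · intro v hv
    rw [hrow 0 (by omega) v hv, h.zero v hv]
  · intro i' e' hB hval hne
    have hi' : i' ≤ i := by rcases hB with h1 | h1 <;> omega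
    have he' : e' < G.E := by rcases hB with h1 | h1 <;> omega
    rw [hrow i' hi' _ (G.src_lt _ he')] at hne ⊢
    have hold : i' = i ∧ e' = e ∨ G.Before i e i' e' := by
      rcases hB with h1 | ⟨h1, h2⟩
      · exact .inr (.inl h1)
      · rcases Nat.lt_succ_iff_lt_or_eq.1 h2 with h3 | h3
        · exact .inr (.inr ⟨h1, h3⟩)
        · exact .inl ⟨h1, h3⟩
    rw [hdp _ _ (G.dst_lt _ he')]
    by_cases heq : i' + 1 = i + 1 ∧ G.dst e' = G.dst e
    · rw [if_pos heq]
      refine ⟨by omega, ?_⟩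
      rcases hold with ⟨rfl, rfl⟩ | hold
      · exact le_rfl
      · obtain ⟨h1, h2⟩ := h.low _ _ hold hval hne
        rw [heq.1, heq.2] at h1 h2
        omega
    · rw [if_neg heq]
      rcases hold with ⟨rfl, rfl⟩ | hold
      · exact absurd ⟨rfl, rfl⟩ heq
      · exact h.low _ _ hold hval hne
  · intro i' v hv' h0
    rw [hdp _ _ hv'] at h0 ⊢
    rw [hbp _ _ hv']
    by_cases heq : i' + 1 = i + 1 ∧ v = G.dst e
    · obtain ⟨h1, rfl⟩ := heq
      obtain rfl : i' = i := by omega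
      simp only [and_self, if_true]
      rw [hrow _ le_rfl _ (G.src_lt _ hd)]
      exact ⟨.inr ⟨rfl, by omega⟩, hv, trivial, hs, rfl⟩
    · rw [if_neg heq] at h0 ⊢
      rw [if_neg heq]
      obtain ⟨h1, h2, h3, h4⟩ := h.back i' v hv' h0
      have hi' : i' ≤ i := by rcases h1 with h1 | h1 <;> omega
      have he' : bp (i' + 1) v < G.E := by rcases h1 with h1 | h1 <;> omega
      rw [hrow _ hi' _ (G.src_lt _ he')]
      exact ⟨h1.imp id fun h3 => ⟨h3.1, by omega⟩, h2, h3, h4⟩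

/-- The path that ends in `v` after `i` steps according to the back pointers. -/
def trace (G : LGraph) (bp : ℕ → ℕ → ℕ) : ℕ → ℕ → List ℕ
  | 0, _ => []
  | i + 1, v => trace G bp i (G.src (bp (i + 1) v)) ++ [bp (i + 1) v]

@[simp] theorem length_trace (i v : ℕ) : (G.trace bp i v).length = i := by
  induction i generalizing v with
  | zero => rfl
  | succ i ih => simp [trace, ih]

/-- Every entry is attained: follow the back pointers. Together with `Table.le_of_path` this makes
the entries exact minima. -/
theorem Table.path {k : ℕ} (h : G.Table (G.Before k 0) dp bp) (i v : ℕ) (hv : v < G.V)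
    (h0 : dp i v ≠ 0) : G.Path (G.trace bp i v) v (dp i v - 1) := by
  induction i generalizing v with
  | zero =>
    have h1 := h.zero v hv
    have hst : G.start v := by
      by_contra hc
      exact h0 (h1.trans (truthBit_eq_zero.2 hc))
    rw [h1, truthBit_eq_one.2 hst]
    exact .nil hst
  | succ i ih =>
    obtain ⟨h1, h2, h3, h4, h5⟩ := h.back i v hv h0
    have he : bp (i + 1) v < G.E := by rcases h1 with h1 | h1 <;> omega
    have := (ih _ (G.src_lt _ he) h4).snoc he (by simpa using h2)
    rw [h3] at this
    rw [h5, Nat.add_sub_cancel]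
    exact this

/-- Bellman's argument along the path: its last edge has been processed, and the entry at the source
of that edge is at most the weight of the shorter path. -/
theorem Table.le_of_path {k : ℕ} (h : G.Table (G.Before k 0) dp bp) {es : List ℕ} {v c : ℕ}
    (hp : G.Path es v c) (hk : es.length ≤ k) :
    v < G.V ∧ dp es.length v ≠ 0 ∧ dp es.length v ≤ c + 1 := by
  induction hp with
  | nil hst =>
    refine ⟨G.start_lt _ hst, ?_⟩
    rw [List.length_nil, h.zero _ (G.start_lt _ hst), truthBit_eq_one.2 hst]
    simp
  | @snoc es c e hp he hval ih =>
    rw [List.length_append, List.length_singleton] at hk ⊢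
    obtain ⟨-, h1, h2⟩ := ih (by omega)
    obtain ⟨h3, h4⟩ := h.low _ _ (.inl ⟨by omega, he⟩) hval h1
    refine ⟨G.dst_lt _ he, h3, h4.trans ?_⟩
    exact Nat.add_le_add_right (combine_mono _ (by omega)) 1

end LGraph

/-! ### The graph of an instance -/

section Instance

variable {Sig : Type u} {Q : Type v} {w n : ℕ}

instance (Sig : Type u) (w : ℕ) : Inhabited (Layer Sig w) :=
  ⟨⟨∅, ∅, ∅, ∅, ∅, false, false, by simp, by simp, by simp, by simp, by simp⟩⟩

/-- The layer of the `j`-th transition. -/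
def transLayer (ts : List (Q × Layer Sig w × Q)) (j : ℕ) : Layer Sig w :=
  (ts[j]?.map fun t => t.2.1).getD default

/-- The source of the `j`-th transition. -/
def transSrc (eQ : Q ≃ Fin n) (ts : List (Q × Layer Sig w × Q)) (j : ℕ) : ℕ :=
  (ts[j]?.map fun t => (eQ t.1 : ℕ)).getD 0

/-- The target of the `j`-th transition. -/
def transDst (eQ : Q ≃ Fin n) (ts : List (Q × Layer Sig w × Q)) (j : ℕ) : ℕ :=
  (ts[j]?.map fun t => (eQ t.2.2 : ℕ)).getD 0

theorem numColourings_pos (w : ℕ) : 0 < numColourings w := by unfold numColourings; positivity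

theorem transSrc_lt (eQ : Q ≃ Fin n) (ts : List (Q × Layer Sig w × Q)) {j : ℕ}
    (hj : j < ts.length) : transSrc eQ ts j < n := by
  simp [transSrc, List.getElem?_eq_getElem hj]

theorem transDst_lt (eQ : Q ≃ Fin n) (ts : List (Q × Layer Sig w × Q)) {j : ℕ}
    (hj : j < ts.length) : transDst eQ ts j < n := by
  simp [transDst, List.getElem?_eq_getElem hj]

theorem mul_add_lt_mul {a b n K : ℕ} (ha : a < n) (hb : b < K) : a * K + b < n * K := by
  have := Nat.mul_le_mul_right K (show a + 1 ≤ n from ha)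
  rw [Nat.add_mul] at this
  omega

/-- The nodes are pairs of a state of `F` and a colouring, the edges are triples of a transition
of `F` and two colourings. -/
def oddGraph (eQ : Q ≃ Fin n) (B : List (Layer Sig w)) (F : NFA (Layer Sig w) Q)
    (ts : List (Q × Layer Sig w × Q)) (weight : Layer Sig w → ℕ) (b : Bool) : LGraph where
  V := n * numColourings w
  E := ts.length * (numColourings w * numColourings w)
  src e := transSrc eQ ts (e / (numColourings w * numColourings w)) * numColourings w +
    e / numColourings w % numColourings w
  dst e := transDst eQ ts (e / (numColourings w * numColourings w)) * numColourings w +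
    e % numColourings w
  wt e := weight (transLayer ts (e / (numColourings w * numColourings w)))
  val i e := Compatible (B.getD i default)
    (transLayer ts (e / (numColourings w * numColourings w)))
    (e / numColourings w % numColourings w) (e % numColourings w)
  start v := (∃ q, (eQ q : ℕ) = v / numColourings w ∧ q ∈ F.start) ∧
    ColourInitial w (v % numColourings w)
  useMax := b
  src_lt e he := mul_add_lt_mul (transSrc_lt eQ ts (Nat.div_lt_of_lt_mul (by rwa [mul_comm])))
    (Nat.mod_lt _ (numColourings_pos w))
  dst_lt e he := mul_add_lt_mul (transDst_lt eQ ts (Nat.div_lt_of_lt_mul (by rwa [mul_comm])))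
    (Nat.mod_lt _ (numColourings_pos w))
  start_lt v := by
    rintro ⟨⟨q, hq, -⟩, -⟩
    have h : v / numColourings w < n := hq ▸ (eQ q).2
    exact (Nat.div_lt_iff_lt_mul (numColourings_pos w)).1 h

/-- The layers read along a sequence of edges. -/
def edgeLayers (ts : List (Q × Layer Sig w × Q)) (es : List ℕ) : List (Layer Sig w) :=
  es.map fun e => transLayer ts (e / (numColourings w * numColourings w))

/-- The combined weights of the layers. -/
def layerMeasure (b : Bool) (weight : Layer Sig w → ℕ) (D : List (Layer Sig w)) : ℕ :=
  D.foldl (fun c L => combine b c (weight L)) 0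

theorem node_div {a b K : ℕ} (hb : b < K) : (a * K + b) / K = a := by
  rw [mul_comm, Nat.mul_add_div (by omega), Nat.div_eq_of_lt hb, add_zero]

theorem node_mod {a b K : ℕ} (hb : b < K) : (a * K + b) % K = b := by
  rw [mul_comm, Nat.mul_add_mod, Nat.mod_eq_of_lt hb]

/-- The colourings on a path do not depend on the input word, so one path certifies equal colours
for all words at once. The induction uses no ODD property of the layers read, only that the
deterministic run is defined for any sequence of layers. -/
theorem LGraph.Path.sound {eQ : Q ≃ Fin n} {B : List (Layer Sig w)} {F : NFA (Layer Sig w) Q}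
    {ts : List (Q × Layer Sig w × Q)} {weight : Layer Sig w → ℕ} {b : Bool} (hw : 0 < w)
    (hts : ∀ t, t ∈ ts ↔ t ∈ faTransitions F) {es : List ℕ} {v c : ℕ}
    (h : (oddGraph eQ B F ts weight b).Path es v c) (hB : es.length ≤ B.length) :
    (∃ q, (eQ q : ℕ) = v / numColourings w ∧ q ∈ F.eval (edgeLayers ts es)) ∧
    (∀ x : List Sig, x.length = es.length →
      colour w (v % numColourings w) (runLayers (B.take es.length) 0 x) =
      colour w (v % numColourings w) (2 ^ w + runLayers (edgeLayers ts es) 0 x)) ∧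
    c = layerMeasure b weight (edgeLayers ts es) := by
  have hM : 0 < 2 ^ w := by positivity
  induction h with
  | nil hst =>
    obtain ⟨⟨q, h1, h2⟩, h3⟩ := hst
    exact ⟨⟨q, h1, h2⟩, fun x _ => by simpa [edgeLayers, ColourInitial] using h3, rfl⟩
  | @snoc es c e hp he hval ih =>
    rw [List.length_append, List.length_singleton] at hB ⊢
    obtain ⟨⟨q, h1, h2⟩, h3, h4⟩ := ih (by omega)
    have hK := numColourings_pos w
    have hj : e / (numColourings w * numColourings w) < ts.length :=
      Nat.div_lt_of_lt_mul (by rwa [mul_comm])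
    set j := e / (numColourings w * numColourings w) with hjdef
    have hsrc : (eQ q : ℕ) = transSrc eQ ts j := by
      rw [h1]; exact node_div (Nat.mod_lt _ hK)
    have hq : q = ts[j].1 := by
      apply eQ.injective; apply Fin.ext
      rw [hsrc]; simp [transSrc, List.getElem?_eq_getElem hj]
    have hlay : transLayer ts j = ts[j].2.1 := by
      simp [transLayer, List.getElem?_eq_getElem hj]
    have hel : edgeLayers ts (es ++ [e]) = edgeLayers ts es ++ [transLayer ts j] := by
      simp [edgeLayers, hjdef]
    have hlen : (edgeLayers ts es).length = es.length := by simp [edgeLayers]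
    refine ⟨⟨ts[j].2.2, ?_, ?_⟩, ?_, ?_⟩
    · refine Eq.trans ?_ (node_div (Nat.mod_lt _ hK)).symm
      simp [transDst, ← hjdef, List.getElem?_eq_getElem hj]
    · rw [hel, NFA.eval_append_singleton, NFA.mem_stepSet]
      refine ⟨q, h2, ?_⟩
      have := (hts ts[j]).1 (List.getElem_mem hj)
      rw [hlay, hq]; exact this
    · intro x hx
      obtain ⟨y, a, rfl⟩ : ∃ y a, x = y ++ [a] := by
        rcases List.eq_nil_or_concat x with rfl | ⟨y, a, rfl⟩
        · simp at hx
        · exact ⟨y, a, by simp⟩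
      have hy : y.length = es.length := by simpa using hx
      have hBi : B.getD es.length default = B[es.length] := by
        simp [List.getD, List.getElem?_eq_getElem (show es.length < B.length by omega)]
      rw [← List.take_append_getElem (show es.length < B.length by omega), hel,
        runLayers_concat _ _ _ _ _ (by simp [hy]; omega),
        runLayers_concat _ _ _ _ _ (hlen.trans hy.symm)]
      have hu := runLayers_lt hw (B.take es.length) 0 hM y
      have hv := runLayers_lt hw (edgeLayers ts es) 0 hM y
      have h5 := h3 y hy
      have h6 := hval (runLayers (B.take es.length) 0 y) (by omega)
        (2 ^ w + runLayers (edgeLayers ts es) 0 y) (by omega) a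
        (by rw [← hjdef] at *;
            have : (oddGraph eQ B F ts weight b).src e % numColourings w =
              e / numColourings w % numColourings w := node_mod (Nat.mod_lt _ hK)
            rwa [this] at h5)
      have h7 : (oddGraph eQ B F ts weight b).dst e % numColourings w = e % numColourings w :=
        node_mod (Nat.mod_lt _ hK)
      rw [h7]
      simpa only [pairNext, hu, if_true, hBi, ← hjdef, Nat.not_lt.2 (Nat.le_add_right _ _),
        if_false, Nat.add_sub_cancel_left] using h6
    · rw [hel, layerMeasure, List.foldl_append, ← layerMeasure, h4]
      rfl

/-- Pair an accepting-run prefix of F on D with the residual colourings of the remaining suffixes of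
B and D. -/
theorem exists_path {eQ : Q ≃ Fin n} {B : List (Layer Sig w)} {F : NFA (Layer Sig w) Q}
    {ts : List (Q × Layer Sig w × Q)} {weight : Layer Sig w → ℕ} {b : Bool} (hw : 0 < w)
    (hts : ∀ t, t ∈ ts ↔ t ∈ faTransitions F) {D : List (Layer Sig w)}
    (hl : D.length = B.length)
    (hD : ∀ x : List Sig, x.length = B.length → runLayers D 0 x = runLayers B 0 x)
    (i : ℕ) (hi : i ≤ D.length) (q : Q) (hq : q ∈ F.eval (D.take i)) :
    ∃ es : List ℕ, es.length = i ∧ (oddGraph eQ B F ts weight b).Path es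
      (eQ q * numColourings w + residualColouring (B.drop i) (D.drop i))
      (layerMeasure b weight (D.take i)) := by
  have hK := numColourings_pos w
  induction i generalizing q with
  | zero =>
    refine ⟨[], rfl, .nil ⟨⟨q, ?_, hq⟩, ?_⟩⟩
    · exact (node_div (residualColouring_lt _ _)).symm
    · rw [node_mod (residualColouring_lt _ _)]
      exact colourInitial_residualColouring _ _ hD
  | succ i ih =>
    rw [← List.take_append_getElem hi, NFA.eval_append_singleton, NFA.mem_stepSet] at hq
    obtain ⟨p, hp, hpq⟩ := hq
    obtain ⟨es, hes, hpath⟩ := ih (by omega) p hp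
    obtain ⟨j, hj, hjt⟩ := List.getElem_of_mem ((hts (p, D[i], q)).2 hpq)
    set c := residualColouring (B.drop i) (D.drop i) with hc
    set c' := residualColouring (B.drop (i + 1)) (D.drop (i + 1)) with hc'
    have hclt : c < numColourings w := residualColouring_lt _ _
    have hclt' : c' < numColourings w := residualColouring_lt _ _
    set K := numColourings w with hKdef
    -- The edge number with digits j, c, c' in mixed radix; the next lines decode it again.
    set e := (j * K + c) * K + c' with he
    have e1 : e / K = j * K + c := node_div hclt'
    have e2 : e % K = c' := node_mod hclt'
    have e3 : e / K % K = c := by rw [e1]; exact node_mod hclt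
    have e4 : e / (K * K) = j := by rw [← Nat.div_div_eq_div_mul, e1]; exact node_div hclt
    have hsrc : (oddGraph eQ B F ts weight b).src e = eQ p * K + c := by
      simp only [oddGraph, ← hKdef, e3, e4]
      simp [transSrc, List.getElem?_eq_getElem hj, hjt]
    have hdst : (oddGraph eQ B F ts weight b).dst e = eQ q * K + c' := by
      simp only [oddGraph, ← hKdef, e2, e4]
      simp [transDst, List.getElem?_eq_getElem hj, hjt]
    have hlay : transLayer ts j = D[i] := by
      simp [transLayer, List.getElem?_eq_getElem hj, hjt]
    have hwt : (oddGraph eQ B F ts weight b).wt e = weight D[i] := by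
      simp only [oddGraph, ← hKdef, e4, hlay]
    refine ⟨es ++ [e], by simp [hes], ?_⟩
    rw [← hdst]
    have hstep := LGraph.Path.snoc (G := oddGraph eQ B F ts weight b) (e := e)
      (by rw [hsrc]; exact hpath) ?_ ?_
    · rw [← List.take_append_getElem hi, layerMeasure, List.foldl_append, ← layerMeasure]
      rw [hwt] at hstep
      exact hstep
    · change e < ts.length * (K * K)
      rw [← Nat.div_lt_iff_lt_mul (by positivity), e4]; exact hj
    · simp only [oddGraph, ← hKdef, e2, e3, e4, hlay, hes]
      have hiB : i < B.length := by omega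
      rw [hc, hc', List.drop_eq_getElem_cons hiB,
        List.drop_eq_getElem_cons (show i < D.length from hi),
        show B.getD i default = B[i] by simp [List.getD, List.getElem?_eq_getElem hiB]]
      exact compatible_residualColouring hw _ _ _ _

/-- An accepting node: its state is accepting and its colouring separates the results. -/
def AcceptNode (eQ : Q ≃ Fin n) (F : NFA (Layer Sig w) Q) (v : ℕ) : Prop :=
  (∃ q, (eQ q : ℕ) = v / numColourings w ∧ q ∈ F.accept) ∧ ColourFinal w (v % numColourings w)

theorem LGraph.Path.mem_equivODDs {eQ : Q ≃ Fin n} {B : List (Layer Sig w)}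
    {F : NFA (Layer Sig w) Q} {ts : List (Q × Layer Sig w × Q)} {weight : Layer Sig w → ℕ}
    {b : Bool} (hw : 0 < w) (hts : ∀ t, t ∈ ts ↔ t ∈ faTransitions F) (hBodd : IsODD B)
    (hF : IsSOFA F) {es : List ℕ} {v c : ℕ}
    (h : (oddGraph eQ B F ts weight b).Path es v c) (hl : es.length = B.length)
    (hv : AcceptNode eQ F v) :
    edgeLayers ts es ∈ equivODDs F B ∧ c = layerMeasure b weight (edgeLayers ts es) := by
  have hM : 0 < 2 ^ w := by positivity
  obtain ⟨⟨q, h1, h2⟩, h3, h4⟩ := h.sound hw hts hl.le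
  obtain ⟨⟨q', h5, h6⟩, h7⟩ := hv
  obtain rfl : q = q' := eQ.injective (Fin.ext (h1.trans h5.symm))
  have hacc : edgeLayers ts es ∈ F.accepts := ⟨q, h6, h2⟩
  refine ⟨⟨hacc, ?_⟩, h4⟩
  rw [(hF _ hacc).oddLang_eq_iff hBodd]
  refine ⟨by simp [edgeLayers, hl], fun x hx => ?_⟩
  have h8 := h3 x (hx.trans hl.symm)
  rw [hl, List.take_length] at h8
  have hu := runLayers_lt hw B 0 hM x
  have hv := runLayers_lt hw (edgeLayers ts es) 0 hM x
  have := h7 _ (by omega) _ (by omega) h8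
  rw [Nat.mod_eq_of_lt hu, Nat.add_mod_left, Nat.mod_eq_of_lt hv] at this
  exact this.symm

/-- Minimality needs only that each competitor gives a path whose weight is its measure; the path
found need not come from residual colourings. -/
theorem exists_path_of_mem_equivODDs (eQ : Q ≃ Fin n) {B : List (Layer Sig w)}
    {F : NFA (Layer Sig w) Q} {ts : List (Q × Layer Sig w × Q)} (weight : Layer Sig w → ℕ)
    (b : Bool) (hw : 0 < w) (hts : ∀ t, t ∈ ts ↔ t ∈ faTransitions F) (hBodd : IsODD B)
    (hF : IsSOFA F) {D : List (Layer Sig w)} (hD : D ∈ equivODDs F B) :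
    ∃ es v, es.length = B.length ∧ AcceptNode eQ F v ∧
      (oddGraph eQ B F ts weight b).Path es v (layerMeasure b weight D) := by
  obtain ⟨hacc, hlang⟩ := hD
  obtain ⟨hl, hrun⟩ := ((hF _ hacc).oddLang_eq_iff hBodd).1 hlang
  obtain ⟨q, hq, hev⟩ := hacc
  obtain ⟨es, hes, hp⟩ := exists_path (eQ := eQ) (weight := weight) (b := b) hw hts hl hrun D.length
    le_rfl q (by rwa [List.take_length])
  rw [List.take_length, List.drop_length, hl, List.drop_length] at hp
  refine ⟨es, _, hes.trans hl, ⟨⟨q, ?_, hq⟩, ?_⟩, hp⟩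
  · exact (node_div (residualColouring_lt _ _)).symm
  · rw [node_mod (residualColouring_lt _ _)]
    exact colourFinal_residualColouring

/-! ### The three measures as combined weights -/

/-- Inner state sets are counted twice under the maximum, which does no harm. -/
def widthWeight (L : Layer Sig w) : ℕ := max L.left.card L.right.card

/-- The factor `L.initFlag.toNat` charges the left states only in the first layer, so the weight
needs no knowledge of the position. -/
def statesWeight (L : Layer Sig w) : ℕ := L.initFlag.toNat * L.left.card + L.right.card

def transWeight (L : Layer Sig w) : ℕ := L.trans.card

theorem oddNumTrans_eq (D : List (Layer Sig w)) :
    oddNumTrans D = layerMeasure false transWeight D := by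
  have : ∀ c, D.foldl (fun c L => combine false c (transWeight L)) c =
      c + (D.map fun L => L.trans.card).sum := by
    induction D with
    | nil => simp
    | cons L D ih =>
      intro c
      simp only [List.foldl_cons, List.map_cons, List.sum_cons, ih]
      simp only [combine, transWeight, Bool.false_eq_true, if_false]
      omega
  rw [layerMeasure, this, zero_add, oddNumTrans]

theorem IsODD.oddNumStates_eq {D : List (Layer Sig w)} (hD : IsODD D) :
    oddNumStates D = layerMeasure false statesWeight D := by
  have key : ∀ (D : List (Layer Sig w)) (c : ℕ), (∀ L ∈ D, L.initFlag = false) →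
      D.foldl (fun c L => combine false c (statesWeight L)) c =
      c + (D.map fun L => L.right.card).sum := by
    intro D
    induction D with
    | nil => simp
    | cons L D ih =>
      intro c h
      have h1 := h L (by simp)
      simp only [List.foldl_cons, List.map_cons, List.sum_cons,
        ih _ fun L' hL' => h L' (List.mem_cons_of_mem _ hL')]
      simp [combine, statesWeight, h1]
      omega
  obtain _ | ⟨L, D⟩ := D
  · exact absurd rfl hD.ne_nil
  have h0 : L.initFlag = true := (hD.initFlag_iff 0 (by simp)).2 rfl
  rw [layerMeasure, List.foldl_cons, key]
  · simp [oddNumStates, combine, statesWeight, h0]; omega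
  · intro L' hL'
    obtain ⟨i, hi, rfl⟩ := List.getElem_of_mem hL'
    have := hD.initFlag_iff (i + 1) (by simpa using hi)
    rw [← Bool.not_eq_true]
    simpa using this

/-- The gluing condition identifies the right states of each inner layer with the left states of its
successor, so only those of the last layer are new. -/
theorem IsODD.oddWidth_eq {D : List (Layer Sig w)} (hD : IsODD D) :
    oddWidth D = layerMeasure true widthWeight D := by
  have hf : ∀ (D : List (Layer Sig w)) (c : ℕ),
      D.foldl (fun c L => combine true c (widthWeight L)) c =
      max c ((D.map widthWeight).foldr max 0) := by
    intro D
    induction D with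
    | nil => simp
    | cons L D ih =>
      intro c
      simp only [List.foldl_cons, List.map_cons, List.foldr_cons, ih]
      simp [combine, max_assoc]
  have key : ∀ (D : List (Layer Sig w)),
      (∀ (i : ℕ) (h : i + 1 < D.length), D[i + 1].left = D[i].right) →
      oddWidth D = (D.map widthWeight).foldr max 0 := by
    intro D
    induction D with
    | nil => simp [oddWidth]
    | cons L D ih =>
      intro hg
      have ih := ih fun i h => hg (i + 1) (by simpa using h)
      obtain _ | ⟨L', D⟩ := D
      · simp [oddWidth, widthWeight]
      · have h1 : L'.left = L.right := hg 0 (by simp)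
        simp only [oddWidth, List.map_cons, List.foldr_cons, List.getLast?_cons_cons,
          widthWeight] at ih ⊢
        rw [max_assoc, ih, h1]
        omega
  rw [layerMeasure, hf, key D hD.glue, Nat.zero_max]

end Instance

/-! ### Expressions for the parts of the algorithm -/

namespace SExpr

instance : Add SExpr := ⟨op .add⟩
instance : Sub SExpr := ⟨op .sub⟩
instance : Mul SExpr := ⟨op .mul⟩
instance : Div SExpr := ⟨op .div⟩
instance : Mod SExpr := ⟨op .mod⟩

def lt (a b : SExpr) : SExpr := op .lt a b
def eq (a b : SExpr) : SExpr := op .eq a b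

variable (m r : ℕ → ℕ) (a b : SExpr)

@[simp] theorem eval_const (n : ℕ) : (const n).eval m r = n := rfl
@[simp] theorem eval_var (x : ℕ) : (var x).eval m r = r x := rfl
@[simp] theorem eval_load : (load a).eval m r = m (a.eval m r) := rfl
@[simp] theorem eval_add : (a + b).eval m r = a.eval m r + b.eval m r := rfl
@[simp] theorem eval_sub : (a - b).eval m r = a.eval m r - b.eval m r := rfl
@[simp] theorem eval_mul : (a * b).eval m r = a.eval m r * b.eval m r := rfl
@[simp] theorem eval_div : (a / b).eval m r = a.eval m r / b.eval m r := rfl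
@[simp] theorem eval_mod : (a % b).eval m r = a.eval m r % b.eval m r := rfl
@[simp] theorem eval_sum (x n : ℕ) : (sum x n b).eval m r =
    ∑ i ∈ Finset.range (r n), b.eval m (Function.update r x i) := rfl
@[simp] theorem eval_bind (x : ℕ) : (bind x a b).eval m r =
    b.eval m (Function.update r x (a.eval m r)) := rfl

theorem eval_lt : (lt a b).eval m r = truthBit (a.eval m r < b.eval m r) := by
  simp [lt, eval, BinOp.eval, truthBit]

theorem eval_eq : (eq a b).eval m r = truthBit (a.eval m r = b.eval m r) := by
  simp [eq, eval, BinOp.eval, truthBit]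

@[simp] theorem wf_const (n : ℕ) : (const n).WF := trivial
@[simp] theorem wf_var (x : ℕ) : (var x).WF := trivial
@[simp] theorem wf_load : (load a).WF ↔ a.WF := Iff.rfl
@[simp] theorem wf_add : (a + b).WF ↔ a.WF ∧ b.WF := Iff.rfl
@[simp] theorem wf_sub : (a - b).WF ↔ a.WF ∧ b.WF := Iff.rfl
@[simp] theorem wf_mul : (a * b).WF ↔ a.WF ∧ b.WF := Iff.rfl
@[simp] theorem wf_div : (a / b).WF ↔ a.WF ∧ b.WF := Iff.rfl
@[simp] theorem wf_mod : (a % b).WF ↔ a.WF ∧ b.WF := Iff.rfl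
@[simp] theorem wf_lt : (lt a b).WF ↔ a.WF ∧ b.WF := Iff.rfl
@[simp] theorem wf_eq : (eq a b).WF ↔ a.WF ∧ b.WF := Iff.rfl
@[simp] theorem wf_sum (x n : ℕ) : (sum x n b).WF ↔ x < 20 ∧ 20 ≤ n ∧ n < 30 ∧ b.WF := Iff.rfl
@[simp] theorem wf_bind (x : ℕ) : (bind x a b).WF ↔ x < 20 ∧ a.WF ∧ b.WF := Iff.rfl

end SExpr

/-- The length of the encoding of a layer. -/
def layerLen (s w : ℕ) : ℕ := 4 * w + 2 + w * s * w

/-- The address of the encoding of the automaton. -/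
def posF (s w k : ℕ) : ℕ := 3 + k * layerLen s w

/-- The address of the list of transitions. -/
def posT (s w k n : ℕ) : ℕ := posF s w k + 2 + 2 * n

/-- The first address after the input. -/
def posE (s w k n m : ℕ) : ℕ := posT s w k n + m * (layerLen s w + 2)

/-- The constants of the algorithm, by the variables that hold them. -/
def constEnv (s w k n m : ℕ) : ℕ → ℕ
  | 20 => s
  | 21 => w
  | 22 => layerLen s w
  | 23 => 2 ^ w
  | 24 => 2 * 2 ^ w
  | 25 => w * s * w
  | 26 => numColourings w
  | 27 => (w + 1) * (2 * 2 ^ w)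
  | 30 => k
  | 31 => posF s w k
  | 32 => n
  | 33 => m
  | 34 => posT s w k n
  | 35 => posE s w k n m
  | 36 => n * numColourings w
  | 37 => m * (numColourings w * numColourings w)
  | _ => 0

/-- The variables from number `20` on hold the constants of the algorithm. -/
def Env (s w k n m : ℕ) (r : ℕ → ℕ) : Prop := ∀ x, 20 ≤ x → r x = constEnv s w k n m x

theorem Env.update {s w k n m : ℕ} {r : ℕ → ℕ} (h : Env s w k n m r) {x : ℕ} (hx : x < 20) (v : ℕ) :
    Env s w k n m (Function.update r x v) := fun y hy => by
  rw [Function.update_of_ne (by omega), h y hy]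

/-- The encoding of a layer stands in the memory from the address `A` on. -/
structure LayerAt {Sig : Type u} {s w : ℕ} (eS : Sig ≃ Fin s) (m : ℕ → ℕ) (A : ℕ)
    (L : Layer Sig w) : Prop where
  left : ∀ p : Fin w, m (A + p) = truthBit (p ∈ L.left)
  right : ∀ p : Fin w, m (A + w + p) = truthBit (p ∈ L.right)
  init : ∀ p : Fin w, m (A + 2 * w + p) = truthBit (p ∈ L.initStates)
  fin : ∀ p : Fin w, m (A + 3 * w + p) = truthBit (p ∈ L.finStates)
  initFlag : m (A + 4 * w) = L.initFlag.toNat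
  finFlag : m (A + 4 * w + 1) = L.finFlag.toNat
  trans : ∀ (p : Fin w) (a : Sig) (q : Fin w),
    m (A + 4 * w + 2 + ((p * s + eS a) * w + q)) = truthBit ((p, a, q) ∈ L.trans)

/-- The powers of two stand in the memory, in every third cell from the address `E` on. -/
def PowersAt (w E : ℕ) (m : ℕ → ℕ) : Prop :=
  ∀ t ≤ (w + 1) * (2 * 2 ^ w), m (E + 3 * t) = 2 ^ t

open SExpr

/-- The power of two with a given exponent. -/
def powE (e : SExpr) : SExpr := load (var 35 + const 3 * e)

/-- Whether the state `var 5` of the layer at `var 1` is hit from the set `var 2` by `var 3`. -/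
def hitE : SExpr := lt (const 0) <| sum 4 21 <|
  (var 2 / powE (var 4) % const 2 + load (var 1 + const 2 * var 21 + var 4)) *
    load (var 1 + const 4 * var 21 + const 2 + ((var 4 * var 20 + var 3) * var 21 + var 5))

/-- The successor of the set `var 2` under `var 3` in the layer at `var 1`. -/
def nextE : SExpr :=
  load (var 1 + const 4 * var 21 + const 1) *
    lt (const 0) (sum 5 21 (hitE * load (var 1 + const 3 * var 21 + var 5))) +
  (const 1 - load (var 1 + const 4 * var 21 + const 1)) * sum 5 21 (hitE * powE (var 5))

/-- The successor of the state `var y` of the union of the two automata. -/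
def pairNextE (y : ℕ) : SExpr :=
  lt (var y) (var 23) * bind 1 (var 6) (bind 2 (var y) nextE) +
  (const 1 - lt (var y) (var 23)) *
    (var 23 + bind 1 (var 7) (bind 2 (var y - var 23) nextE))

/-- The machine has no exponentiation or shift; the power that selects the digit is read from a
table. -/
def colourE (c u : SExpr) : SExpr :=
  c / powE ((var 21 + const 1) * u) % var 24

/-- Compatibility of the colourings `var 8` and `var 9` for the layers at `var 6` and `var 7`. -/
def compatibleE : SExpr :=
  eq (sum 10 24 <| sum 11 24 <| sum 3 20 <|
    eq (colourE (var 8) (var 10)) (colourE (var 8) (var 11)) *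
    (const 1 - eq (colourE (var 9) (pairNextE 10)) (colourE (var 9) (pairNextE 11)))) (const 0)

/-- Counts the pairs of states that violate the condition; a universal statement becomes the
vanishing of a sum. -/
def colourFinalE (c : SExpr) : SExpr :=
  eq (sum 10 24 <| sum 11 24 <| eq (colourE c (var 10)) (colourE c (var 11)) *
    (const 1 - eq (var 10 % var 23) (var 11 % var 23))) (const 0)

def colourInitialE (c : SExpr) : SExpr := eq (colourE c (const 0)) (colourE c (var 23))

section Eval

variable {Sig : Type u} {s w k n m : ℕ} {eS : Sig ≃ Fin s} {mem r : ℕ → ℕ}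

theorem bit_eq (S p : ℕ) : S / 2 ^ p % 2 = truthBit (S.testBit p = true) := by
  rw [Nat.testBit_eq_decide_div_mod_eq]
  rcases Nat.mod_two_eq_zero_or_one (S / 2 ^ p) with h | h <;> simp [h, truthBit]

theorem one_sub_truthBit {P : Prop} : 1 - truthBit P = 0 ↔ P := by
  by_cases h : P <;> simp [truthBit, h]

theorem lt_numColours (w : ℕ) : w < (w + 1) * (2 * 2 ^ w) := by
  have : 0 < 2 ^ w := by positivity
  nlinarith

/-- The sum counts witnesses, some of them twice when a state is both in the set and initial; only
its positivity matters. -/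
theorem eval_hitE (h : Env s w k n m r) (hp : PowersAt w (posE s w k n m) mem) {A S : ℕ}
    {L : Layer Sig w} (hL : LayerAt eS mem A L) (a : Sig) (h1 : r 1 = A) (h2 : r 2 = S)
    (h3 : r 3 = eS a) (q : Fin w) (h5 : r 5 = q) :
    hitE.eval mem r = truthBit (L.Hit S a q) := by
  have e20 : r 20 = s := h 20 (by omega)
  have e21 : r 21 = w := h 21 (by omega)
  have e35 : r 35 = posE s w k n m := h 35 (by omega)
  have hw := lt_numColours w
  rw [hitE, eval_lt]
  refine truthBit_congr ?_
  simp only [eval_const, eval_sum, eval_mul, eval_add, eval_mod, eval_div, eval_load, eval_var,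
    powE, Function.update_self, Function.update_of_ne, ne_eq, Nat.reduceEqDiff,
    not_false_eq_true, e20, e21, e35, h1, h2, h3, h5]
  rw [Finset.sum_pos_iff]
  simp only [Finset.mem_range, Layer.Hit]
  constructor
  · rintro ⟨p, hpw, hpos⟩
    refine ⟨⟨p, hpw⟩, ?_⟩
    have ei := hL.init ⟨p, hpw⟩
    have et := hL.trans ⟨p, hpw⟩ a q
    simp only at ei et
    rw [ei, et, hp p (by omega), bit_eq] at hpos
    have hz := (CanonicallyOrderedAdd.mul_pos.1 hpos)
    refine ⟨?_, ?_⟩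
    · by_contra hc
      rw [not_or] at hc
      have h3 := truthBit_eq_zero.2 hc.1
      have h4 := truthBit_eq_zero.2 hc.2
      simp only at h3
      omega
    · by_contra hc
      have := truthBit_eq_zero.2 hc
      omega
  · rintro ⟨p, hpS, hpt⟩
    refine ⟨p, p.2, ?_⟩
    rw [hL.init, hL.trans, hp p (by have := p.2; omega), bit_eq, truthBit_eq_one.2 hpt, mul_one]
    rcases hpS with h | h
    · rw [truthBit_eq_one.2 h]; omega
    · rw [truthBit_eq_one.2 h]; omega

theorem eval_nextE (h : Env s w k n m r) (hp : PowersAt w (posE s w k n m) mem) {A S : ℕ}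
    {L : Layer Sig w} (hL : LayerAt eS mem A L) (a : Sig) (h1 : r 1 = A) (h2 : r 2 = S)
    (h3 : r 3 = eS a) : nextE.eval mem r = L.next S a := by
  have e21 : r 21 = w := h 21 (by omega)
  have e35 : r 35 = posE s w k n m := h 35 (by omega)
  have hw := lt_numColours w
  have hhit : ∀ q : Fin w, hitE.eval mem (Function.update r 5 q) = truthBit (L.Hit S a q) :=
    fun q => eval_hitE (h.update (by omega) _) hp hL a (by simpa) (by simpa) (by simpa) q (by simp)
  simp only [nextE, eval_add, eval_mul, eval_load, eval_var, eval_const, eval_lt, eval_sub,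
    eval_sum, e21, h1, hL.finFlag, powE, Finset.sum_range, Function.update_self,
    Function.update_of_ne, ne_eq, Nat.reduceEqDiff, not_false_eq_true, hhit, hL.fin, e35]
  have hpq : ∀ q : Fin w, mem (posE s w k n m + 3 * q) = 2 ^ (q : ℕ) := fun q =>
    hp q (by have := q.2; omega)
  simp only [hpq, Layer.next]
  cases L.finFlag
  · simp
  · simp only [Bool.toNat_true, one_mul, Nat.sub_self, zero_mul, add_zero, if_true]
    refine truthBit_congr ?_
    rw [Finset.sum_pos_iff]
    simp only [Finset.mem_univ, true_and]
    refine exists_congr fun q => ?_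
    rw [CanonicallyOrderedAdd.mul_pos, Nat.pos_iff_ne_zero, Nat.pos_iff_ne_zero, ne_eq, ne_eq,
      truthBit_eq_zero, truthBit_eq_zero, not_not, not_not]

/-- Both branches are evaluated and weighted by truth values, so the second one may meet a truncated
difference, which is then multiplied by 0. The variable y must differ from 1, because 1 is rebound
to a layer address before y is read. -/
theorem eval_pairNextE (h : Env s w k n m r) (hp : PowersAt w (posE s w k n m) mem) {AB AD u : ℕ}
    {LB LD : Layer Sig w} (hB : LayerAt eS mem AB LB) (hD : LayerAt eS mem AD LD) (a : Sig)
    (h6 : r 6 = AB) (h7 : r 7 = AD) (h3 : r 3 = eS a) {y : ℕ} (hy : r y = u) (hy1 : y ≠ 1) :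
    (pairNextE y).eval mem r = pairNext LB LD a u := by
  have e23 : r 23 = 2 ^ w := h 23 (by omega)
  simp only [pairNextE, eval_add, eval_mul, eval_lt, eval_var, eval_bind, eval_sub, eval_const,
    Function.update_of_ne, ne_eq, hy1, Nat.reduceEqDiff, not_false_eq_true, e23, hy]
  rw [eval_nextE (S := u) ((h.update (by omega) _).update (by omega) _) hp hB a (by simpa) (by simp)
    (by simpa), eval_nextE (S := u - 2 ^ w) ((h.update (by omega) _).update (by omega) _) hp hD a
    (by simpa) (by simp) (by simpa), pairNext]
  by_cases hlt : u < 2 ^ w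
  · rw [truthBit_eq_one.2 hlt, if_pos hlt]; simp
  · rw [truthBit_eq_zero.2 hlt, if_neg hlt]; simp

theorem eval_colourE (h : Env s w k n m r) (hp : PowersAt w (posE s w k n m) mem) {c u : SExpr}
    (hu : u.eval mem r < 2 * 2 ^ w) :
    (colourE c u).eval mem r = colour w (c.eval mem r) (u.eval mem r) := by
  have e21 : r 21 = w := h 21 (by omega)
  have e24 : r 24 = 2 * 2 ^ w := h 24 (by omega)
  have e35 : r 35 = posE s w k n m := h 35 (by omega)
  simp only [colourE, powE, eval_mod, eval_div, eval_load, eval_add, eval_mul, eval_var, eval_const,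
    e21, e24, e35, colour]
  rw [hp _ (Nat.mul_le_mul_left _ hu.le)]

theorem eval_compatibleE (hw : 0 < w) (h : Env s w k n m r)
    (hp : PowersAt w (posE s w k n m) mem)
    {AB AD : ℕ} {LB LD : Layer Sig w} (hB : LayerAt eS mem AB LB) (hD : LayerAt eS mem AD LD)
    (h6 : r 6 = AB) (h7 : r 7 = AD) :
    compatibleE.eval mem r = truthBit (Compatible LB LD (r 8) (r 9)) := by
  have e20 : r 20 = s := h 20 (by omega)
  have e24 : r 24 = 2 * 2 ^ w := h 24 (by omega)
  rw [compatibleE, eval_eq]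
  refine truthBit_congr ?_
  simp only [eval_sum, eval_const, Finset.sum_eq_zero_iff, Finset.mem_range, Function.update_of_ne,
    ne_eq, Nat.reduceEqDiff, not_false_eq_true, e20, e24]
  refine forall₂_congr fun u hu => forall₂_congr fun v hv => ?_
  have key : ∀ a : Sig,
      (eq (colourE (var 8) (var 10)) (colourE (var 8) (var 11)) * (const 1 - eq
        (colourE (var 9) (pairNextE 10)) (colourE (var 9) (pairNextE 11)))).eval mem
        (Function.update (Function.update (Function.update r 10 u) 11 v) 3 (eS a)) = 0 ↔
      (colour w (r 8) u = colour w (r 8) v →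
        colour w (r 9) (pairNext LB LD a u) = colour w (r 9) (pairNext LB LD a v)) := by
    intro a
    set r' :=
      Function.update (Function.update (Function.update r 10 u) 11 v) 3 ((eS a : ℕ)) with hr'
    have h' : Env s w k n m r' :=
      ((h.update (by omega) _).update (by omega) _).update (by omega) _
    have f10 : r' 10 = u := by simp [hr']
    have f11 : r' 11 = v := by simp [hr']
    have f8 : r' 8 = r 8 := by simp [hr']
    have f9 : r' 9 = r 9 := by simp [hr']
    have p1 := eval_pairNextE h' hp hB hD a (by simp [hr', h6]) (by simp [hr', h7]) (by simp [hr'])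
      f10 (by omega)
    have p2 := eval_pairNextE h' hp hB hD a (by simp [hr', h6]) (by simp [hr', h7]) (by simp [hr'])
      f11 (by omega)
    have l1 := pairNext_lt hw LB LD a u
    have l2 := pairNext_lt hw LB LD a v
    rw [eval_mul, eval_sub, eval_eq, eval_eq, eval_colourE h' hp (by rw [eval_var, f10]; exact hu),
      eval_colourE h' hp (by rw [eval_var, f11]; exact hv),
      eval_colourE h' hp (by rw [p1]; exact l1), eval_colourE h' hp (by rw [p2]; exact l2), p1, p2]
    simp only [eval_var, eval_const, f8, f9, f10, f11, Nat.mul_eq_zero, truthBit_eq_zero]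
    rw [imp_iff_not_or, one_sub_truthBit]
  constructor
  · intro H a hc
    exact (key a).1 (H (eS a) (eS a).2) hc
  · intro H i hi
    have := (key (eS.symm ⟨i, hi⟩)).2 (H _)
    simpa using this

/-- The assumption on c rules out capture: the expression is evaluated under the binders 10 and 11.
-/
theorem eval_colourFinalE (h : Env s w k n m r) (hp : PowersAt w (posE s w k n m) mem) {c : SExpr}
    (hc : ∀ u v, c.eval mem (Function.update (Function.update r 10 u) 11 v) = c.eval mem r) :
    (colourFinalE c).eval mem r = truthBit (ColourFinal w (c.eval mem r)) := by
  have e23 : r 23 = 2 ^ w := h 23 (by omega)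
  have e24 : r 24 = 2 * 2 ^ w := h 24 (by omega)
  rw [colourFinalE, eval_eq]
  refine truthBit_congr ?_
  simp only [eval_sum, eval_const, Finset.sum_eq_zero_iff, Finset.mem_range, Function.update_of_ne,
    ne_eq, Nat.reduceEqDiff, not_false_eq_true, e24]
  refine forall₂_congr fun u hu => forall₂_congr fun v hv => ?_
  have h' := (h.update (x := 10) (by omega) u).update (x := 11) (by omega) v
  rw [eval_mul, eval_sub, eval_eq, eval_eq, eval_colourE h' hp (by simpa using hu),
    eval_colourE h' hp (by simpa using hv), hc]
  simp only [eval_var, eval_mod, eval_const, Function.update_self, Function.update_of_ne, ne_eq,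
    Nat.reduceEqDiff, not_false_eq_true, e23, Nat.mul_eq_zero, truthBit_eq_zero]
  rw [imp_iff_not_or, one_sub_truthBit]

theorem eval_colourInitialE (h : Env s w k n m r) (hp : PowersAt w (posE s w k n m) mem)
    (c : SExpr) : (colourInitialE c).eval mem r = truthBit (ColourInitial w (c.eval mem r)) := by
  have e23 : r 23 = 2 ^ w := h 23 (by omega)
  have hM : 0 < 2 ^ w := by positivity
  rw [colourInitialE, eval_eq, eval_colourE h hp (by simp), eval_colourE h hp (by
    rw [eval_var, e23]; omega), ColourInitial, eval_var, eval_const, e23]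

/-! ### Weights -/

/-- With truncated subtraction, x + (y - x) is the maximum. -/
def combineE (b : Bool) (x y : SExpr) : SExpr := if b then x + (y - x) else x + y

theorem eval_combineE (b : Bool) (x y : SExpr) :
    (combineE b x y).eval mem r = combine b (x.eval mem r) (y.eval mem r) := by
  cases b
  · simp [combineE, combine]
  · simp [combineE, combine]; omega

theorem wf_combineE (b : Bool) {x y : SExpr} (hx : x.WF) (hy : y.WF) : (combineE b x y).WF := by
  cases b <;> simp [combineE, hx, hy]

def leftE : SExpr := sum 1 21 (load (var 7 + var 1))

def rightE : SExpr := sum 1 21 (load (var 7 + var 21 + var 1))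

def widthE : SExpr := combineE true leftE rightE

def statesE : SExpr := load (var 7 + const 4 * var 21) * leftE + rightE

/-- Counts the ones in the whole block of the transition relation, which is one flat sum of length
`w * s * w`. -/
def transE : SExpr := sum 1 25 (load (var 7 + const 4 * var 21 + const 2 + var 1))

theorem sum_truthBit_mem {α : Type*} [Fintype α] (T : Finset α) :
    ∑ x, truthBit (x ∈ T) = T.card := by
  classical
  have : ∀ x, truthBit (x ∈ T) = if x ∈ T then 1 else 0 := fun x => by
    unfold truthBit; split_ifs <;> rfl
  simp [this]

variable {A : ℕ} {L : Layer Sig w}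

theorem eval_leftE (h : Env s w k n m r) (hL : LayerAt eS mem A L) (h7 : r 7 = A) :
    leftE.eval mem r = L.left.card := by
  have e21 : r 21 = w := h 21 (by omega)
  simp [leftE, Finset.sum_range, e21, h7, hL.left, sum_truthBit_mem]

theorem eval_rightE (h : Env s w k n m r) (hL : LayerAt eS mem A L) (h7 : r 7 = A) :
    rightE.eval mem r = L.right.card := by
  have e21 : r 21 = w := h 21 (by omega)
  simp [rightE, Finset.sum_range, e21, h7, hL.right, sum_truthBit_mem]

theorem eval_widthE (h : Env s w k n m r) (hL : LayerAt eS mem A L) (h7 : r 7 = A) :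
    widthE.eval mem r = widthWeight L := by
  rw [widthE, eval_combineE, eval_leftE h hL h7, eval_rightE h hL h7, combine, if_pos rfl,
    widthWeight]

theorem eval_statesE (h : Env s w k n m r) (hL : LayerAt eS mem A L) (h7 : r 7 = A) :
    statesE.eval mem r = statesWeight L := by
  have e21 : r 21 = w := h 21 (by omega)
  simp [statesE, eval_leftE h hL h7, eval_rightE h hL h7, e21, h7, hL.initFlag, statesWeight]

theorem sum_range_mul (f : ℕ → ℕ) (a b : ℕ) :
    ∑ z ∈ Finset.range (a * b), f z =
      ∑ i ∈ Finset.range a, ∑ j ∈ Finset.range b, f (i * b + j) := by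
  induction a with
  | zero => simp
  | succ a ih => rw [Nat.succ_mul, Finset.sum_range_add, ih, Finset.sum_range_succ]

theorem eval_transE (h : Env s w k n m r) (hL : LayerAt eS mem A L) (h7 : r 7 = A) :
    transE.eval mem r = transWeight L := by
  let _ : Fintype Sig := Fintype.ofEquiv _ eS.symm
  have e21 : r 21 = w := h 21 (by omega)
  have e25 : r 25 = w * s * w := h 25 (by omega)
  simp only [transE, eval_sum, eval_load, eval_add, eval_var, eval_mul, eval_const, e25,
    Function.update_self, Function.update_of_ne, ne_eq, Nat.reduceEqDiff, not_false_eq_true,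
    e21, h7]
  rw [sum_range_mul, sum_range_mul, transWeight, ← sum_truthBit_mem, Fintype.sum_prod_type,
    Finset.sum_range]
  refine Finset.sum_congr rfl fun p _ => ?_
  rw [Fintype.sum_prod_type, Finset.sum_range, ← eS.sum_comp]
  refine Finset.sum_congr rfl fun a _ => ?_
  rw [Finset.sum_range]
  exact Finset.sum_congr rfl fun q _ => hL.trans p a q

theorem card_le_width (T : Finset (Fin w)) : T.card ≤ w := by
  simpa using T.card_le_univ

theorem widthWeight_le (L : Layer Sig w) (s : ℕ) : widthWeight L ≤ layerLen s w := by
  have h1 := card_le_width L.left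
  have h2 := card_le_width L.right
  unfold widthWeight layerLen
  omega

theorem statesWeight_le (L : Layer Sig w) (s : ℕ) : statesWeight L ≤ layerLen s w := by
  have h1 := card_le_width L.left
  have h2 := card_le_width L.right
  unfold statesWeight layerLen
  cases L.initFlag <;> simp <;> omega

theorem transWeight_le (eS : Sig ≃ Fin s) (L : Layer Sig w) : transWeight L ≤ layerLen s w := by
  let _ : Fintype Sig := Fintype.ofEquiv _ eS.symm
  have hc : Fintype.card Sig = s := by simpa using Fintype.card_congr eS
  have h1 := L.trans.card_le_univ
  rw [Fintype.card_prod, Fintype.card_prod, Fintype.card_fin, hc] at h1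
  unfold transWeight layerLen
  rw [mul_assoc]
  omega

end Eval

/-! ### Reading the encoding of the input -/

section Encoding

theorem List.getD_flatMap_uniform {α : Type*} {f : α → List ℕ} {c : ℕ} (l : List α)
    (hf : ∀ x ∈ l, (f x).length = c) (i : ℕ) (hi : i < l.length) (z : ℕ) (hz : z < c) :
    (l.flatMap f).getD (i * c + z) 0 = (f l[i]).getD z 0 := by
  induction l generalizing i with
  | nil => simp at hi
  | cons x l ih =>
    have hx := hf x (by simp)
    rw [List.flatMap_cons]
    obtain _ | i := i
    · rw [List.getD_append _ _ _ _ (by omega)]; simp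
    · rw [List.getD_append_right _ _ _ _ (by rw [Nat.succ_mul]; omega), hx, Nat.succ_mul,
        show i * c + c + z - c = i * c + z by omega,
        ih (fun y hy => hf y (List.mem_cons_of_mem _ hy)) i (by simpa using hi)]
      rfl

theorem List.length_flatMap_uniform {α : Type*} {f : α → List ℕ} {c : ℕ} (l : List α)
    (hf : ∀ x ∈ l, (f x).length = c) : (l.flatMap f).length = l.length * c := by
  induction l with
  | nil => simp
  | cons x l ih =>
    rw [List.flatMap_cons, List.length_append, hf x (by simp),
      ih fun y hy => hf y (List.mem_cons_of_mem _ hy), List.length_cons, Nat.succ_mul, add_comm]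

theorem List.getD_map_finRange {w : ℕ} (f : Fin w → ℕ) (p : Fin w) :
    ((List.finRange w).map f).getD p 0 = f p := by
  simp [List.getD]

variable {Sig : Type u} {Q : Type v} {s w n : ℕ}

theorem length_encodeTrans (eS : Sig ≃ Fin s) (L : Layer Sig w) (p : Fin w) :
    ((List.finRange s).flatMap fun a => (List.finRange w).map fun q =>
      truthBit ((p, eS.symm a, q) ∈ L.trans)).length = s * w := by
  rw [List.length_flatMap_uniform (c := w) _ (by simp)]; simp

theorem length_encodeLayer (eS : Sig ≃ Fin s) (L : Layer Sig w) :
    (encodeLayer eS L).length = layerLen s w := by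
  simp only [encodeLayer, List.length_append, List.length_map, List.length_finRange,
    List.length_cons, List.length_nil]
  rw [List.length_flatMap_uniform (c := s * w) _ (fun p _ => length_encodeTrans eS L p),
    List.length_finRange, layerLen, mul_assoc]
  omega

/-- Stated for an arbitrary address, since it serves both for the layers of B and for those inside
the transitions of F. -/
theorem layerAt_of_encodeLayer {eS : Sig ≃ Fin s} {mem : ℕ → ℕ} {A : ℕ} {L : Layer Sig w}
    (h : ∀ z < layerLen s w, mem (A + z) = (encodeLayer eS L).getD z 0) :
    LayerAt eS mem A L := by
  have hl : w + w + w + w + 2 ≤ layerLen s w := by unfold layerLen; omega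
  have hlen : ∀ f : Fin w → ℕ, ((List.finRange w).map f).length = w := by simp
  constructor
  · intro p
    have := p.2
    rw [h _ (by omega), encodeLayer, List.getD_append _ _ _ _ (by simp; omega),
      List.getD_append _ _ _ _ (by simp; omega), List.getD_append _ _ _ _ (by simp; omega),
      List.getD_append _ _ _ _ (by simp; omega), List.getD_append _ _ _ _ (by simp),
      List.getD_map_finRange]
  · intro p
    have := p.2
    rw [add_assoc, h _ (by omega), encodeLayer, List.getD_append _ _ _ _ (by simp; omega),
      List.getD_append _ _ _ _ (by simp; omega), List.getD_append _ _ _ _ (by simp; omega),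
      List.getD_append _ _ _ _ (by simp), List.getD_append_right _ _ _ _ (by simp), hlen,
      Nat.add_sub_cancel_left, List.getD_map_finRange]
  · intro p
    have := p.2
    rw [add_assoc, h _ (by omega), encodeLayer, List.getD_append _ _ _ _ (by simp; omega),
      List.getD_append _ _ _ _ (by simp; omega), List.getD_append _ _ _ _ (by simp; omega),
      List.getD_append_right _ _ _ _ (by simp; omega), List.length_append, hlen, hlen,
      ← two_mul, Nat.add_sub_cancel_left, List.getD_map_finRange]
  · intro p
    have := p.2
    rw [add_assoc, h _ (by omega), encodeLayer, List.getD_append _ _ _ _ (by simp; omega),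
      List.getD_append _ _ _ _ (by simp; omega),
      List.getD_append_right _ _ _ _ (by simp; omega), List.length_append, List.length_append,
      hlen, hlen, hlen, show 3 * w + (p : ℕ) - (w + w + w) = p by omega, List.getD_map_finRange]
  · rw [h _ (by omega), encodeLayer, List.getD_append _ _ _ _ (by simp; omega),
      List.getD_append_right _ _ _ _ (by simp; omega)]
    simp only [List.length_append, hlen]
    rw [show 4 * w - (w + w + w + w) = 0 by omega]
    rfl
  · rw [add_assoc, h _ (by omega), encodeLayer, List.getD_append _ _ _ _ (by simp; omega),
      List.getD_append_right _ _ _ _ (by simp; omega)]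
    simp only [List.length_append, hlen]
    rw [show 4 * w + 1 - (w + w + w + w) = 1 by omega]
    rfl
  · intro p a q
    have h1 : (eS a : ℕ) * w + q < s * w := mul_add_lt_mul (eS a).2 q.2
    have h2 : (p : ℕ) * (s * w) + ((eS a : ℕ) * w + q) < w * (s * w) := mul_add_lt_mul p.2 h1
    have h3 : ((p : ℕ) * s + eS a) * w + q = p * (s * w) + ((eS a : ℕ) * w + q) := by ring
    have h4 : w * s * w = w * (s * w) := mul_assoc _ _ _
    rw [h3, show A + 4 * w + 2 + (p * (s * w) + ((eS a : ℕ) * w + q)) =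
      A + (4 * w + 2 + (p * (s * w) + ((eS a : ℕ) * w + q))) by omega,
      h _ (by unfold layerLen; omega), encodeLayer, List.getD_append_right _ _ _ _ (by simp; omega)]
    simp only [List.length_append, hlen, List.length_cons, List.length_nil]
    rw [show 4 * w + 2 + (p * (s * w) + ((eS a : ℕ) * w + q)) - (w + w + w + w + (0 + 1 + 1)) =
      p * (s * w) + ((eS a : ℕ) * w + q) by omega,
      List.getD_flatMap_uniform (c := s * w) _ (fun p _ => length_encodeTrans eS L p) p (by simp)
        _ h1, List.getD_flatMap_uniform (c := w) _ (by simp) (eS a) (by simp) q q.2,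
      List.getD_map_finRange]
    simp

theorem length_encodeODD (eS : Sig ≃ Fin s) (B : List (Layer Sig w)) :
    (encodeODD eS B).length = 1 + B.length * layerLen s w := by
  rw [encodeODD, List.length_cons,
    List.length_flatMap_uniform _ (fun L _ => length_encodeLayer eS L), add_comm]

/-- The part of the input before the automaton. -/
theorem encodeInput_odd (eS : Sig ≃ Fin s) (eQ : Q ≃ Fin n) (B : List (Layer Sig w))
    (F : NFA (Layer Sig w) Q) (ts : List (Q × Layer Sig w × Q)) (i : ℕ)
    (hi : i < (encodeODD eS B).length) :
    (encodeInput eS eQ B F ts).getD (2 + i) 0 = (encodeODD eS B).getD i 0 := by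
  rw [encodeInput, List.getD_append _ _ _ _ (by simp; omega),
    List.getD_append_right _ _ _ _ (by simp)]
  simp

theorem encodeODD_layer (eS : Sig ≃ Fin s) (B : List (Layer Sig w)) {i z : ℕ} (hi : i < B.length)
    (hz : z < layerLen s w) :
    (encodeODD eS B).getD (1 + (i * layerLen s w + z)) 0 =
      (encodeLayer eS (B.getD i default)).getD z 0 := by
  rw [encodeODD, add_comm, List.getD_cons_succ,
    List.getD_flatMap_uniform _ (fun L _ => length_encodeLayer eS L) i hi z hz]
  simp [List.getD, List.getElem?_eq_getElem hi]

theorem encodeInput_fa (eS : Sig ≃ Fin s) (eQ : Q ≃ Fin n) (B : List (Layer Sig w))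
    (F : NFA (Layer Sig w) Q) (ts : List (Q × Layer Sig w × Q)) (i : ℕ) :
    (encodeInput eS eQ B F ts).getD (posF s w B.length + i) 0 =
      (encodeFA eS eQ F ts).getD i 0 := by
  have h : ([s, w] ++ encodeODD eS B).length = posF s w B.length := by
    rw [List.length_append, length_encodeODD, posF]; simp; omega
  rw [encodeInput, List.getD_append_right _ _ _ _ (by omega), h, Nat.add_sub_cancel_left]

theorem length_encodeEdge (eS : Sig ≃ Fin s) (eQ : Q ≃ Fin n) (t : Q × Layer Sig w × Q) :
    ((eQ t.1 : ℕ) :: (eQ t.2.2 : ℕ) :: encodeLayer eS t.2.1).length = layerLen s w + 2 := by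
  simp [length_encodeLayer]

theorem encodeFA_edge (eS : Sig ≃ Fin s) (eQ : Q ≃ Fin n)
    (F : NFA (Layer Sig w) Q) (ts : List (Q × Layer Sig w × Q)) {j z : ℕ} (hj : j < ts.length)
    (hz : z < layerLen s w + 2) :
    (encodeFA eS eQ F ts).getD (2 + 2 * n + (j * (layerLen s w + 2) + z)) 0 =
      ((transSrc eQ ts j) :: (transDst eQ ts j) ::
        encodeLayer eS (transLayer ts j)).getD z 0 := by
  rw [encodeFA, List.getD_append_right _ _ _ _ (by simp; omega)]
  simp only [List.length_append, List.length_map, List.length_finRange, List.length_cons,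
    List.length_nil]
  rw [show 2 + 2 * n + (j * (layerLen s w + 2) + z) - (0 + 1 + 1 + n + n) =
    j * (layerLen s w + 2) + z by omega,
    List.getD_flatMap_uniform _ (fun t _ => length_encodeEdge eS eQ t) j hj z hz]
  simp [transSrc, transDst, transLayer, List.getElem?_eq_getElem hj]

theorem encodeFA_start (eS : Sig ≃ Fin s) (eQ : Q ≃ Fin n)
    (F : NFA (Layer Sig w) Q) (ts : List (Q × Layer Sig w × Q)) (q : Fin n) :
    (encodeFA eS eQ F ts).getD (2 + q) 0 = truthBit (eQ.symm q ∈ F.start) := by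
  have := q.2
  rw [encodeFA, List.getD_append _ _ _ _ (by simp; omega),
    List.getD_append _ _ _ _ (by simp; omega),
    List.getD_append_right _ _ _ _ (by simp)]
  simp only [List.length_cons, List.length_nil]
  rw [show 2 + (q : ℕ) - (0 + 1 + 1) = q by omega, List.getD_map_finRange]

theorem encodeFA_accept (eS : Sig ≃ Fin s) (eQ : Q ≃ Fin n)
    (F : NFA (Layer Sig w) Q) (ts : List (Q × Layer Sig w × Q)) (q : Fin n) :
    (encodeFA eS eQ F ts).getD (2 + n + q) 0 = truthBit (eQ.symm q ∈ F.accept) := by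
  have := q.2
  rw [encodeFA, List.getD_append _ _ _ _ (by simp; omega),
    List.getD_append_right _ _ _ _ (by simp; omega)]
  simp only [List.length_cons, List.length_nil, List.length_append, List.length_map,
    List.length_finRange]
  rw [show 2 + n + (q : ℕ) - (0 + 1 + 1 + n) = q by omega, List.getD_map_finRange]

theorem encodeFA_zero (eS : Sig ≃ Fin s) (eQ : Q ≃ Fin n)
    (F : NFA (Layer Sig w) Q) (ts : List (Q × Layer Sig w × Q)) :
    (encodeFA eS eQ F ts).getD 0 0 = n := by simp [encodeFA]

theorem encodeFA_one (eS : Sig ≃ Fin s) (eQ : Q ≃ Fin n)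
    (F : NFA (Layer Sig w) Q) (ts : List (Q × Layer Sig w × Q)) :
    (encodeFA eS eQ F ts).getD 1 0 = ts.length := by simp [encodeFA]

theorem length_encodeInput (eS : Sig ≃ Fin s) (eQ : Q ≃ Fin n) (B : List (Layer Sig w))
    (F : NFA (Layer Sig w) Q) (ts : List (Q × Layer Sig w × Q)) :
    (encodeInput eS eQ B F ts).length = posE s w B.length n ts.length := by
  rw [encodeInput, List.length_append, List.length_append, length_encodeODD, encodeFA,
    List.length_append, List.length_flatMap_uniform _ (fun t _ => length_encodeEdge eS eQ t)]
  simp only [List.length_cons, List.length_nil, List.length_append, List.length_map,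
    List.length_finRange, posE, posT, posF]
  omega

/-- Every entry of the input is bounded. -/
theorem le_of_mem_encodeLayer {eS : Sig ≃ Fin s} {L : Layer Sig w} {x : ℕ}
    (hx : x ∈ encodeLayer eS L) : x ≤ 1 := by
  simp only [encodeLayer, List.mem_append, List.mem_map, List.mem_flatMap, List.mem_cons,
    List.not_mem_nil, or_false] at hx
  rcases hx with ((((⟨_, -, rfl⟩ | ⟨_, -, rfl⟩) | ⟨_, -, rfl⟩) | ⟨_, -, rfl⟩) | rfl | rfl) |
    ⟨_, -, _, -, _, -, rfl⟩
  any_goals exact truthBit_le _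
  all_goals exact Bool.toNat_le _

theorem le_of_mem_encodeInput {eS : Sig ≃ Fin s} {eQ : Q ≃ Fin n} {B : List (Layer Sig w)}
    {F : NFA (Layer Sig w) Q} {ts : List (Q × Layer Sig w × Q)} {x X : ℕ}
    (hs : s ≤ X) (hw : w ≤ X) (hk : B.length ≤ X) (hn : n ≤ X) (hm : ts.length ≤ X) (h1 : 1 ≤ X)
    (hx : x ∈ encodeInput eS eQ B F ts) : x ≤ X := by
  simp only [encodeInput, encodeODD, encodeFA, List.mem_append, List.mem_map, List.mem_flatMap,
    List.mem_cons, List.not_mem_nil, or_false] at hx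
  rcases hx with ((rfl | rfl) | rfl | ⟨_, -, hx⟩) |
    (((rfl | rfl) | ⟨_, -, rfl⟩) | ⟨_, -, rfl⟩) | ⟨_, -, rfl | rfl | hx⟩
  any_goals assumption
  · exact (le_of_mem_encodeLayer hx).trans h1
  · exact (truthBit_le _).trans h1
  · exact (truthBit_le _).trans h1
  · exact (Fin.is_lt _).le.trans hn
  · exact (Fin.is_lt _).le.trans hn
  · exact (le_of_mem_encodeLayer hx).trans h1

/-- The encoding of the input stands in the memory, at least from the address `A` on. -/
def InputFrom (eS : Sig ≃ Fin s) (eQ : Q ≃ Fin n) (B : List (Layer Sig w))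
    (F : NFA (Layer Sig w) Q) (ts : List (Q × Layer Sig w × Q)) (A : ℕ) (mem : ℕ → ℕ) : Prop :=
  ∀ a, A ≤ a → a < posE s w B.length n ts.length → mem a = (encodeInput eS eQ B F ts).getD a 0

variable {eS : Sig ≃ Fin s} {eQ : Q ≃ Fin n} {B : List (Layer Sig w)}
    {F : NFA (Layer Sig w) Q} {ts : List (Q × Layer Sig w × Q)} {A : ℕ} {mem : ℕ → ℕ}

theorem InputFrom.layer (h : InputFrom eS eQ B F ts 0 mem) {i : ℕ} (hi : i < B.length) :
    LayerAt eS mem (3 + i * layerLen s w) (B.getD i default) := by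
  refine layerAt_of_encodeLayer fun z hz => ?_
  have h1 := mul_add_lt_mul hi hz
  rw [h _ (Nat.zero_le _) (by unfold posE posT posF; omega), ← encodeODD_layer eS B hi hz,
    ← encodeInput_odd eS eQ B F ts _ (by rw [length_encodeODD]; omega)]
  congr 1
  omega

theorem InputFrom.edge (h : InputFrom eS eQ B F ts A mem) (hA : A ≤ posF s w B.length) {j z : ℕ}
    (hj : j < ts.length) (hz : z < layerLen s w + 2) :
    mem (posT s w B.length n + j * (layerLen s w + 2) + z) =
      ((transSrc eQ ts j) :: (transDst eQ ts j) ::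
        encodeLayer eS (transLayer ts j)).getD z 0 := by
  have h1 := mul_add_lt_mul hj hz
  rw [h _ (by unfold posT; omega) (by unfold posE; omega), ← encodeFA_edge eS eQ F ts hj hz,
    ← encodeInput_fa eS eQ B F ts]
  congr 1
  unfold posT
  omega

theorem InputFrom.src (h : InputFrom eS eQ B F ts A mem) (hA : A ≤ posF s w B.length) {j : ℕ}
    (hj : j < ts.length) :
    mem (posT s w B.length n + j * (layerLen s w + 2)) = transSrc eQ ts j :=
  h.edge hA hj (z := 0) (by omega)

theorem InputFrom.dst (h : InputFrom eS eQ B F ts A mem) (hA : A ≤ posF s w B.length) {j : ℕ}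
    (hj : j < ts.length) :
    mem (posT s w B.length n + j * (layerLen s w + 2) + 1) = transDst eQ ts j :=
  h.edge hA hj (z := 1) (by omega)

theorem InputFrom.edgeLayer (h : InputFrom eS eQ B F ts A mem) (hA : A ≤ posF s w B.length)
    {j z : ℕ} (hj : j < ts.length) (hz : z < layerLen s w) :
    mem (posT s w B.length n + j * (layerLen s w + 2) + 2 + z) =
      (encodeLayer eS (transLayer ts j)).getD z 0 := by
  rw [add_assoc _ 2 z, h.edge hA hj (z := 2 + z) (by omega), add_comm 2 z]
  rfl

theorem InputFrom.start (h : InputFrom eS eQ B F ts A mem) (hA : A ≤ posF s w B.length) {q : ℕ}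
    (hq : q < n) : mem (posF s w B.length + 2 + q) =
      truthBit (∃ p, (eQ p : ℕ) = q ∧ p ∈ F.start) := by
  rw [h _ (by omega) (by unfold posE posT; omega), add_assoc, encodeInput_fa,
    encodeFA_start eS eQ F ts ⟨q, hq⟩]
  refine truthBit_congr ⟨fun h => ⟨_, by simp, h⟩, ?_⟩
  rintro ⟨p, rfl, hp⟩
  simpa using hp

theorem InputFrom.accept (h : InputFrom eS eQ B F ts A mem) (hA : A ≤ posF s w B.length) {q : ℕ}
    (hq : q < n) : mem (posF s w B.length + 2 + n + q) =
      truthBit (∃ p, (eQ p : ℕ) = q ∧ p ∈ F.accept) := by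
  rw [h _ (by omega) (by unfold posE posT; omega), add_assoc, add_assoc, encodeInput_fa,
    ← add_assoc 2, encodeFA_accept eS eQ F ts ⟨q, hq⟩]
  refine truthBit_congr ⟨fun h => ⟨_, by simp, h⟩, ?_⟩
  rintro ⟨p, rfl, hp⟩
  simpa using hp

end Encoding

/-! ### Statements whose running time is bounded by a power of the small parameters -/

/-- An exponent that bounds the running time of a statement with short loops. -/
def Stm.time : Stm → ℕ
  | skip => 1
  | asg _ e => e.time + 1
  | put a e => a.time + e.time + 1
  | seq p q => p.time + q.time
  | ite e p q => e.time + p.time + q.time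
  | loop _ _ p => p.time + 2

theorem Stm.time_pos : ∀ p : Stm, 1 ≤ p.time
  | skip => le_rfl
  | asg _ e => by simp [time]
  | put a e => by simp [time]
  | seq p q => by have := time_pos p; simp only [time]; omega
  | ite e p q => by have := e.time_pos; simp only [time]; omega
  | loop _ _ p => by simp [time]

/-- Started in `s`, the statement halts within `L ^ p.time` steps in a store satisfying `post`. -/
def Fast (X L : ℕ) (p : Stm) (s : Store) (post : Store → Prop) : Prop :=
  Runs X p (L ^ p.time) s post

namespace Fast

variable {X L : ℕ} {s : Store} {post mid : Store → Prop}

theorem skip (hL : 16 ≤ L) (h : post s) : Fast X L .skip s post :=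
  (Runs.skip h).weaken (Nat.one_le_pow _ _ (by omega)) fun _ h => h

theorem asg (hX : 2 ≤ X) (hL : 16 ≤ L) {x : ℕ} {e : SExpr} (hs : s.Le X L) (hwf : e.WF)
    (h : post (s.setReg x (e.eval s.mem s.reg))) : Fast X L (.asg x e) s post := by
  refine (Runs.asg hX hL hs hwf h).weaken ?_ fun _ h => h
  have h1 : 1 ≤ L ^ e.time := Nat.one_le_pow _ _ (by omega)
  simp only [Stm.time, pow_succ]
  nlinarith

theorem put (hX : 2 ≤ X) (hL : 16 ≤ L) {a e : SExpr} (hs : s.Le X L) (hwa : a.WF) (hwe : e.WF)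
    (h : post (s.setMem (a.eval s.mem s.reg) (e.eval s.mem s.reg))) :
    Fast X L (.put a e) s post := by
  refine (Runs.put hX hL hs hwa hwe h).weaken ?_ fun _ h => h
  have h1 := add_le_pow_add (X := L) (by omega) a.time_pos e.time_pos
  have h2 : 1 ≤ L ^ (a.time + e.time) := Nat.one_le_pow _ _ (by omega)
  simp only [Stm.time, pow_succ]
  nlinarith

theorem seq (hX : 2 ≤ X) (hL : 16 ≤ L) {p q : Stm} (hp : Fast X L p s mid)
    (hq : ∀ s', mid s' → Fast X L q s' post) : Fast X L (.seq p q) s post :=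
  (Runs.seq hX hp hq).weaken (add_le_pow_add (by omega) p.time_pos q.time_pos) fun _ h => h

theorem ite (hX : 2 ≤ X) (hL : 16 ≤ L) {e : SExpr} {p q : Stm} (hs : s.Le X L) (hwf : e.WF)
    (hp : e.eval s.mem s.reg ≠ 0 → Fast X L p s post)
    (hq : e.eval s.mem s.reg = 0 → Fast X L q s post) : Fast X L (.ite e p q) s post := by
  have hpt := p.time_pos
  have hqt := q.time_pos
  have het := e.time_pos
  have h1 : L ≤ L ^ (p.time + q.time - 1) := Nat.le_self_pow (by omega) L
  have h2 : L ^ (p.time + q.time - 1) * L = L ^ (p.time + q.time) := by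
    rw [← pow_succ]; congr 1; omega
  have h3 : L ^ p.time ≤ L ^ (p.time + q.time - 1) := Nat.pow_le_pow_right (by omega) (by omega)
  have h4 : L ^ q.time ≤ L ^ (p.time + q.time - 1) := Nat.pow_le_pow_right (by omega) (by omega)
  refine (Runs.ite (T := L ^ (p.time + q.time - 1)) hX hL hs hwf
    (fun h => (hp h).weaken h3 fun _ h => h)
    (fun h => (hq h).weaken h4 fun _ h => h)).weaken ?_ fun _ h => h
  have h5 := add_le_pow_add (X := L) (a := e.time) (b := p.time + q.time) (by omega) het (by omega)
  simp only [Stm.time, add_assoc]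
  nlinarith

/-- For the long loops over nodes and edges, whose number of iterations is not bounded by L and has
to remain an explicit factor. -/
theorem loop_time_le (hL : 16 ≤ L) (N : ℕ) (p : Stm) :
    N * (L ^ p.time + 8) + 8 ≤ (N + 1) * L ^ (p.time + 1) := by
  have h1 : L ≤ L ^ p.time := Nat.le_self_pow (by have := p.time_pos; omega) L
  rw [pow_succ]
  have : L ^ p.time + 8 ≤ L ^ p.time * L := by nlinarith
  nlinarith

theorem loop (hX : 2 ≤ X) (hL : 16 ≤ L) {x n N : ℕ} {p : Stm} (Inv : ℕ → Store → Prop)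
    (hn : s.reg n = N) (hNX : N ≤ X) (hNL : N + 1 ≤ L) (hxn : x ≠ n) (h0 : Inv 0 (s.setReg x 0))
    (hstep : ∀ i < N, ∀ s, s.reg x = i → s.reg n = N → Inv i s →
      Fast X L p s fun s' => s'.reg x = i ∧ s'.reg n = N ∧ Inv (i + 1) (s'.setReg x (i + 1)))
    (hpost : ∀ s', s'.reg x = N → s'.reg n = N → Inv N s' → post s') :
    Fast X L (.loop x n p) s post := by
  refine (Runs.loop hX Inv hn hNX hxn h0 hstep hpost).weaken ?_ fun _ h => h
  refine (loop_time_le hL N p).trans ?_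
  rw [Stm.time, show p.time + 2 = p.time + 1 + 1 from rfl, pow_succ _ (p.time + 1), mul_comm]
  exact Nat.mul_le_mul_left _ hNL

end Fast

namespace Store

variable {X L : ℕ} {s : Store}

@[simp] theorem setReg_reg (x v : ℕ) : (s.setReg x v).reg = Function.update s.reg x v := rfl
@[simp] theorem setReg_mem (x v : ℕ) : (s.setReg x v).mem = s.mem := rfl
@[simp] theorem setMem_reg (x v : ℕ) : (s.setMem x v).reg = s.reg := rfl
@[simp] theorem setMem_mem (x v : ℕ) : (s.setMem x v).mem = Function.update s.mem x v := rfl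

end Store

/-! ### The program -/

open SExpr Stm

/-- Registers 20 to 29 receive numbers that depend on s and w alone and may bound sums; those from
30 on also depend on k, n or m. The powers of two occupy every third cell behind the input, which
leaves the other two residue classes for the tables of weights and back pointers. -/
def setupStm : Stm :=
  .seq (.asg 20 (load (const 0))) <|
  .seq (.asg 21 (load (const 1))) <|
  .seq (.asg 30 (load (const 2))) <|
  .seq (.asg 25 (var 21 * var 20 * var 21)) <|
  .seq (.asg 22 (const 4 * var 21 + const 2 + var 25)) <|
  .seq (.asg 31 (const 3 + var 30 * var 22)) <|
  .seq (.asg 32 (load (var 31))) <|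
  .seq (.asg 33 (load (var 31 + const 1))) <|
  .seq (.asg 34 (var 31 + const 2 + const 2 * var 32)) <|
  .seq (.asg 35 (var 34 + var 33 * (var 22 + const 2))) <|
  .seq (.asg 14 (const 1)) <|
  .seq (.loop 12 21 (.asg 14 (var 14 * const 2))) <|
  .seq (.asg 23 (var 14)) <|
  .seq (.asg 24 (const 2 * var 23)) <|
  .seq (.asg 27 ((var 21 + const 1) * var 24)) <|
  .seq (.put (var 35) (const 1)) <|
  .seq (.loop 12 27 (.put (var 35 + const 3 * (var 12 + const 1)) (powE (var 12) * const 2))) <|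
  .seq (.asg 26 (powE (var 27))) <|
  .seq (.asg 36 (var 32 * var 26)) <|
  .seq (.asg 37 (var 33 * (var 26 * var 26))) .skip

/-- Bounds for the values that occur in the computation. -/
structure Bounds (X L s w k n m : ℕ) : Prop where
  two_le : 2 ≤ X
  le_L : 16 ≤ L
  const : ∀ x, constEnv s w k n m x ≤ X
  small : ∀ x, 20 ≤ x → x < 30 → constEnv s w k n m x + 1 ≤ L
  weight : k * layerLen s w + 1 ≤ X

/-- The constants in `D` have been computed, the other variables from `20` on are `0`. -/
def Known (s w k n m : ℕ) (D : List ℕ) (r : ℕ → ℕ) : Prop :=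
  ∀ x, 20 ≤ x → r x = if x ∈ D then constEnv s w k n m x else 0

/-- The state during the setup. -/
structure SetupState (X s w k n m : ℕ) (D : List ℕ) (σ : Store) : Prop where
  known : Known s w k n m D σ.reg
  locals : ∀ x < 20, σ.reg x ≤ X
  mem : ∀ a, σ.mem a ≤ X

/-! ### Correctness of the setup -/

section Setup

variable {X L s w k n m : ℕ} {D : List ℕ} {σ : Store} {post : Store → Prop}

theorem SetupState.le (hb : Bounds X L s w k n m) (h : SetupState X s w k n m D σ) :
    σ.Le X L := by
  refine ⟨fun x => ?_, h.mem, fun x h1 h2 => ?_⟩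
  · by_cases hx : x < 20
    · exact h.locals x hx
    · rw [h.known x (by omega)]
      split
      · exact hb.const x
      · exact Nat.zero_le _
  · rw [h.known x h1]
    split
    · exact (Nat.le_succ _).trans (hb.small x h1 h2)
    · exact Nat.zero_le _

/-- A rule in continuation form, so that the long chain of constants is verified one assignment at a
time. -/
theorem SetupState.asg (hb : Bounds X L s w k n m) (h : SetupState X s w k n m D σ) {x : ℕ}
    (hx : 20 ≤ x) {e : SExpr} (hwf : e.WF) {q : Stm}
    (he : e.eval σ.mem σ.reg = constEnv s w k n m x)
    (hq : SetupState X s w k n m (x :: D) (σ.setReg x (constEnv s w k n m x)) →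
      Fast X L q (σ.setReg x (constEnv s w k n m x)) post) :
    Fast X L (.seq (.asg x e) q) σ post := by
  refine Fast.seq hb.two_le hb.le_L (mid := (· = σ.setReg x (constEnv s w k n m x)))
    (.asg hb.two_le hb.le_L (h.le hb) hwf (by rw [he])) ?_
  rintro _ rfl
  refine hq ⟨fun y hy => ?_, fun y hy => ?_, h.mem⟩
  · by_cases hxy : y = x
    · subst hxy; simp
    · simp [hxy, h.known y hy]
  · rw [Store.setReg_reg, Function.update_of_ne (by omega)]
    exact h.locals y hy

theorem SetupState.setLocal (h : SetupState X s w k n m D σ) {x v : ℕ} (hx : x < 20)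
    (hv : v ≤ X) : SetupState X s w k n m D (σ.setReg x v) := by
  refine ⟨fun y hy => ?_, fun y hy => ?_, h.mem⟩
  · rw [Store.setReg_reg, Function.update_of_ne (by omega), h.known y hy]
  · rw [Store.setReg_reg, Function.update_apply]
    split
    · exact hv
    · exact h.locals y hy

theorem SetupState.setMem (h : SetupState X s w k n m D σ) {a v : ℕ}
    (hv : v ≤ X) : SetupState X s w k n m D (σ.setMem a v) := by
  refine ⟨h.known, h.locals, fun y => ?_⟩
  rw [Store.setMem_mem, Function.update_apply]
  split
  · exact hv
  · exact h.mem y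

/-- After the setup, the constants are known and the table of powers of two is filled. -/
structure SetupDone (X s w k n m : ℕ) (mem₀ : ℕ → ℕ) (σ : Store) : Prop where
  env : Env s w k n m σ.reg
  locals : ∀ x < 20, σ.reg x ≤ X
  le : ∀ a, σ.mem a ≤ X
  input : ∀ a < posE s w k n m, σ.mem a = mem₀ a
  powers : PowersAt w (posE s w k n m) σ.mem
  rest : ∀ t, σ.mem (posE s w k n m + 3 * t + 1) = mem₀ (posE s w k n m + 3 * t + 1)

theorem fast_setupStm (hb : Bounds X L s w k n m) (h : SetupState X s w k n m [] σ)
    (h0 : σ.mem 0 = s) (h1 : σ.mem 1 = w) (h2 : σ.mem 2 = k)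
    (hn : σ.mem (posF s w k) = n) (hm : σ.mem (posF s w k + 1) = m) :
    Fast X L setupStm σ (SetupDone X s w k n m σ.mem) := by
  have hwX : w ≤ X := hb.const 21
  have hwL : w + 1 ≤ L := hb.small 21 (by omega) (by omega)
  have hMX : 2 ^ w ≤ X := hb.const 23
  have hKX : numColourings w ≤ X := hb.const 26
  refine h.asg hb (by omega) (by simp) (by simpa [constEnv] using h0) fun h => ?_
  refine h.asg hb (by omega) (by simp) (by simpa [constEnv] using h1) fun h => ?_
  refine h.asg hb (by omega) (by simp) (by simpa [constEnv] using h2) fun h => ?_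
  refine h.asg hb (by omega) (by simp) (by simp [constEnv]) fun h => ?_
  refine h.asg hb (by omega) (by simp) (by simp [constEnv, layerLen]) fun h => ?_
  refine h.asg hb (by omega) (by simp) (by simp [constEnv, posF]) fun h => ?_
  refine h.asg hb (by omega) (by simp) (by simpa [constEnv] using hn) fun h => ?_
  refine h.asg hb (by omega) (by simp) (by simpa [constEnv] using hm) fun h => ?_
  refine h.asg hb (by omega) (by simp) (by simp [constEnv, posT]) fun h => ?_
  refine h.asg hb (by omega) (by simp) (by simp [constEnv, posE]) fun h => ?_
  -- From here on only the known constants and the unchanged memory matter, not how the store arose;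
  -- forgetting it keeps the terms small.
  generalize hσ₁ : (Store.setReg _ 35 _ : Store) = σ₁ at h ⊢
  have hmem₁ : σ₁.mem = σ.mem := by rw [← hσ₁]; rfl
  rw [← hmem₁]
  clear hσ₁
  refine Fast.seq hb.two_le hb.le_L (mid := (· = σ₁.setReg 14 1))
    (.asg hb.two_le hb.le_L (h.le hb) (by simp) (by simp)) ?_
  rintro _ rfl
  refine Fast.seq hb.two_le hb.le_L (mid := fun s' => s'.mem = σ₁.mem ∧
    SetupState X s w k n m [35, 34, 33, 32, 31, 22, 25, 30, 21, 20] s' ∧ s'.reg 14 = 2 ^ w)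
    (Fast.loop (N := w) hb.two_le hb.le_L (fun i s' => s'.mem = σ₁.mem ∧
      SetupState X s w k n m [35, 34, 33, 32, 31, 22, 25, 30, 21, 20] s' ∧ s'.reg 14 = 2 ^ i)
      ?_ hwX hwL (by omega) ?_ ?_ ?_) ?_
  · have := h.known 21 (by omega)
    simpa [constEnv] using this
  · refine ⟨rfl, (h.setLocal (by omega) (by have := hb.two_le; omega)).setLocal (by omega)
      (by omega), by simp⟩
  · rintro i hi s' hx hn' ⟨g1, g2, g3⟩
    have : 2 ^ (i + 1) ≤ X := (Nat.pow_le_pow_right (by omega) (by omega)).trans hMX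
    refine .asg hb.two_le hb.le_L (g2.le hb) (by simp) ?_
    simp only [eval_mul, eval_var, eval_const, g3]
    refine ⟨by simpa using hx, by simpa using hn', by simpa using g1, ?_, by simp [pow_succ]⟩
    exact (g2.setLocal (by omega) (by rwa [← pow_succ])).setLocal (by omega) (by omega)
  · rintro s' - - h; exact h
  · clear h
    rintro s' ⟨g1, h, g3⟩
    rw [← g1]
    clear g1
    refine h.asg hb (by omega) (by simp) (by simpa [constEnv] using g3) fun h => ?_
    refine h.asg hb (by omega) (by simp) (by simp [constEnv]) fun h => ?_
    refine h.asg hb (by omega) (by simp) ?_ fun h => ?_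
    · have := h.known 21 (by omega)
      simp [constEnv] at this
      simp [this, constEnv]
    generalize hσ₂ : (Store.setReg _ 27 _ : Store) = σ₂ at h ⊢
    have hmem₂ : σ₂.mem = s'.mem := by rw [← hσ₂]; rfl
    rw [← hmem₂]
    clear hσ₂
    have e35 : ∀ s', SetupState X s w k n m
        [27, 24, 23, 35, 34, 33, 32, 31, 22, 25, 30, 21, 20] s' →
        s'.reg 35 = posE s w k n m := fun s' h => by
      have := h.known 35 (by omega)
      simpa [constEnv] using this
    refine Fast.seq hb.two_le hb.le_L (mid := (· = σ₂.setMem (posE s w k n m) 1))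
      (.put hb.two_le hb.le_L (h.le hb) (by simp) (by simp) (by simp [e35 _ h])) ?_
    rintro _ rfl
    refine Fast.seq hb.two_le hb.le_L (mid := fun s' =>
      SetupState X s w k n m [27, 24, 23, 35, 34, 33, 32, 31, 22, 25, 30, 21, 20] s' ∧
      (∀ a < posE s w k n m, s'.mem a = σ₂.mem a) ∧ PowersAt w (posE s w k n m) s'.mem ∧
      ∀ t, s'.mem (posE s w k n m + 3 * t + 1) = σ₂.mem (posE s w k n m + 3 * t + 1))
      (Fast.loop (N := (w + 1) * (2 * 2 ^ w)) hb.two_le hb.le_L (fun i s' =>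
        SetupState X s w k n m [27, 24, 23, 35, 34, 33, 32, 31, 22, 25, 30, 21, 20] s' ∧
        (∀ a < posE s w k n m, s'.mem a = σ₂.mem a) ∧
        (∀ t ≤ i, s'.mem (posE s w k n m + 3 * t) = 2 ^ t) ∧
        ∀ t, s'.mem (posE s w k n m + 3 * t + 1) = σ₂.mem (posE s w k n m + 3 * t + 1))
        ?_ (hb.const 27) (hb.small 27 (by omega) (by omega)) (by omega) ?_ ?_ ?_) ?_
    · have := h.known 27 (by omega)
      simpa [constEnv] using this
    · refine ⟨(h.setMem (by have := hb.two_le; omega)).setLocal (by omega) (by omega), ?_, ?_, ?_⟩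
      · intro a ha
        simp only [Store.setReg_mem, Store.setMem_mem]
        rw [Function.update_of_ne (by omega)]
      · intro t ht
        obtain rfl : t = 0 := by omega
        simp
      · intro t
        simp only [Store.setReg_mem, Store.setMem_mem]
        rw [Function.update_of_ne (by omega)]
    · rintro i hi s' hx hn' ⟨g1, g2, g3, g4⟩
      have hp : 2 ^ (i + 1) ≤ X := (Nat.pow_le_pow_right (by omega) (by omega)).trans hKX
      refine .put hb.two_le hb.le_L (g1.le hb) (by simp) (by simp [powE]) ?_
      simp only [powE, eval_mul, eval_var, eval_const, eval_add, eval_load, e35 _ g1, hx,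
        g3 i le_rfl, ← pow_succ]
      refine ⟨hx, hn', (g1.setMem hp).setLocal (by omega) ?_, ?_, ?_, ?_⟩
      · exact (show i + 1 ≤ (w + 1) * (2 * 2 ^ w) from hi).trans (hb.const 27)
      · intro a ha
        simp only [Store.setReg_mem, Store.setMem_mem]
        rw [Function.update_of_ne (by omega), g2 a ha]
      · intro t ht
        simp only [Store.setReg_mem, Store.setMem_mem]
        rcases Nat.lt_or_eq_of_le ht with ht | rfl
        · rw [Function.update_of_ne (by omega), g3 t (by omega)]
        · rw [Function.update_self]
      · intro t
        simp only [Store.setReg_mem, Store.setMem_mem]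
        rw [Function.update_of_ne (by omega), g4 t]
    · rintro s' - - h; exact h
    · clear h
      rintro s' ⟨h, g1, g2, g3⟩
      have hK := g2 _ le_rfl
      refine h.asg hb (by omega) (by simp [powE]) ?_ fun h => ?_
      · have := h.known 27 (by omega)
        simp [powE, e35 _ h, this, constEnv, hK, numColourings]
      refine h.asg hb (by omega) (by simp) ?_ fun h => ?_
      · have := h.known 32 (by omega)
        simp [constEnv] at this
        simp [this, constEnv]
      refine h.asg hb (by omega) (by simp) ?_ fun h => ?_
      · have := h.known 33 (by omega)
        simp [constEnv] at this
        simp [this, constEnv]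
      refine .skip hb.le_L ⟨fun x hx => ?_, h.locals, h.mem, g1, g2, g3⟩
      rw [h.known x hx]
      split
      · rfl
      -- Every index with a constant other than the default 0 has been assigned by now.
      · rename_i hD
        unfold constEnv
        split <;> simp_all

end Setup

/-! ### The search for an optimal path -/

open SExpr Stm

/-- The address of the transition that belongs to an edge. -/
def edgeAddrE (e : SExpr) : SExpr :=
  var 34 + e / (var 26 * var 26) * (var 22 + const 2)

def srcE (e : SExpr) : SExpr := load (edgeAddrE e) * var 26 + e / var 26 % var 26

def dstE (e : SExpr) : SExpr := load (edgeAddrE e + const 1) * var 26 + e % var 26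

/-- The address of the table entry for the node `v` after `i` steps. -/
def cellE (i v : SExpr) : SExpr := var 35 + const 3 * (i * var 36 + v) + const 1

/-- Variables 12 and 13 are the level and the edge. The offset 2 in the layer address skips the
source and target states stored in front of the layer of a transition. -/
def edgeOkE : SExpr :=
  bind 6 (const 3 + var 12 * var 22) <| bind 7 (edgeAddrE (var 13) + const 2) <|
  bind 8 (var 13 / var 26 % var 26) <| bind 9 (var 13 % var 26) compatibleE

def srcCellE : SExpr := cellE (var 12) (srcE (var 13))

def dstCellE : SExpr := cellE (var 12 + const 1) (dstE (var 13))

/-- Entries are shifted by one, with 0 for unreached nodes, so the shift is removed before combining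
and restored afterwards. -/
def candE (b : Bool) (wE : SExpr) : SExpr :=
  combineE b (load srcCellE - const 1) (bind 7 (edgeAddrE (var 13) + const 2) wE) + const 1

def relaxStm (b : Bool) (wE : SExpr) : Stm :=
  .ite (edgeOkE * lt (const 0) (load srcCellE) *
      (eq (load dstCellE) (const 0) + lt (candE b wE) (load dstCellE)))
    (.seq (.put (dstCellE + const 1) (var 13)) (.put dstCellE (candE b wE))) .skip

def initStm : Stm :=
  .put (cellE (const 0) (var 12))
    (load (var 31 + const 2 + var 12 / var 26) * colourInitialE (var 12 % var 26))

/-- Variable 16 follows the same convention as the table: 0 means that no accepting node has been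
reached yet. -/
def bestStm : Stm :=
  .ite (load (var 31 + const 2 + var 32 + var 12 / var 26) * colourFinalE (var 12 % var 26) *
      lt (const 0) (load (cellE (var 30) (var 12))) *
      (eq (var 16) (const 0) + lt (load (cellE (var 30) (var 12))) (var 16)))
    (.seq (.asg 16 (load (cellE (var 30) (var 12)))) (.asg 17 (var 12))) .skip

/-- The search for a best path: its weight plus one is left in `var 16`, its end in `var 17`. -/
def searchStm (b : Bool) (wE : SExpr) : Stm :=
  .seq setupStm <| .seq (.loop 12 36 initStm) <|
  .seq (.loop 12 30 (.loop 13 37 (relaxStm b wE))) <|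
  .seq (.asg 16 (const 0)) (.loop 12 36 bestStm)

/-- `wE` computes the weights of layers. -/
structure Computes {Sig : Type u} {s w : ℕ} (eS : Sig ≃ Fin s) (k n m : ℕ)
    (weight : Layer Sig w → ℕ) (wE : SExpr) : Prop where
  wf : wE.WF
  eval : ∀ {mem r A L}, Env s w k n m r → LayerAt eS mem A L → r 7 = A →
    wE.eval mem r = weight L
  le : ∀ L, weight L ≤ layerLen s w

/-- The entries of the tables in the memory. -/
def tableAt (E V d : ℕ) (mem : ℕ → ℕ) (i v : ℕ) : ℕ := mem (E + 3 * (i * V + v) + d)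

theorem index_inj {V i v i' v' : ℕ} (hv : v < V) (hv' : v' < V) :
    i * V + v = i' * V + v' ↔ i = i' ∧ v = v' := by
  constructor
  · intro h
    have h1 := congrArg (· / V) h
    have h2 := congrArg (· % V) h
    simp only [node_div hv, node_div hv', node_mod hv, node_mod hv'] at h1 h2
    exact ⟨h1, h2⟩
  · rintro ⟨rfl, rfl⟩; rfl

theorem tableAt_update {E V d i j x : ℕ} {mem : ℕ → ℕ} (hj : j < V) (i' v : ℕ) (hv : v < V) :
    tableAt E V d (Function.update mem (E + 3 * (i * V + j) + d) x) i' v =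
      if i' = i ∧ v = j then x else tableAt E V d mem i' v := by
  have := index_inj (i := i') (i' := i) hv hj
  simp only [tableAt, Function.update_apply]
  by_cases heq : i' = i ∧ v = j
  · rw [if_pos heq, if_pos (by rw [this.2 heq])]
  · rw [if_neg heq, if_neg (fun hc => heq (this.1 (by omega)))]

/-- The three interleaved tables lie in different residue classes modulo 3, so no bound on their
lengths is needed to keep them disjoint. -/
theorem tableAt_update_ne {E V d d' t x : ℕ} {mem : ℕ → ℕ} (hd : d % 3 ≠ d' % 3) :
    tableAt E V d (Function.update mem (E + 3 * t + d') x) = tableAt E V d mem := by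
  funext i v
  exact Function.update_of_ne (by omega) _ _

theorem truthBit_mul (P P' : Prop) : truthBit P * truthBit P' = truthBit (P ∧ P') := by
  by_cases h : P <;> by_cases h' : P' <;> simp [truthBit, h, h']

section Search

variable {Sig : Type u} {Q : Type v} {s w n : ℕ} {eS : Sig ≃ Fin s} {eQ : Q ≃ Fin n}
  {B : List (Layer Sig w)} {F : NFA (Layer Sig w) Q} {ts : List (Q × Layer Sig w × Q)}
  {weight : Layer Sig w → ℕ} {b : Bool} {wE : SExpr} {X L : ℕ} {σ : Store}

/-- The state during the search. -/
structure SearchState (X : ℕ) (eS : Sig ≃ Fin s) (eQ : Q ≃ Fin n) (B : List (Layer Sig w))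
    (F : NFA (Layer Sig w) Q) (ts : List (Q × Layer Sig w × Q)) (σ : Store) : Prop where
  env : Env s w B.length n ts.length σ.reg
  locals : ∀ x < 20, σ.reg x ≤ X
  mem : ∀ a, σ.mem a ≤ X
  input : InputFrom eS eQ B F ts 0 σ.mem
  powers : PowersAt w (posE s w B.length n ts.length) σ.mem

theorem SearchState.le (hb : Bounds X L s w B.length n ts.length)
    (h : SearchState X eS eQ B F ts σ) : σ.Le X L := by
  refine ⟨fun x => ?_, h.mem, fun x h1 h2 => ?_⟩
  · by_cases hx : x < 20
    · exact h.locals x hx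
    · rw [h.env x (by omega)]; exact hb.const x
  · rw [h.env x h1]; exact (Nat.le_succ _).trans (hb.small x h1 h2)

theorem SearchState.setReg (h : SearchState X eS eQ B F ts σ) {x v : ℕ} (hx : x < 20)
    (hv : v ≤ X) : SearchState X eS eQ B F ts (σ.setReg x v) := by
  refine ⟨h.env.update hx v, fun y hy => ?_, h.mem, h.input, h.powers⟩
  rw [Store.setReg_reg, Function.update_apply]
  split
  · exact hv
  · exact h.locals y hy

theorem SearchState.setCell (h : SearchState X eS eQ B F ts σ) {t d v : ℕ} (hd : d = 1 ∨ d = 2)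
    (hv : v ≤ X) : SearchState X eS eQ B F ts
      (σ.setMem (posE s w B.length n ts.length + 3 * t + d) v) := by
  refine ⟨h.env, h.locals, fun y => ?_, fun a h0 ha => ?_, fun y hy => ?_⟩
  · rw [Store.setMem_mem, Function.update_apply]
    split
    · exact hv
    · exact h.mem y
  · rw [Store.setMem_mem, Function.update_of_ne (by omega)]
    exact h.input a h0 ha
  · rw [Store.setMem_mem, Function.update_of_ne (by omega)]
    exact h.powers y hy

/-- The tables of the search. -/
abbrev SearchTable (eQ : Q ≃ Fin n) (B : List (Layer Sig w)) (F : NFA (Layer Sig w) Q)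
    (ts : List (Q × Layer Sig w × Q)) (weight : Layer Sig w → ℕ) (b : Bool) (s i j : ℕ)
    (mem : ℕ → ℕ) : Prop :=
  (oddGraph eQ B F ts weight b).Table ((oddGraph eQ B F ts weight b).Before i j)
    (tableAt (posE s w B.length n ts.length) (n * numColourings w) 1 mem)
    (tableAt (posE s w B.length n ts.length) (n * numColourings w) 2 mem)

theorem wf_cellE {i v : SExpr} (hi : i.WF) (hv : v.WF) : (cellE i v).WF := by
  simp [cellE, hi, hv]

theorem wf_edgeAddrE {e : SExpr} (he : e.WF) : (edgeAddrE e).WF := by simp [edgeAddrE, he]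

theorem wf_srcE {e : SExpr} (he : e.WF) : (srcE e).WF := by simp [srcE, wf_edgeAddrE he, he]

theorem wf_dstE {e : SExpr} (he : e.WF) : (dstE e).WF := by simp [dstE, wf_edgeAddrE he, he]

theorem wf_hitE : hitE.WF := by simp [hitE, powE]

theorem wf_nextE : nextE.WF := by simp [nextE, wf_hitE, powE]

theorem wf_compatibleE : compatibleE.WF := by
  simp [compatibleE, colourE, powE, pairNextE, wf_nextE]

theorem wf_srcCellE : srcCellE.WF := wf_cellE (by simp) (wf_srcE (by simp))

theorem wf_dstCellE : dstCellE.WF := wf_cellE (by simp) (wf_dstE (by simp))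

theorem wf_candE (b : Bool) {wE : SExpr} (h : wE.WF) : (candE b wE).WF := by
  simp only [candE, wf_add, wf_const, and_true]
  exact wf_combineE b (by simp [wf_srcCellE]) (by simp [h, edgeAddrE])

theorem eval_cellE (h : SearchState X eS eQ B F ts σ) (i v : SExpr) :
    (cellE i v).eval σ.mem σ.reg = posE s w B.length n ts.length +
      3 * (i.eval σ.mem σ.reg * (n * numColourings w) + v.eval σ.mem σ.reg) + 1 := by
  have e35 : σ.reg 35 = posE s w B.length n ts.length := h.env 35 (by omega)
  have e36 : σ.reg 36 = n * numColourings w := h.env 36 (by omega)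
  simp [cellE, e35, e36]

theorem eval_edgeAddrE {r mem : ℕ → ℕ} (h : Env s w B.length n ts.length r) (e : SExpr) :
    (edgeAddrE e).eval mem r = posT s w B.length n +
      e.eval mem r / (numColourings w * numColourings w) * (layerLen s w + 2) := by
  have e34 : r 34 = posT s w B.length n := h 34 (by omega)
  have e26 : r 26 = numColourings w := h 26 (by omega)
  have e22 : r 22 = layerLen s w := h 22 (by omega)
  simp [edgeAddrE, e34, e26, e22]

theorem edge_div_lt {m K e : ℕ} (he : e < m * (K * K)) : e / (K * K) < m :=
  Nat.div_lt_of_lt_mul (by rwa [mul_comm])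

theorem eval_srcE {r mem : ℕ → ℕ} {A : ℕ} (h : Env s w B.length n ts.length r)
    (hI : InputFrom eS eQ B F ts A mem) (hA : A ≤ posF s w B.length) {e : SExpr}
    (he : e.eval mem r < ts.length * (numColourings w * numColourings w)) :
    (srcE e).eval mem r = (oddGraph eQ B F ts weight b).src (e.eval mem r) := by
  have e26 : r 26 = numColourings w := h 26 (by omega)
  simp only [srcE, eval_add, eval_mul, eval_load, eval_edgeAddrE h, eval_mod, eval_div, eval_var,
    e26, hI.src hA (edge_div_lt he)]
  rfl

theorem eval_dstE {r mem : ℕ → ℕ} {A : ℕ} (h : Env s w B.length n ts.length r)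
    (hI : InputFrom eS eQ B F ts A mem) (hA : A ≤ posF s w B.length) {e : SExpr}
    (he : e.eval mem r < ts.length * (numColourings w * numColourings w)) :
    (dstE e).eval mem r = (oddGraph eQ B F ts weight b).dst (e.eval mem r) := by
  have e26 : r 26 = numColourings w := h 26 (by omega)
  simp only [dstE, eval_add, eval_mul, eval_load, eval_edgeAddrE h, eval_mod, eval_var, eval_const,
    e26, hI.dst hA (edge_div_lt he)]
  rfl

theorem InputFrom.edgeLayerAt {mem : ℕ → ℕ} {A : ℕ} (h : InputFrom eS eQ B F ts A mem)
    (hA : A ≤ posF s w B.length) {j : ℕ} (hj : j < ts.length) :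
    LayerAt eS mem (posT s w B.length n + j * (layerLen s w + 2) + 2) (transLayer ts j) :=
  layerAt_of_encodeLayer fun _ hz => h.edgeLayer hA hj hz

theorem eval_edgeOkE (hw : 0 < w) (h : SearchState X eS eQ B F ts σ) {i e : ℕ}
    (hi : i < B.length) (he : e < ts.length * (numColourings w * numColourings w))
    (h12 : σ.reg 12 = i) (h13 : σ.reg 13 = e) :
    edgeOkE.eval σ.mem σ.reg = truthBit ((oddGraph eQ B F ts weight b).val i e) := by
  have e26 : σ.reg 26 = numColourings w := h.env 26 (by omega)
  have e22 : σ.reg 22 = layerLen s w := h.env 22 (by omega)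
  have hE6 := h.env.update (x := 6) (by omega) (3 + i * layerLen s w)
  simp only [edgeOkE, eval_bind, eval_edgeAddrE hE6, eval_add, eval_mul, eval_var, eval_const,
    eval_div, eval_mod, e22, h12, h13, e26, Function.update_of_ne, ne_eq, Nat.reduceEqDiff,
    not_false_eq_true]
  rw [eval_compatibleE hw (((hE6.update (by omega) _).update (by omega) _).update (by omega) _)
    h.powers (h.input.layer hi) (h.input.edgeLayerAt (Nat.zero_le _) (edge_div_lt he)) (by simp)
    (by simp)]
  simp [oddGraph]

theorem eval_srcCellE (h : SearchState X eS eQ B F ts σ) {i e : ℕ}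
    (he : e < ts.length * (numColourings w * numColourings w))
    (h12 : σ.reg 12 = i) (h13 : σ.reg 13 = e) :
    σ.mem (srcCellE.eval σ.mem σ.reg) = tableAt (posE s w B.length n ts.length)
      (n * numColourings w) 1 σ.mem i ((oddGraph eQ B F ts weight b).src e) := by
  rw [srcCellE, eval_cellE h, eval_srcE (weight := weight) (b := b) h.env h.input (Nat.zero_le _)
    (by simpa [h13] using he), eval_var, eval_var, h12, h13]
  rfl

theorem eval_dstCellE (h : SearchState X eS eQ B F ts σ) {i e : ℕ}
    (he : e < ts.length * (numColourings w * numColourings w))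
    (h12 : σ.reg 12 = i) (h13 : σ.reg 13 = e) :
    dstCellE.eval σ.mem σ.reg = posE s w B.length n ts.length +
      3 * ((i + 1) * (n * numColourings w) + (oddGraph eQ B F ts weight b).dst e) + 1 := by
  rw [dstCellE, eval_cellE h, eval_dstE (weight := weight) (b := b) h.env h.input (Nat.zero_le _)
    (by simpa [h13] using he), eval_add, eval_var, eval_var, h12, h13, eval_const]

theorem eval_candE (hC : Computes eS B.length n ts.length weight wE)
    (h : SearchState X eS eQ B F ts σ) {i e : ℕ}
    (he : e < ts.length * (numColourings w * numColourings w))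
    (h12 : σ.reg 12 = i) (h13 : σ.reg 13 = e) :
    (candE b wE).eval σ.mem σ.reg =
      combine (oddGraph eQ B F ts weight b).useMax (tableAt (posE s w B.length n ts.length)
      (n * numColourings w) 1 σ.mem i ((oddGraph eQ B F ts weight b).src e) - 1)
      ((oddGraph eQ B F ts weight b).wt e) + 1 := by
  rw [candE, eval_add, eval_combineE, eval_sub, eval_load,
    eval_srcCellE (weight := weight) (b := b) h he h12 h13, eval_bind,
    hC.eval (h.env.update (by omega) _) (h.input.edgeLayerAt (Nat.zero_le _) (edge_div_lt he))
    (by simp [eval_edgeAddrE h.env, h13])]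
  rfl

theorem fast_relaxStm (hw : 0 < w) (hb : Bounds X L s w B.length n ts.length)
    (hC : Computes eS B.length n ts.length weight wE) (h : SearchState X eS eQ B F ts σ) {i e : ℕ}
    (hi : i < B.length) (he : e < ts.length * (numColourings w * numColourings w))
    (h12 : σ.reg 12 = i) (h13 : σ.reg 13 = e)
    (hT : SearchTable eQ B F ts weight b s i e σ.mem) :
    Fast X L (relaxStm b wE) σ fun σ' => SearchState X eS eQ B F ts σ' ∧ σ'.reg = σ.reg ∧
      SearchTable eQ B F ts weight b s i (e + 1) σ'.mem := by
  set G := oddGraph eQ B F ts weight b with hG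
  set E := posE s w B.length n ts.length with hE
  set V := n * numColourings w with hV
  have hs := eval_srcCellE (weight := weight) (b := b) h he h12 h13
  have hd := eval_dstCellE (weight := weight) (b := b) h he h12 h13
  have hc := eval_candE (b := b) hC h he h12 h13
  have hok := eval_edgeOkE (weight := weight) (b := b) hw h hi he h12 h13
  rw [← hG] at hs hd hc hok
  rw [← hE] at hs hd hc
  rw [← hV] at hs hd hc
  set cand := combine G.useMax (tableAt E V 1 σ.mem i (G.src e) - 1) (G.wt e) + 1 with hcand
  have hdst : σ.mem (dstCellE.eval σ.mem σ.reg) = tableAt E V 1 σ.mem (i + 1) (G.dst e) := by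
    rw [hd]; rfl
  have hE37 : ts.length * (numColourings w * numColourings w) ≤ X := hb.const 37
  have hsrcV : G.src e < V := G.src_lt e he
  have hdstV : G.dst e < V := G.dst_lt e he
  -- A path of i + 1 ≤ k layers weighs at most k times the length of a layer code, which is where
  -- the field `weight` of `Bounds` is used.
  have hcandX : cand ≤ X := by
    have h1 : tableAt E V 1 σ.mem i (G.src e) ≤ i * layerLen s w + 1 :=
      hT.le (wmax := layerLen s w) (fun i' e' hB => by
        rcases hB with h1 | h1
        · exact h1.2
        · exact h1.2.trans he)
      (fun e' _ => hC.le _) i (G.src e) hsrcV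
    have h2 := combine_le_add G.useMax (tableAt E V 1 σ.mem i (G.src e) - 1) (G.wt e)
    have h3 : G.wt e ≤ layerLen s w := hC.le _
    have h4 := Nat.mul_le_mul_right (layerLen s w) (show i + 1 ≤ B.length from hi)
    have h5 := hb.weight
    rw [Nat.add_mul] at h4
    omega
  refine .ite hb.two_le hb.le_L (h.le hb) ?_ ?_ ?_
  · simp [edgeOkE, wf_edgeAddrE, wf_compatibleE, wf_srcCellE, wf_dstCellE, wf_candE, hC.wf]
  · intro hne
    simp only [eval_mul, hok, eval_lt, eval_const, eval_load, hs, eval_add, eval_eq, hdst, hc,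
      ne_eq, Nat.mul_eq_zero, not_or, truthBit_eq_zero, not_not, Nat.add_eq_zero_iff,
      not_and_or] at hne
    obtain ⟨⟨h1, h2⟩, h3⟩ := hne
    have hSS : SearchState X eS eQ B F ts (σ.setMem (dstCellE.eval σ.mem σ.reg + 1) e) := by
      rw [hd]
      exact h.setCell (d := 2) (.inr rfl) (he.le.trans hE37)
    refine Fast.seq hb.two_le hb.le_L
      (mid := (· = σ.setMem (dstCellE.eval σ.mem σ.reg + 1) e))
      (.put hb.two_le hb.le_L (h.le hb) (by simp [wf_dstCellE]) (by simp)
        (by simp only [eval_add, eval_const, eval_var, h13])) ?_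
    rintro _ rfl
    have hd' := eval_dstCellE (weight := weight) (b := b) hSS he h12 h13
    have hc' := eval_candE (b := b) hC hSS he h12 h13
    rw [← hG, ← hE, ← hV] at hd' hc'
    have hsame : tableAt E V 1 (σ.setMem (dstCellE.eval σ.mem σ.reg + 1) e).mem =
        tableAt E V 1 σ.mem := by
      rw [hd]; exact tableAt_update_ne (d' := 2) (by omega)
    rw [hsame, ← hcand] at hc'
    refine .put hb.two_le hb.le_L (hSS.le hb) wf_dstCellE (wf_candE b hC.wf) ?_
    rw [hd', hc']
    refine ⟨hSS.setCell (d := 1) (.inl rfl) hcandX, rfl, ?_⟩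
    refine hT.relax (i := i) (e := e) h1 h2.ne' he h3 ?_ ?_
    · intro i' v hv
      refine (tableAt_update hdstV i' v hv).trans ?_
      rw [hsame]
    · intro i' v hv
      rw [Store.setMem_mem, Store.setMem_mem, hd]
      exact (congrFun (congrFun (tableAt_update_ne (d' := 1) (by omega)) i') v).trans
        (tableAt_update (d := 2) hdstV i' v hv)
  · intro hz
    refine .skip hb.le_L ⟨h, rfl, hT.skip fun hv hne => ?_⟩
    simp only [eval_mul, hok, eval_lt, eval_const, eval_load, hs, eval_add, eval_eq, hdst, hc,
      Nat.mul_eq_zero, truthBit_eq_zero, Nat.add_eq_zero_iff] at hz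
    rcases hz with (hz | hz) | hz
    · exact absurd hv hz
    · exact absurd (Nat.pos_of_ne_zero hne) hz
    · exact ⟨hz.1, Nat.not_lt.1 hz.2⟩

theorem fast_initStm (hb : Bounds X L s w B.length n ts.length)
    (h : SearchState X eS eQ B F ts σ) {v : ℕ} (hv : v < n * numColourings w)
    (h12 : σ.reg 12 = v) :
    Fast X L initStm σ fun σ' => σ' = σ.setMem (posE s w B.length n ts.length +
      3 * (0 * (n * numColourings w) + v) + 1)
      (truthBit ((oddGraph eQ B F ts weight b).start v)) := by
  have e31 : σ.reg 31 = posF s w B.length := h.env 31 (by omega)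
  have e26 : σ.reg 26 = numColourings w := h.env 26 (by omega)
  refine .put hb.two_le hb.le_L (h.le hb) (by simp [cellE])
    (by simp [colourInitialE, colourE, powE])
    ?_
  rw [eval_cellE h, eval_mul, eval_colourInitialE h.env h.powers]
  simp only [eval_const, eval_load, eval_add, eval_var, eval_div, eval_mod, e31, e26, h12]
  rw [h.input.start (Nat.zero_le _) (Nat.div_lt_of_lt_mul (by rwa [mul_comm]))]
  rw [truthBit_mul]
  rfl

theorem fast_init (hb : Bounds X L s w B.length n ts.length)
    (h : SearchState X eS eQ B F ts σ)
    (h0 : ∀ t, σ.mem (posE s w B.length n ts.length + 3 * t + 1) = 0) :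
    Runs X (.loop 12 36 initStm) ((n * numColourings w + 1) * L ^ (initStm.time + 1)) σ fun σ' =>
      SearchState X eS eQ B F ts σ' ∧ SearchTable eQ B F ts weight b s 0 0 σ'.mem := by
  set E := posE s w B.length n ts.length with hE
  set V := n * numColourings w with hV
  have hVX : V ≤ X := hb.const 36
  refine (Runs.loop (N := V) hb.two_le (fun v σ' => SearchState X eS eQ B F ts σ' ∧
    (∀ v' < v, σ'.mem (E + 3 * (0 * V + v') + 1) =
      truthBit ((oddGraph eQ B F ts weight b).start v')) ∧
    (∀ t, v ≤ t → σ'.mem (E + 3 * t + 1) = 0))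
    (h.env 36 (by omega)) hVX (by omega) ?_ ?_ ?_).weaken (Fast.loop_time_le hb.le_L _ _)
    fun _ h => h
  · exact ⟨h.setReg (by omega) (by omega), fun v' hv' => by omega, fun t _ => h0 t⟩
  · rintro v hv σ' hx hn ⟨h1, h2, h3⟩
    refine Runs.weaken (fast_initStm (weight := weight) (b := b) hb h1 hv hx) le_rfl ?_
    rintro _ rfl
    rw [← hE, ← hV]
    refine ⟨hx, hn, (h1.setCell (.inl rfl) ((truthBit_le _).trans
      (by have := hb.two_le; omega))).setReg (by omega) (by omega), ?_, ?_⟩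
    · intro v' hv'
      simp only [Store.setReg_mem, Store.setMem_mem]
      rcases Nat.lt_succ_iff_lt_or_eq.1 hv' with h4 | rfl
      · rw [Function.update_of_ne (by omega), h2 v' h4]
      · rw [Function.update_self]
    · intro t ht
      simp only [Store.setReg_mem, Store.setMem_mem]
      rw [Function.update_of_ne (by omega), h3 t (by omega)]
  · rintro σ' - - ⟨h1, h2, h3⟩
    refine ⟨h1, ⟨h2, ?_, ?_⟩⟩
    · rintro i e (hB | hB) <;> omega
    · intro i v hv hne
      -- All later rows consist of untouched cells, which are 0: nothing is reached and no back
      -- pointer has to be justified.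
      exact absurd (h3 ((i + 1) * V + v) (by rw [Nat.succ_mul]; omega)) hne

theorem fast_levels (hw : 0 < w) (hb : Bounds X L s w B.length n ts.length)
    (hC : Computes eS B.length n ts.length weight wE) (h : SearchState X eS eQ B F ts σ)
    (hT : SearchTable eQ B F ts weight b s 0 0 σ.mem) :
    Runs X (.loop 12 30 (.loop 13 37 (relaxStm b wE)))
      (B.length * ((ts.length * (numColourings w * numColourings w) + 1) *
        L ^ ((relaxStm b wE).time + 1) + 8) + 8) σ fun σ' =>
      SearchState X eS eQ B F ts σ' ∧ SearchTable eQ B F ts weight b s B.length 0 σ'.mem := by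
  have hkX : B.length ≤ X := hb.const 30
  have hEX : ts.length * (numColourings w * numColourings w) ≤ X := hb.const 37
  refine Runs.loop (N := B.length) hb.two_le (fun i σ' => SearchState X eS eQ B F ts σ' ∧
    SearchTable eQ B F ts weight b s i 0 σ'.mem) (h.env 30 (by omega)) hkX (by omega)
    ⟨h.setReg (by omega) (by omega), hT⟩ ?_ fun _ _ _ h => h
  rintro i hi σ' hx hn ⟨h1, h2⟩
  refine (Runs.loop (N := ts.length * (numColourings w * numColourings w)) hb.two_le
    (fun e σ'' => SearchState X eS eQ B F ts σ'' ∧ σ''.reg 12 = i ∧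
    SearchTable eQ B F ts weight b s i e σ''.mem) (h1.env 37 (by omega)) hEX (by omega)
    ⟨h1.setReg (by omega) (by omega), by simpa using hx, h2⟩ ?_ ?_).weaken
    (Fast.loop_time_le hb.le_L _ _) fun _ h => h
  · rintro e he σ'' hxe hne ⟨h3, h4, h5⟩
    refine Runs.weaken (fast_relaxStm hw hb hC h3 hi he h4 hxe h5) le_rfl ?_
    rintro τ ⟨h6, h7, h8⟩
    rw [h7]
    exact ⟨hxe, hne, h6.setReg (by omega) (by omega), by simpa [h7] using h4, h8⟩
  · rintro τ - - ⟨h3, h4, h5⟩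
    refine ⟨h4, h3.env 30 (by omega), h3.setReg (by omega) (by omega), ?_⟩
    -- A completed row is the same as the next row before its first edge.
    have := (oddGraph eQ B F ts weight b).before_succ i
    rw [SearchTable, ← this]
    exact h5

/-- The value `best` is one plus the weight of a best path that ends in an accepting node, and `v`
is its end. -/
structure Best (eQ : Q ≃ Fin n) (F : NFA (Layer Sig w) Q) (dp : ℕ → ℕ) (bound best v : ℕ) :
    Prop where
  spec : best ≠ 0 → v < bound ∧ AcceptNode eQ F v ∧ dp v = best
  le : ∀ v' < bound, AcceptNode eQ F v' → dp v' ≠ 0 → best ≠ 0 ∧ best ≤ dp v'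

theorem fast_best (hb : Bounds X L s w B.length n ts.length)
    (h : SearchState X eS eQ B F ts σ) (h16 : σ.reg 16 = 0) :
    Runs X (.loop 12 36 bestStm) ((n * numColourings w + 1) * L ^ (bestStm.time + 1)) σ fun σ' =>
      SearchState X eS eQ B F ts σ' ∧ σ'.mem = σ.mem ∧
      Best eQ F (tableAt (posE s w B.length n ts.length) (n * numColourings w) 1 σ.mem B.length)
        (n * numColourings w) (σ'.reg 16) (σ'.reg 17) := by
  set E := posE s w B.length n ts.length with hE
  set V := n * numColourings w with hV
  have hVX : V ≤ X := hb.const 36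
  set dp := tableAt E V 1 σ.mem B.length with hdp
  refine (Runs.loop (N := V) hb.two_le (fun v σ' => SearchState X eS eQ B F ts σ' ∧
    σ'.mem = σ.mem ∧ Best eQ F dp v (σ'.reg 16) (σ'.reg 17))
    (h.env 36 (by omega)) hVX (by omega) ?_ ?_ ?_).weaken (Fast.loop_time_le hb.le_L _ _)
    fun _ h => h
  · refine ⟨h.setReg (by omega) (by omega), rfl, ⟨fun h0 => absurd (by simpa using h16) h0, ?_⟩⟩
    intro v' hv'; omega
  · rintro v hv σ' hx hn ⟨h1, h2, h3⟩
    have e31 : σ'.reg 31 = posF s w B.length := h1.env 31 (by omega)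
    have e26 : σ'.reg 26 = numColourings w := h1.env 26 (by omega)
    have e32 : σ'.reg 32 = n := h1.env 32 (by omega)
    have e30 : σ'.reg 30 = B.length := h1.env 30 (by omega)
    have hcell : (load (cellE (var 30) (var 12))).eval σ'.mem σ'.reg = dp v := by
      rw [eval_load, eval_cellE h1, eval_var, eval_var, e30, hx, h2]
      rfl
    have hacc : (load (var 31 + const 2 + var 32 + var 12 / var 26) *
        colourFinalE (var 12 % var 26)).eval σ'.mem σ'.reg = truthBit (AcceptNode eQ F v) := by
      rw [eval_mul, eval_colourFinalE h1.env h1.powers (by simp)]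
      simp only [eval_load, eval_add, eval_var, eval_div, eval_mod, eval_const, e31, e26, e32, hx]
      rw [h1.input.accept (Nat.zero_le _) (Nat.div_lt_of_lt_mul (by rwa [mul_comm]))]
      exact truthBit_mul _ _
    have hcond : (load (var 31 + const 2 + var 32 + var 12 / var 26) *
        colourFinalE (var 12 % var 26) * lt (const 0) (load (cellE (var 30) (var 12))) *
        (eq (var 16) (const 0) + lt (load (cellE (var 30) (var 12))) (var 16))).eval σ'.mem σ'.reg
        ≠ 0 ↔ (AcceptNode eQ F v ∧ 0 < dp v) ∧ (σ'.reg 16 = 0 ∨ dp v < σ'.reg 16) := by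
      rw [eval_mul, eval_mul, hacc, eval_lt, eval_add, eval_eq, eval_lt, hcell]
      simp only [eval_const, eval_var, ne_eq, Nat.mul_eq_zero, not_or, truthBit_eq_zero, not_not,
        Nat.add_eq_zero_iff, not_and_or]
    have hdpX : dp v ≤ X := h.mem _
    refine Fast.ite hb.two_le hb.le_L (h1.le hb) ?_ ?_ ?_
    · simp [colourFinalE, colourE, powE, cellE]
    · intro hc
      obtain ⟨⟨h4, h5⟩, h6⟩ := hcond.1 hc
      refine Fast.seq hb.two_le hb.le_L (mid := (· = σ'.setReg 16 (dp v)))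
        (.asg hb.two_le hb.le_L (h1.le hb) (by simp [cellE]) (by rw [hcell])) ?_
      rintro _ rfl
      have h7 := h1.setReg (x := 16) (by omega) hdpX
      refine .asg hb.two_le hb.le_L (h7.le hb) (by simp) ?_
      simp only [eval_var, Store.setReg_reg, Store.setReg_mem, Function.update_self,
        Function.update_of_ne, ne_eq, Nat.reduceEqDiff, not_false_eq_true, hx]
      refine ⟨trivial, hn, (h7.setReg (by omega) (by omega)).setReg (by omega) (by omega), h2, ?_⟩
      refine ⟨fun _ => ⟨by omega, h4, rfl⟩, fun v' hv' ha hne => ⟨by omega, ?_⟩⟩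
      rcases Nat.lt_succ_iff_lt_or_eq.1 hv' with h8 | rfl
      · obtain ⟨h9, h10⟩ := h3.le v' h8 ha hne
        omega
      · exact le_rfl
    · intro hc
      have hnc := fun h => (hcond.2 h) hc
      refine .skip hb.le_L ⟨hx, hn, h1.setReg (by omega) (by omega), h2, ?_⟩
      simp only [Store.setReg_reg, Function.update_of_ne, ne_eq, Nat.reduceEqDiff,
        not_false_eq_true]
      refine ⟨fun h0 => ?_, fun v' hv' ha hne => ?_⟩
      · obtain ⟨g1, g2⟩ := h3.spec h0
        exact ⟨by omega, g2⟩
      · rcases Nat.lt_succ_iff_lt_or_eq.1 hv' with h8 | rfl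
        · exact h3.le v' h8 ha hne
        · have : ¬(σ'.reg 16 = 0 ∨ dp v' < σ'.reg 16) := fun h => hnc ⟨⟨ha, by omega⟩, h⟩
          omega
  · rintro σ' - - h; exact h

/-- The state after the search. -/
structure Searched (X : ℕ) (eS : Sig ≃ Fin s) (eQ : Q ≃ Fin n) (B : List (Layer Sig w))
    (F : NFA (Layer Sig w) Q) (ts : List (Q × Layer Sig w × Q)) (weight : Layer Sig w → ℕ)
    (b : Bool) (σ : Store) : Prop where
  state : SearchState X eS eQ B F ts σ
  table : SearchTable eQ B F ts weight b s B.length 0 σ.mem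
  best : Best eQ F (tableAt (posE s w B.length n ts.length) (n * numColourings w) 1 σ.mem B.length)
    (n * numColourings w) (σ.reg 16) (σ.reg 17)

/-- A bound for the running time of the search. -/
def searchTime (b : Bool) (wE : SExpr) (L k V E : ℕ) : ℕ :=
  L ^ setupStm.time + ((V + 1) * L ^ (initStm.time + 1) +
    ((k * ((E + 1) * L ^ ((relaxStm b wE).time + 1) + 8) + 8) +
    (L ^ (Stm.asg 16 (const 0)).time + (V + 1) * L ^ (bestStm.time + 1))))

theorem runs_searchStm (hw : 0 < w) (hb : Bounds X L s w B.length n ts.length)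
    (hC : Computes eS B.length n ts.length weight wE)
    (hreg : ∀ x, σ.reg x = 0) (hX : ∀ a, σ.mem a ≤ X)
    (hmem : ∀ a, σ.mem a = (encodeInput eS eQ B F ts).getD a 0) :
    Runs X (searchStm b wE) (searchTime b wE L B.length (n * numColourings w)
      (ts.length * (numColourings w * numColourings w))) σ
      (Searched X eS eQ B F ts weight b) := by
  refine Runs.seq hb.two_le (mid := SetupDone X s w B.length n ts.length σ.mem)
    (fast_setupStm hb ⟨fun x _ => by simp [hreg x], fun x _ => by simp [hreg x], hX⟩ ?_ ?_ ?_ ?_ ?_)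
    ?_
  · rw [hmem]; simp [encodeInput]
  · rw [hmem]; simp [encodeInput]
  · rw [hmem]; simp [encodeInput, encodeODD]
  · rw [hmem]; exact (encodeInput_fa eS eQ B F ts 0).trans (encodeFA_zero eS eQ F ts)
  · rw [hmem]; exact (encodeInput_fa eS eQ B F ts 1).trans (encodeFA_one eS eQ F ts)
  · intro σ₁ h₁
    have hs : SearchState X eS eQ B F ts σ₁ := ⟨h₁.env, h₁.locals, h₁.le,
      fun a _ ha => by rw [h₁.input a ha, hmem], h₁.powers⟩
    refine Runs.seq hb.two_le (fast_init (weight := weight) (b := b) hb hs fun t => ?_) ?_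
    -- The cells for the weights lie behind the input and were not touched by the setup, so they are
    -- still 0.
    · rw [h₁.rest, hmem, List.getD_eq_default]
      rw [length_encodeInput]; omega
    · rintro σ₂ ⟨h₂, h₃⟩
      refine Runs.seq hb.two_le (fast_levels hw hb hC h₂ h₃) ?_
      rintro σ₃ ⟨h₄, h₅⟩
      refine Runs.seq hb.two_le (mid := (· = σ₃.setReg 16 0))
        (Fast.asg hb.two_le hb.le_L (h₄.le hb) (by simp) rfl) ?_
      rintro _ rfl
      refine (fast_best hb (h₄.setReg (by omega) (Nat.zero_le _)) (by simp)).weaken le_rfl ?_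
      rintro σ₅ ⟨h₆, h₇, h₈⟩
      rw [Store.setReg_mem] at h₇ h₈
      exact ⟨h₆, by rw [h₇]; exact h₅, by rw [h₇]; exact h₈⟩

end Search

/-! ### Reconstruction of the optimal ODD -/

open SExpr Stm

/-- The last edge of the path to the node `var 17`, according to the back pointers. -/
def edgeBackE : SExpr := load (cellE (var 30 - var 12) (var 17) + const 1)

/-- In round t of the outer loop, layer number k - 1 - t is copied; the layers come out from last to
first, as the back pointers deliver them. -/
def copyStm : Stm :=
  .put (const 3 + (var 30 - const 1 - var 12) * var 22 + var 10)
    (load (edgeAddrE edgeBackE + const 2 + var 10))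

/-- The construction of the ODD found; it overwrites the ODD in the input. -/
def reconStm : Stm :=
  .seq (.loop 12 30 (.seq (.loop 10 22 copyStm) (.asg 17 (srcE edgeBackE)))) (.asg 0 (const 2))

section Reconstruction

variable {Sig : Type u} {Q : Type v} {s w n : ℕ} {eS : Sig ≃ Fin s} {eQ : Q ≃ Fin n}
  {B : List (Layer Sig w)} {F : NFA (Layer Sig w) Q} {ts : List (Q × Layer Sig w × Q)}
  {weight : Layer Sig w → ℕ} {b : Bool} {wE : SExpr} {X L : ℕ} {σ : Store} {mem₀ : ℕ → ℕ}

/-- The state during the reconstruction. -/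
structure ReconState (X s w k n m : ℕ) (mem₀ : ℕ → ℕ) (σ : Store) : Prop where
  env : Env s w k n m σ.reg
  locals : ∀ x < 20, σ.reg x ≤ X
  mem : ∀ a, σ.mem a ≤ X
  high : ∀ a, posF s w k ≤ a → σ.mem a = mem₀ a
  length : σ.mem 2 = k

theorem ReconState.le {k m : ℕ} (hb : Bounds X L s w k n m)
    (h : ReconState X s w k n m mem₀ σ) : σ.Le X L := by
  refine ⟨fun x => ?_, h.mem, fun x h1 h2 => ?_⟩
  · by_cases hx : x < 20
    · exact h.locals x hx
    · rw [h.env x (by omega)]; exact hb.const x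
  · rw [h.env x h1]; exact (Nat.le_succ _).trans (hb.small x h1 h2)

theorem ReconState.setReg {k m : ℕ} (h : ReconState X s w k n m mem₀ σ) {x v : ℕ} (hx : x < 20)
    (hv : v ≤ X) : ReconState X s w k n m mem₀ (σ.setReg x v) := by
  refine ⟨h.env.update hx v, fun y hy => ?_, h.mem, h.high, h.length⟩
  rw [Store.setReg_reg, Function.update_apply]
  split
  · exact hv
  · exact h.locals y hy

theorem ReconState.setMem {k m : ℕ} (h : ReconState X s w k n m mem₀ σ) {a v : ℕ} (ha : 3 ≤ a)
    (ha' : a < posF s w k) (hv : v ≤ X) : ReconState X s w k n m mem₀ (σ.setMem a v) := by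
  refine ⟨h.env, h.locals, fun y => ?_, fun y hy => ?_, ?_⟩
  · rw [Store.setMem_mem, Function.update_apply]
    split
    · exact hv
    · exact h.mem y
  · rw [Store.setMem_mem, Function.update_of_ne (by omega)]; exact h.high y hy
  · rw [Store.setMem_mem, Function.update_of_ne (by omega)]; exact h.length

theorem posF_le_posE (s w k n m : ℕ) : posF s w k ≤ posE s w k n m := by
  unfold posE posT; omega

/-- Only cells below the automaton are overwritten, so the back pointers are still those of the
memory `mem₀` left by the search. -/
theorem eval_edgeBackE {k m : ℕ} (h : ReconState X s w k n m mem₀ σ) {i v t : ℕ}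
    (ht : k - t = i + 1) (h12 : σ.reg 12 = t) (h17 : σ.reg 17 = v) :
    edgeBackE.eval σ.mem σ.reg =
      tableAt (posE s w k n m) (n * numColourings w) 2 mem₀ (i + 1) v := by
  have e35 : σ.reg 35 = posE s w k n m := h.env 35 (by omega)
  have e36 : σ.reg 36 = n * numColourings w := h.env 36 (by omega)
  have e30 : σ.reg 30 = k := h.env 30 (by omega)
  have := posF_le_posE s w k n m
  simp only [edgeBackE, cellE, eval_load, eval_add, eval_mul, eval_sub, eval_var, eval_const, e35,
    e36, e30, h12, h17, ht, tableAt]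
  exact h.high _ (by omega)

theorem wf_edgeBackE : edgeBackE.WF := by simp [edgeBackE, cellE]

theorem edgeLayers_getD (ts : List (Q × Layer Sig w × Q)) (es : List ℕ) {i : ℕ}
    (hi : i < es.length) : (edgeLayers ts es).getD i default =
      transLayer ts (es[i] / (numColourings w * numColourings w)) := by
  simp [edgeLayers, List.getD, List.getElem?_eq_getElem hi]

/-- The layers of `D` from number `i` on stand in the memory. -/
def LayersFrom (eS : Sig ≃ Fin s) (D : List (Layer Sig w)) (i : ℕ) (mem : ℕ → ℕ) : Prop :=
  ∀ j, i ≤ j → j < D.length → ∀ z < layerLen s w,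
    mem (3 + j * layerLen s w + z) = (encodeLayer eS (D.getD j default)).getD z 0

/-- Copying proceeds downwards, so the layers from i + 1 on, which are already in place, lie above
every cell written now. -/
theorem fast_copy (hb : Bounds X L s w B.length n ts.length)
    (h : ReconState X s w B.length n ts.length mem₀ σ) (hI : InputFrom eS eQ B F ts 0 mem₀)
    {D : List (Layer Sig w)} {i v t e : ℕ}
    (ht : B.length - t = i + 1) (h12 : σ.reg 12 = t) (h17 : σ.reg 17 = v)
    (he : tableAt (posE s w B.length n ts.length) (n * numColourings w) 2 mem₀ (i + 1) v = e)
    (heE : e < ts.length * (numColourings w * numColourings w))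
    (hDi : D.getD i default = transLayer ts (e / (numColourings w * numColourings w)))
    (hl : LayersFrom eS D (i + 1) σ.mem) :
    Fast X L (.loop 10 22 copyStm) σ fun σ' => ReconState X s w B.length n ts.length mem₀ σ' ∧
      σ'.reg 12 = t ∧ σ'.reg 17 = v ∧ LayersFrom eS D i σ'.mem := by
  have hLX : layerLen s w ≤ X := hb.const 22
  refine Fast.loop (N := layerLen s w) hb.two_le hb.le_L (fun z σ' =>
    ReconState X s w B.length n ts.length mem₀ σ' ∧ σ'.reg 12 = t ∧ σ'.reg 17 = v ∧
    LayersFrom eS D (i + 1) σ'.mem ∧ ∀ z' < z, σ'.mem (3 + i * layerLen s w + z') =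
      (encodeLayer eS (D.getD i default)).getD z' 0) (h.env 22 (by omega)) hLX
    (hb.small 22 (by omega) (by omega)) (by omega) ?_ ?_ ?_
  · refine ⟨h.setReg (by omega) (by omega), by simpa using h12, by simpa using h17, hl, ?_⟩
    intro z' hz'; omega
  · rintro z hz σ' hx hn ⟨h1, h2, h3, h4, h5⟩
    have e22 : σ'.reg 22 = layerLen s w := h1.env 22 (by omega)
    have e30 : σ'.reg 30 = B.length := h1.env 30 (by omega)
    have hback := eval_edgeBackE h1 ht h2 h3
    rw [he] at hback
    have hj := edge_div_lt heE
    have hval : (load (edgeAddrE edgeBackE + const 2 + var 10)).eval σ'.mem σ'.reg =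
        (encodeLayer eS (D.getD i default)).getD z 0 := by
      rw [eval_load, eval_add, eval_add, eval_edgeAddrE h1.env, hback, eval_var, eval_const, hx,
        h1.high _ (by unfold posT; omega), hI.edgeLayer (Nat.zero_le _) hj hz, hDi]
    have haddr : (const 3 + (var 30 - const 1 - var 12) * var 22 + var 10).eval σ'.mem σ'.reg =
        3 + i * layerLen s w + z := by
      simp only [eval_add, eval_mul, eval_sub, eval_var, eval_const, e22, e30, h2, hx]
      rw [show B.length - 1 - t = i by omega]
    have hiz : i * layerLen s w + z < B.length * layerLen s w :=
      mul_add_lt_mul (by omega) hz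
    have hvX : (encodeLayer eS (D.getD i default)).getD z 0 ≤ X := by
      rw [← hval, eval_load]; exact h1.mem _
    refine .put hb.two_le hb.le_L (h1.le hb) (by simp) (by simp [edgeAddrE, wf_edgeBackE]) ?_
    rw [haddr, hval]
    refine ⟨hx, hn, (h1.setMem (by omega) (by unfold posF; omega) hvX).setReg (by omega) (by omega),
      by simpa using h2, by simpa using h3, ?_, ?_⟩
    · intro j hj1 hj2 z' hz'
      have := Nat.mul_le_mul_right (layerLen s w) hj1
      rw [Nat.add_mul] at this
      simp only [Store.setReg_mem, Store.setMem_mem]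
      rw [Function.update_of_ne (by omega)]
      exact h4 j hj1 hj2 z' hz'
    · intro z' hz'
      simp only [Store.setReg_mem, Store.setMem_mem]
      rcases Nat.lt_succ_iff_lt_or_eq.1 hz' with h6 | rfl
      · rw [Function.update_of_ne (by omega)]; exact h5 z' h6
      · rw [Function.update_self]
  · rintro σ' - - ⟨h1, h2, h3, h4, h5⟩
    refine ⟨h1, h2, h3, fun j hj1 hj2 => ?_⟩
    rcases Nat.lt_or_eq_of_le hj1 with h6 | rfl
    · exact h4 j h6 hj2
    · exact h5

/-- A bound for the running time of the reconstruction. -/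
def reconTime (L k : ℕ) : ℕ :=
  k * (L ^ (Stm.seq (.loop 10 22 copyStm) (.asg 17 (srcE edgeBackE))).time + 8) + 8 +
    L ^ (Stm.asg 0 (const 2)).time

/-- Overwriting B in place is possible because the result has the same length: cell 2 already
contains it, and the output starts there. The loop invariant says that the current node is where the
path, cut off after k - t edges, ends. -/
theorem runs_reconStm (hb : Bounds X L s w B.length n ts.length)
    (h : Searched X eS eQ B F ts weight b σ) (hpos : σ.reg 16 ≠ 0) :
    Runs X reconStm (reconTime L B.length) σ fun σ' => σ'.reg 0 = 2 ∧ σ'.mem 2 = B.length ∧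
      LayersFrom eS (edgeLayers ts ((oddGraph eQ B F ts weight b).trace
        (tableAt (posE s w B.length n ts.length) (n * numColourings w) 2 σ.mem) B.length
        (σ.reg 17))) 0 σ'.mem := by
  obtain ⟨hS, hT, hBest⟩ := h
  set G := oddGraph eQ B F ts weight b with hG
  set bp := tableAt (posE s w B.length n ts.length) (n * numColourings w) 2 σ.mem with hbp
  set dp := tableAt (posE s w B.length n ts.length) (n * numColourings w) 1 σ.mem with hdp
  set es := G.trace bp B.length (σ.reg 17) with hes
  have hlen : es.length = B.length := LGraph.length_trace _ _
  have hDlen : (edgeLayers ts es).length = B.length := by simp [edgeLayers, hlen]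
  obtain ⟨hv, -, hdv⟩ := hBest.spec hpos
  have hkX : B.length ≤ X := hb.const 30
  have hVX : n * numColourings w ≤ X := hb.const 36
  have hR : ReconState X s w B.length n ts.length σ.mem σ := by
    refine ⟨hS.env, hS.locals, hS.mem, fun _ _ => rfl, ?_⟩
    rw [hS.input 2 (Nat.zero_le _) (by unfold posE posT posF; omega)]
    simp [encodeInput, encodeODD]
  refine Runs.seq hb.two_le (mid := fun σ' => ReconState X s w B.length n ts.length σ.mem σ' ∧
    LayersFrom eS (edgeLayers ts es) 0 σ'.mem) (Runs.loop (N := B.length) hb.two_le (fun t σ' =>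
      ReconState X s w B.length n ts.length σ.mem σ' ∧ σ'.reg 17 < n * numColourings w ∧
      dp (B.length - t) (σ'.reg 17) ≠ 0 ∧
      G.trace bp (B.length - t) (σ'.reg 17) = es.take (B.length - t) ∧
      LayersFrom eS (edgeLayers ts es) (B.length - t) σ'.mem) (hR.env 30 (by omega)) hkX (by omega)
      ?_ ?_ ?_) ?_
  · refine ⟨hR.setReg (by omega) (by omega), by simpa using hv, ?_, ?_, ?_⟩
    · simp only [Store.setReg_reg, Function.update_of_ne, ne_eq, Nat.reduceEqDiff,
        not_false_eq_true, Nat.sub_zero, hdv, hpos]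
    · simp only [Store.setReg_reg, Function.update_of_ne, ne_eq, Nat.reduceEqDiff,
        not_false_eq_true, Nat.sub_zero]
      exact (List.take_of_length_le hlen.le).symm
    · intro j h1 h2; omega
  · rintro t ht σ' hx hn ⟨h1, h2, h3, h4, h5⟩
    obtain ⟨i, hi⟩ : ∃ i, B.length - t = i + 1 := ⟨B.length - t - 1, by omega⟩
    rw [hi] at h3 h4 h5
    set v := σ'.reg 17 with hvdef
    obtain ⟨g1, g2, g3, g4, g5⟩ := hT.back i v h2 h3
    have heE : bp (i + 1) v < G.E := by
      rcases (g1 : G.Before B.length 0 i (bp (i + 1) v)) with h | h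
      · exact h.2
      · exact absurd h.2 (Nat.not_lt_zero _)
    have hsrcV : G.src (bp (i + 1) v) < n * numColourings w := G.src_lt _ heE
    have hies : i < es.length := by omega
    rw [LGraph.trace, ← List.take_append_getElem hies] at h4
    obtain ⟨h6, h7⟩ := List.append_inj' h4 rfl
    have h8 : bp (i + 1) v = es[i] := by simpa using h7
    refine Fast.seq hb.two_le hb.le_L (fast_copy hb h1 hS.input hi hx hvdef.symm rfl heE
      (by rw [edgeLayers_getD ts es hies, ← h8]) h5) ?_
    rintro σ₁ ⟨k1, k2, k3, k4⟩
    have hback := eval_edgeBackE k1 hi k2 k3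
    -- The layers of B may be gone by now, but the transitions, from which the source is read, are
    -- intact.
    have hI : InputFrom eS eQ B F ts (posF s w B.length) σ₁.mem := fun a ha ha' => by
      rw [k1.high a ha]; exact hS.input a (Nat.zero_le _) ha'
    refine .asg hb.two_le hb.le_L (k1.le hb) (wf_srcE wf_edgeBackE) ?_
    rw [eval_srcE (weight := weight) (b := b) k1.env hI le_rfl (by rw [hback]; exact heE), hback]
    refine ⟨by simpa using k2, k1.env 30 (by omega),
      (k1.setReg (by omega) (hsrcV.le.trans hVX)).setReg (by omega) (by omega), ?_⟩
    simp only [Store.setReg_reg, Store.setReg_mem, Function.update_self, Function.update_of_ne,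
      ne_eq, Nat.reduceEqDiff, not_false_eq_true]
    rw [show B.length - (t + 1) = i by omega]
    exact ⟨hsrcV, g4, h6, k4⟩
  · rintro σ' - - ⟨h1, -, -, -, h2⟩
    rw [Nat.sub_self] at h2
    exact ⟨h1, h2⟩
  · rintro σ' ⟨h1, h2⟩
    refine Fast.asg hb.two_le hb.le_L (h1.le hb) (by simp) ?_
    exact ⟨by simp, h1.length, h2⟩

theorem outputs_of_layersFrom {D : List (Layer Sig w)} {τ : Store} (h0 : τ.reg 0 = 2)
    (h2 : τ.mem 2 = D.length) (h : LayersFrom eS D 0 τ.mem) : τ.Outputs (encodeODD eS D) := by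
  intro i hi
  rw [h0]
  obtain _ | i := i
  · simpa [encodeODD] using h2
  · have hi' := hi
    rw [length_encodeODD] at hi'
    have hLL : 0 < layerLen s w := by unfold layerLen; omega
    have h1 : i / layerLen s w < D.length := Nat.div_lt_of_lt_mul (by rw [mul_comm]; omega)
    have h3 := Nat.div_add_mod' i (layerLen s w)
    have h4 := h _ (Nat.zero_le _) h1 _ (Nat.mod_lt i hLL)
    rw [← encodeODD_layer eS D h1 (Nat.mod_lt i hLL), h3] at h4
    rw [show 2 + (i + 1) = 3 + i / layerLen s w * layerLen s w + i % layerLen s w by omega, h4,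
      add_comm 1 i, List.getD_eq_getElem _ _ hi]

/-- The decision program. -/
def decideStm (b : Bool) (wE : SExpr) : Stm :=
  .seq (searchStm b wE) (.asg 0 (lt (const 0) (var 16)))

/-- The optimization programs. -/
def minimizeStm (b : Bool) (wE : SExpr) : Stm := .seq (searchStm b wE) reconStm

theorem Searched.path (hw : 0 < w) (hts : ∀ t, t ∈ ts ↔ t ∈ faTransitions F) (hBodd : IsODD B)
    (hF : IsSOFA F) (h : Searched X eS eQ B F ts weight b σ) (hpos : σ.reg 16 ≠ 0) :
    edgeLayers ts ((oddGraph eQ B F ts weight b).trace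
        (tableAt (posE s w B.length n ts.length) (n * numColourings w) 2 σ.mem) B.length
        (σ.reg 17)) ∈ equivODDs F B ∧
    σ.reg 16 - 1 = layerMeasure b weight (edgeLayers ts ((oddGraph eQ B F ts weight b).trace
        (tableAt (posE s w B.length n ts.length) (n * numColourings w) 2 σ.mem) B.length
        (σ.reg 17))) := by
  obtain ⟨hv, hacc, hdv⟩ := h.best.spec hpos
  have hp := h.table.path B.length (σ.reg 17) hv (by rw [hdv]; exact hpos)
  rw [hdv] at hp
  exact hp.mem_equivODDs hw hts hBodd hF (LGraph.length_trace _ _) hacc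

/-- The first conclusion gives completeness of the decision, the second the optimality of the ODD
found. -/
theorem Searched.le_measure (hw : 0 < w) (hts : ∀ t, t ∈ ts ↔ t ∈ faTransitions F)
    (hBodd : IsODD B) (hF : IsSOFA F) (h : Searched X eS eQ B F ts weight b σ)
    {D : List (Layer Sig w)} (hD : D ∈ equivODDs F B) :
    σ.reg 16 ≠ 0 ∧ σ.reg 16 - 1 ≤ layerMeasure b weight D := by
  obtain ⟨es, v, hl, hacc, hp⟩ := exists_path_of_mem_equivODDs eQ weight b hw hts hBodd hF hD
  obtain ⟨h1, h2, h3⟩ := h.table.le_of_path hp hl.le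
  rw [hl] at h2 h3
  obtain ⟨h4, h5⟩ := h.best.le v h1 hacc h2
  exact ⟨h4, by omega⟩

theorem runs_decideStm (hw : 0 < w) (hb : Bounds X L s w B.length n ts.length)
    (hC : Computes eS B.length n ts.length weight wE)
    (hts : ∀ t, t ∈ ts ↔ t ∈ faTransitions F) (hBodd : IsODD B) (hF : IsSOFA F)
    (hX : ∀ a, (encodeInput eS eQ B F ts).getD a 0 ≤ X) :
    Runs X (decideStm b wE) (searchTime b wE L B.length (n * numColourings w)
      (ts.length * (numColourings w * numColourings w)) +
      L ^ (Stm.asg 0 (lt (const 0) (var 16))).time) (Store.ofInput (encodeInput eS eQ B F ts))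
      fun σ => σ.reg 0 = truthBit (equivODDs F B).Nonempty := by
  refine Runs.seq hb.two_le
    (runs_searchStm (weight := weight) hw hb hC (fun _ => rfl) hX fun _ => rfl) ?_
  intro σ h
  refine Fast.asg hb.two_le hb.le_L (h.state.le hb) (by simp) ?_
  simp only [Store.setReg_reg, Function.update_self, eval_lt, eval_const, eval_var]
  refine truthBit_congr ⟨fun h0 => ?_, fun ⟨D, hD⟩ => ?_⟩
  · exact ⟨_, (h.path hw hts hBodd hF (by omega)).1⟩
  · exact Nat.pos_of_ne_zero (h.le_measure hw hts hBodd hF hD).1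

theorem runs_minimizeStm (hw : 0 < w) (hb : Bounds X L s w B.length n ts.length)
    (hC : Computes eS B.length n ts.length weight wE)
    (hts : ∀ t, t ∈ ts ↔ t ∈ faTransitions F) (hBodd : IsODD B) (hF : IsSOFA F)
    (hX : ∀ a, (encodeInput eS eQ B F ts).getD a 0 ≤ X) {μ : List (Layer Sig w) → ℕ}
    (hμ : ∀ D, IsODD D → μ D = layerMeasure b weight D) (hne : (equivODDs F B).Nonempty) :
    Runs X (minimizeStm b wE) (searchTime b wE L B.length (n * numColourings w)
      (ts.length * (numColourings w * numColourings w)) + reconTime L B.length)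
      (Store.ofInput (encodeInput eS eQ B F ts)) (OutputsMinimizer eS F B μ) := by
  refine Runs.seq hb.two_le
    (runs_searchStm (weight := weight) hw hb hC (fun _ => rfl) hX fun _ => rfl) ?_
  intro σ h
  obtain ⟨D₀, hD₀⟩ := hne
  have hpos := (h.le_measure hw hts hBodd hF hD₀).1
  obtain ⟨h1, h2⟩ := h.path hw hts hBodd hF hpos
  refine (runs_reconStm hb h hpos).weaken le_rfl ?_
  rintro τ ⟨h3, h4, h5⟩
  refine ⟨_, h1, fun D' hD' => ?_, outputs_of_layersFrom h3 (h4.trans ?_) h5⟩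
  · rw [hμ _ (hF _ h1.1), hμ _ (hF _ hD'.1), ← h2]
    exact (h.le_measure hw hts hBodd hF hD').2
  · simp [edgeLayers]

end Reconstruction

open SExpr Stm

/-! ### The bounds and the theorem -/

section Arithmetic

/-- The bound for the sums in the algorithm; the exponents of the running time refer to it. -/
def sumBound (s w : ℕ) : ℕ := 2 ^ (6 * (s * w * 2 ^ w))

/-- The bound for the numbers in the algorithm. -/
def wordBound (s w k n m : ℕ) : ℕ := sumBound s w ^ 3 * ((n + m) * k)

variable {s w k n m : ℕ}

theorem sumBound_eq (s w : ℕ) : sumBound s w = (2 ^ (s * w * 2 ^ w)) ^ 6 := by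
  rw [sumBound, ← pow_mul, mul_comm]

/-- All small parameters are measured in Y = 2^(s·w·2^w). The decisive estimate is (w + 1)·2·2^w ≤
4·(s·w·2^w), which makes the number of colourings at most Y^4. -/
theorem const_bounds {s w Y : ℕ} (hs : 0 < s) (hw : 0 < w) (hY : Y = 2 ^ (s * w * 2 ^ w)) :
    4 ≤ Y ∧ s ≤ Y ∧ w ≤ Y ∧ 2 ^ w ≤ Y ∧ numColourings w ≤ Y ^ 4 ∧
      (w + 1) * (2 * 2 ^ w) ≤ Y * Y := by
  have ha : 0 < s * w := Nat.mul_pos hs hw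
  have h2 : 2 ≤ 2 ^ w := Nat.le_self_pow hw.ne' 2
  have h3 : w < 2 ^ w := Nat.lt_two_pow_self
  have h5 : 2 ^ w ≤ s * w * 2 ^ w := Nat.le_mul_of_pos_left _ ha
  have h6 : s * w ≤ s * w * 2 ^ w := Nat.le_mul_of_pos_right _ (by omega)
  have h7 : s ≤ s * w := Nat.le_mul_of_pos_right _ hw
  have h8 : w ≤ s * w := Nat.le_mul_of_pos_left _ hs
  have h9 : s * w * 2 ^ w < Y := hY ▸ Nat.lt_two_pow_self
  have h10 : (w + 1) * (2 * 2 ^ w) ≤ 4 * (s * w * 2 ^ w) := by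
    calc (w + 1) * (2 * 2 ^ w) ≤ (2 * (s * w)) * (2 * 2 ^ w) :=
          Nat.mul_le_mul_right _ (by omega)
      _ = _ := by ring
  have h11 : 4 ≤ Y := by
    rw [hY]; exact Nat.pow_le_pow_right (n := 2) (by omega) (show 2 ≤ _ by omega)
  refine ⟨h11, by omega, by omega, by omega, ?_, ?_⟩
  · rw [numColourings, hY, ← pow_mul]
    exact Nat.pow_le_pow_right (by omega) (by omega)
  · exact h10.trans (Nat.mul_le_mul h11 h9.le)

theorem layerLen_add_two_le (hs : 0 < s) (hw : 0 < w) :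
    layerLen s w + 2 ≤ (2 ^ (s * w * 2 ^ w)) ^ 4 := by
  obtain ⟨h1, h2, h3, -⟩ := const_bounds hs hw rfl
  generalize 2 ^ (s * w * 2 ^ w) = Y at *
  have h4 : w * s * w ≤ Y * Y * Y := Nat.mul_le_mul (Nat.mul_le_mul h3 h2) h3
  have h5 : 4 * 4 ≤ Y * Y := Nat.mul_le_mul h1 h1
  have h6 : 4 * (Y * Y) ≤ Y * (Y * Y) := Nat.mul_le_mul_right _ h1
  have h7 : 4 * Y ≤ Y * Y := Nat.mul_le_mul_right _ h1
  have h8 : 4 * (Y * Y * Y) ≤ Y * (Y * Y * Y) := Nat.mul_le_mul_right _ h1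
  rw [show Y ^ 4 = Y * (Y * Y * Y) by ring, layerLen]
  rw [← mul_assoc Y Y Y] at h6
  omega

theorem sixteen_le_sumBound (hs : 0 < s) (hw : 0 < w) : 16 ≤ sumBound s w := by
  obtain ⟨h1, -⟩ := const_bounds hs hw rfl
  rw [sumBound_eq]
  exact (show 16 ≤ 4 ^ 6 by norm_num).trans (Nat.pow_le_pow_left h1 6)

theorem layerLen_add_two_le_sumBound (hs : 0 < s) (hw : 0 < w) :
    layerLen s w + 2 ≤ sumBound s w := by
  refine (layerLen_add_two_le hs hw).trans ?_
  rw [sumBound_eq]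
  exact Nat.pow_le_pow_right (by positivity) (by omega)

theorem numColourings_le_sumBound (hs : 0 < s) (hw : 0 < w) : numColourings w ≤ sumBound s w := by
  obtain ⟨h1, -, -, -, h2, -⟩ := const_bounds hs hw rfl
  rw [sumBound_eq]
  exact h2.trans (Nat.pow_le_pow_right (by omega) (by omega))

theorem small_le_sumBound (hs : 0 < s) (hw : 0 < w) {x : ℕ} (h20 : 20 ≤ x) (h30 : x < 30) :
    constEnv s w k n m x + 1 ≤ sumBound s w := by
  obtain ⟨h1, h2, h3, h4, h5, h6⟩ := const_bounds hs hw rfl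
  have h7 := layerLen_add_two_le hs hw
  have h8 : w * s * w ≤ layerLen s w := by unfold layerLen; omega
  rw [sumBound_eq]
  generalize 2 ^ (s * w * 2 ^ w) = Y at *
  have h9 : Y ^ 4 * (4 * 4) ≤ Y ^ 6 := by
    rw [show Y ^ 6 = Y ^ 4 * (Y * Y) by ring]
    exact Nat.mul_le_mul_left _ (Nat.mul_le_mul h1 h1)
  have h10 : 4 * 4 * (Y * Y) ≤ Y ^ 4 := by
    rw [show Y ^ 4 = Y * Y * (Y * Y) by ring]
    exact Nat.mul_le_mul_right _ (Nat.mul_le_mul h1 h1)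
  have h11 : 4 * Y ≤ Y * Y := Nat.mul_le_mul_right _ h1
  interval_cases x <;> simp only [constEnv] <;> omega

/-- The cube of L is needed mainly for the number of edges, with its two colourings per transition.
Addresses of table cells need not be below this bound: they are intermediate values, covered by the
exponents in the word length. -/
theorem bounds_wordBound (hs : 0 < s) (hw : 0 < w) (hn : 0 < n) (hk : 0 < k) :
    Bounds (wordBound s w k n m) (sumBound s w) s w k n m := by
  have hL := sixteen_le_sumBound hs hw
  have hlen := layerLen_add_two_le_sumBound hs hw
  have hK := numColourings_le_sumBound hs hw
  have hsmall : ∀ x, 20 ≤ x → x < 30 → constEnv s w k n m x + 1 ≤ sumBound s w :=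
    fun x => small_le_sumBound hs hw
  unfold wordBound
  generalize hLdef : sumBound s w = L at *
  generalize hLLdef : layerLen s w = LL at *
  have hq : 0 < (n + m) * k := Nat.mul_pos (by omega) hk
  have hnq : n + m ≤ (n + m) * k := Nat.le_mul_of_pos_right _ hk
  have hkq : k ≤ (n + m) * k := Nat.le_mul_of_pos_left _ (by omega)
  generalize (n + m) * k = q at *
  have h1 : L ≤ L ^ 3 * q := (Nat.le_self_pow (by omega) L).trans (Nat.le_mul_of_pos_right _ hq)
  have h3 : 16 * L * q ≤ L ^ 3 * q := Nat.mul_le_mul_right _ (by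
    rw [show L ^ 3 = L * L * L by ring]
    exact Nat.mul_le_mul_right _ (hL.trans (Nat.le_mul_of_pos_left _ (by omega))))
  have h4 : k * (LL + 2) ≤ L * q := by rw [mul_comm]; exact Nat.mul_le_mul hlen hkq
  have h5 : (n + m) * (LL + 2) ≤ L * q := by rw [mul_comm]; exact Nat.mul_le_mul hlen hnq
  have h6 : L ≤ L * q := Nat.le_mul_of_pos_right _ hq
  rw [Nat.mul_add] at h4
  rw [Nat.mul_add, Nat.add_mul] at h5
  rw [mul_assoc] at h3
  refine ⟨by omega, hL, fun x => ?_, hsmall, by rw [hLLdef]; omega⟩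
  by_cases hx : 20 ≤ x ∧ x < 30
  · have := hsmall x hx.1 hx.2; omega
  · have h7 : n * numColourings w ≤ L ^ 3 * q := by
      rw [mul_comm]
      exact Nat.mul_le_mul (hK.trans (Nat.le_self_pow (by omega) L)) (by omega)
    have h8 : m * (numColourings w * numColourings w) ≤ L ^ 3 * q := by
      rw [mul_comm, show L ^ 3 = L * L * L by ring]
      exact Nat.mul_le_mul ((Nat.mul_le_mul hK hK).trans (Nat.le_mul_of_pos_right _ (by omega)))
        (by omega)
    have hp1 : posF s w k ≤ L ^ 3 * q := by unfold posF; rw [hLLdef]; nlinarith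
    have hp2 : posT s w k n ≤ L ^ 3 * q := by unfold posT posF; rw [hLLdef]; nlinarith
    have hp3 : posE s w k n m ≤ L ^ 3 * q := by unfold posE posT posF; rw [hLLdef]; nlinarith
    unfold constEnv
    split <;> omega

end Arithmetic

/-! ### Total running times -/

section Time

variable {s w k n m L : ℕ}

def searchExp (b : Bool) (wE : SExpr) : ℕ :=
  setupStm.time + initStm.time + (relaxStm b wE).time + (Stm.asg 16 (const 0)).time +
    bestStm.time + 4

/-- Each part of the search is at most `L * L * q * L ^ t`, the two factors L being due to the pair
of colourings on an edge; one further factor L ≥ 16 pays for adding the parts. -/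
theorem searchTime_le (hL : 16 ≤ L) (hK : numColourings w ≤ L) (hn : 0 < n) (hk : 0 < k)
    (b : Bool) (wE : SExpr) :
    searchTime b wE L k (n * numColourings w) (m * (numColourings w * numColourings w)) ≤
      L ^ searchExp b wE * ((n + m) * k) := by
  unfold searchTime
  set q := (n + m) * k with hqdef
  set t := searchExp b wE - 3 with ht
  have hq : 0 < q := Nat.mul_pos (by omega) hk
  have hnq : n + m ≤ q := Nat.le_mul_of_pos_right _ hk
  have hkq : k ≤ q := Nat.le_mul_of_pos_left _ (by omega)
  have hpow : ∀ i ≤ t, L ^ i ≤ L ^ t := fun i hi => Nat.pow_le_pow_right (by omega) hi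
  have hLq : 16 * (L * q) ≤ L * L * q := by
    rw [← mul_assoc]; exact Nat.mul_le_mul_right _ (Nat.mul_le_mul_right _ hL)
  have hqL : 16 * q ≤ L * q := Nat.mul_le_mul_right _ hL
  have hV : n * numColourings w + 1 ≤ L * L * q := by
    have : n * numColourings w ≤ q * L := Nat.mul_le_mul (by omega) hK
    rw [mul_comm q L] at this
    omega
  -- Since n is positive, n·L² absorbs the additive 1, which also covers automata without
  -- transitions.
  have hE : k * (m * (numColourings w * numColourings w) + 1) ≤ L * L * q := by
    calc k * (m * (numColourings w * numColourings w) + 1)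
        ≤ k * (m * (L * L) + n * (L * L)) := Nat.mul_le_mul_left _ (add_le_add
          (Nat.mul_le_mul_left _ (Nat.mul_le_mul hK hK))
          (Nat.mul_pos hn (Nat.mul_pos (by omega) (by omega))))
      _ = L * L * q := by rw [hqdef]; ring
  have hZ : 0 < L ^ t := by positivity
  have h1 : L ^ setupStm.time ≤ L * L * q * L ^ t :=
    (hpow _ (by unfold searchExp at ht; omega)).trans (Nat.le_mul_of_pos_left _ (by omega))
  have h2 : L ^ (Stm.asg 16 (const 0)).time ≤ L * L * q * L ^ t :=
    (hpow _ (by unfold searchExp at ht; omega)).trans (Nat.le_mul_of_pos_left _ (by omega))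
  have h3 : (n * numColourings w + 1) * L ^ (initStm.time + 1) ≤ L * L * q * L ^ t :=
    Nat.mul_le_mul hV (hpow _ (by unfold searchExp at ht; omega))
  have h4 : (n * numColourings w + 1) * L ^ (bestStm.time + 1) ≤ L * L * q * L ^ t :=
    Nat.mul_le_mul hV (hpow _ (by unfold searchExp at ht; omega))
  have h5 : k * ((m * (numColourings w * numColourings w) + 1) *
      L ^ ((relaxStm b wE).time + 1)) ≤ L * L * q * L ^ t := by
    rw [← mul_assoc]
    exact Nat.mul_le_mul hE (hpow _ (by unfold searchExp at ht; omega))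
  have h6 : 8 * k + 8 ≤ L * L * q * L ^ t :=
    (show 8 * k + 8 ≤ L * L * q by omega).trans (Nat.le_mul_of_pos_right _ hZ)
  have h7 : 16 * (L * L * q * L ^ t) ≤ L * (L * L * q * L ^ t) := Nat.mul_le_mul_right _ hL
  have h8 : L ^ searchExp b wE * q = L * (L * L * q * L ^ t) := by
    rw [show searchExp b wE = t + 3 by unfold searchExp at ht ⊢; omega]; ring
  rw [h8, Nat.mul_add k]
  omega

def reconExp : ℕ :=
  (Stm.seq (.loop 10 22 copyStm) (.asg 17 (srcE edgeBackE))).time + (Stm.asg 0 (const 2)).time + 1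

theorem reconTime_le (hL : 16 ≤ L) (hn : 0 < n) (hk : 0 < k) :
    reconTime L k ≤ L ^ (reconExp + 1) * ((n + m) * k) := by
  unfold reconTime
  set q := (n + m) * k with hqdef
  have hkq : k ≤ q := Nat.le_mul_of_pos_left _ (by omega)
  have hpow : ∀ i ≤ reconExp, L ^ i ≤ L ^ reconExp := fun i hi =>
    Nat.pow_le_pow_right (by omega) hi
  have hZ : 0 < L ^ reconExp := by positivity
  have h1 : k * L ^ (Stm.seq (.loop 10 22 copyStm) (.asg 17 (srcE edgeBackE))).time ≤
      q * L ^ reconExp := Nat.mul_le_mul hkq (hpow _ (by unfold reconExp; omega))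
  have h2 : L ^ (Stm.asg 0 (const 2)).time ≤ q * L ^ reconExp :=
    (hpow _ (by unfold reconExp; omega)).trans (Nat.le_mul_of_pos_left _ (by omega))
  have h3 : q * L ≤ q * L ^ reconExp :=
    Nat.mul_le_mul_left _ (Nat.le_self_pow (by unfold reconExp; omega) L)
  have h4 : 16 * (q * L ^ reconExp) ≤ L * (q * L ^ reconExp) := Nat.mul_le_mul_right _ hL
  have h5 : q * 16 ≤ q * L := Nat.mul_le_mul_left _ hL
  rw [Nat.mul_add k, pow_succ, show L ^ reconExp * L * q = L * (q * L ^ reconExp) by ring]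
  omega

theorem add_le_pow_mul {A B a b c q : ℕ} (hL : 16 ≤ L) (hA : A ≤ L ^ a * q) (hB : B ≤ L ^ b * q)
    (ha : 1 ≤ a) (hb : 1 ≤ b) (hc : a + b ≤ c) : A + B ≤ L ^ c * q := by
  refine (add_le_add hA hB).trans ?_
  rw [← Nat.add_mul]
  exact Nat.mul_le_mul_right _ ((add_le_pow_add (by omega) ha hb).trans
    (Nat.pow_le_pow_right (by omega) hc))

end Time

/-! ### From the abstract bounds to the machine model -/

section Running

theorem Stm.size_pos (p : Stm) : 0 < p.size := by
  induction p with
  | asg _ e => exact e.size_pos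
  | put a e => exact Nat.add_pos_left a.size_pos _
  | _ => simp only [Stm.size]; omega

/-- Words of (log₂ X + 1)·size bits suffice. Since 2 ≤ X ≤ T, both log₂ X and 1 are at most log₂ T,
whence the factor 2 in the condition on c. -/
theorem Runs.runsIn {X Tn c : ℕ} {p : Stm} {input : List ℕ} {post post' : Store → Prop} {T : ℝ}
    (h : Runs X p Tn (Store.ofInput input) post) (hTn : (Tn : ℝ) ≤ T) (hXT : (X : ℝ) ≤ T)
    (hX : 2 ≤ X) (hc : 2 * p.size ≤ c) (hpost : ∀ τ : Store, post τ.user → post' τ) :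
    RunsIn p.compile input c T post' := by
  obtain ⟨t, τ, he, ht, hτ⟩ := h ((Nat.log 2 X + 1) * p.size) (by
    rw [pow_mul]
    exact Nat.pow_lt_pow_left (Nat.lt_pow_succ_log_self (by omega) X) p.size_pos.ne')
    (Store.ofInput input) rfl
  refine ⟨_, t, τ, he, (Nat.cast_le.2 ht).trans hTn, ?_, hpost τ hτ⟩
  have hX' : (2 : ℝ) ≤ X := by exact_mod_cast hX
  have hlog : 1 ≤ Real.logb 2 T := by
    rw [Real.le_logb_iff_rpow_le (by norm_num) (by linarith), Real.rpow_one]; linarith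
  have hlog2 : (Nat.log 2 X : ℝ) ≤ Real.logb 2 T := by
    rw [Real.le_logb_iff_rpow_le (by norm_num) (by linarith), Real.rpow_natCast]
    refine le_trans ?_ hXT
    exact_mod_cast Nat.pow_log_le_self 2 (by omega)
  push_cast
  have hc' : (2 : ℝ) * p.size ≤ c := by exact_mod_cast hc
  have h0 : (0 : ℝ) ≤ p.size := Nat.cast_nonneg _
  nlinarith

end Running

section Size

variable {Sig : Type u} {Q : Type v} {s w n : ℕ}

theorem two_le_card_layer [Finite Sig] : 2 ≤ Nat.card (Layer Sig w) := by
  let f : Bool → Layer Sig w := fun b => ⟨∅, ∅, ∅, ∅, ∅, b, false, by simp, by simp, by simp,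
    by simp, by simp⟩
  have hf : f.Injective := fun a b h => congrArg Layer.initFlag h
  simpa using Nat.card_le_card_of_injective f hf

/-- There are at least two layers, which differ in a flag, so each transition contributes at least 1
to the size. -/
theorem le_faSize (eS : Sig ≃ Fin s) (eQ : Q ≃ Fin n) (F : NFA (Layer Sig w) Q)
    {ts : List (Q × Layer Sig w × Q)} (hnd : ts.Nodup) (hts : ∀ t, t ∈ ts ↔ t ∈ faTransitions F) :
    ((n + ts.length : ℕ) : ℝ) ≤ faSize F := by
  classical
  have : Finite Sig := .of_equiv _ eS.symm
  have hQ : Nat.card Q = n := by simpa using Nat.card_congr eQ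
  have hT : (faTransitions F).ncard = ts.length := by
    rw [← List.toFinset_card_of_nodup hnd, ← Set.ncard_coe_finset]
    congr 1; ext t; simp [hts]
  have h2 : (2 : ℝ) ≤ Nat.card (Layer Sig w) := by exact_mod_cast two_le_card_layer
  have hlog : 1 ≤ Real.logb 2 (Nat.card (Layer Sig w)) := by
    rw [Real.le_logb_iff_rpow_le (by norm_num) (by linarith), Real.rpow_one]; exact h2
  rw [faSize, hQ, hT, Nat.cast_add]
  gcongr
  exact le_mul_of_one_le_right (Nat.cast_nonneg _) hlog

theorem le_sq_mul_logb {k : ℕ} (hk : 0 < k) : (k : ℝ) ≤ (k : ℝ) ^ 2 * Real.logb 2 (k + 1) := by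
  have h1 : (1 : ℝ) ≤ k := by exact_mod_cast hk
  have hlog : 1 ≤ Real.logb 2 ((k : ℝ) + 1) := by
    rw [Real.le_logb_iff_rpow_le (by norm_num) (by linarith), Real.rpow_one]; linarith
  nlinarith

/-- The passage to the stated form of the bounds, used for the time and for the word bound alike.
The factor 6 comes from the exponent in `sumBound`. -/
theorem mul_pow_le_mul_faSize (eS : Sig ≃ Fin s) (eQ : Q ≃ Fin n) (F : NFA (Layer Sig w) Q)
    {ts : List (Q × Layer Sig w × Q)} (hnd : ts.Nodup) (hts : ∀ t, t ∈ ts ↔ t ∈ faTransitions F)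
    {N C c k : ℕ} {K : ℝ} (hN : N ≤ sumBound s w ^ C * ((n + ts.length) * k)) (hc : 6 * C ≤ c)
    (hK : (k : ℝ) ≤ K) : (N : ℝ) ≤ 2 ^ (c * (s * w * 2 ^ w)) * faSize F * K := by
  have h1 : sumBound s w ^ C ≤ 2 ^ (c * (s * w * 2 ^ w)) := by
    rw [sumBound, ← pow_mul]
    refine Nat.pow_le_pow_right (by omega) ?_
    calc 6 * (s * w * 2 ^ w) * C = 6 * C * (s * w * 2 ^ w) := by ring
      _ ≤ _ := Nat.mul_le_mul_right _ hc
  have h2 := le_faSize eS eQ F hnd hts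
  have h0 : (0 : ℝ) ≤ faSize F := (Nat.cast_nonneg _).trans h2
  calc (N : ℝ) ≤ ((sumBound s w ^ C * ((n + ts.length) * k) : ℕ) : ℝ) := Nat.cast_le.2 hN
    _ = ((sumBound s w ^ C : ℕ) : ℝ) * ((n + ts.length : ℕ) : ℝ) * k := by push_cast; ring
    _ ≤ ((2 ^ (c * (s * w * 2 ^ w)) : ℕ) : ℝ) * faSize F * K := by
        gcongr
    _ = _ := by push_cast; rfl

end Size

section Programs

variable {Sig : Type u} {Q : Type v} {s w n : ℕ} {eS : Sig ≃ Fin s} {eQ : Q ≃ Fin n}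
  {B : List (Layer Sig w)} {F : NFA (Layer Sig w) Q} {ts : List (Q × Layer Sig w × Q)}
  {weight : Layer Sig w → ℕ} {b : Bool} {wE : SExpr} {c : ℕ} {K : ℝ}

theorem getD_encodeInput_le (hs : 0 < s) (hw : 0 < w) (hn : 0 < n) (hk : 0 < B.length) (a : ℕ) :
    (encodeInput eS eQ B F ts).getD a 0 ≤ wordBound s w B.length n ts.length := by
  have hb := bounds_wordBound (m := ts.length) hs hw hn hk
  rw [List.getD_eq_getElem?_getD]
  rcases h : (encodeInput eS eQ B F ts)[a]? with _ | x
  · exact Nat.zero_le _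
  · exact le_of_mem_encodeInput (hb.const 20) (hb.const 21) (hb.const 30) (hb.const 32)
      (hb.const 33) ((Nat.le_succ 1).trans hb.two_le) (List.mem_of_getElem? h)

theorem runsIn_decideStm (hs : 0 < s) (hw : 0 < w) (hn : 0 < n)
    (hC : Computes eS B.length n ts.length weight wE) (hnd : ts.Nodup)
    (hts : ∀ t, t ∈ ts ↔ t ∈ faTransitions F) (hBodd : IsODD B) (hF : IsSOFA F)
    (hc : 6 * (searchExp b wE + (Stm.asg 0 (lt (const 0) (var 16))).time + 1) +
      2 * (decideStm b wE).size ≤ c) (hK : (B.length : ℝ) ≤ K) :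
    RunsIn (decideStm b wE).compile (encodeInput eS eQ B F ts) c
      (2 ^ (c * (s * w * 2 ^ w)) * faSize F * K)
      (fun τ => τ.reg 0 = truthBit (equivODDs F B).Nonempty) := by
  have hk : 0 < B.length := List.length_pos_of_ne_nil hBodd.ne_nil
  have hb := bounds_wordBound (m := ts.length) hs hw hn hk
  refine (runs_decideStm hw hb hC hts hBodd hF (getD_encodeInput_le hs hw hn hk)).runsIn
    (mul_pow_le_mul_faSize eS eQ F hnd hts (C := searchExp b wE +
      (Stm.asg 0 (lt (const 0) (var 16))).time + 1) ?_ (by omega) hK)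
    (mul_pow_le_mul_faSize eS eQ F hnd hts (C := 3) le_rfl
      (by unfold searchExp at hc; omega) hK) hb.two_le (by omega) fun τ h => h
  exact add_le_pow_mul hb.le_L
    (searchTime_le hb.le_L (numColourings_le_sumBound hs hw) hn hk b wE)
    (Nat.le_mul_of_pos_right _ (Nat.mul_pos (by omega) hk)) (by unfold searchExp; omega)
    (Stm.time_pos _) (by omega)

theorem runsIn_minimizeStm (hs : 0 < s) (hw : 0 < w) (hn : 0 < n)
    (hC : Computes eS B.length n ts.length weight wE) (hnd : ts.Nodup)
    (hts : ∀ t, t ∈ ts ↔ t ∈ faTransitions F) (hBodd : IsODD B) (hF : IsSOFA F)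
    (hc : 6 * (searchExp b wE + reconExp + 2) + 2 * (minimizeStm b wE).size ≤ c)
    (hK : (B.length : ℝ) ≤ K) {μ : List (Layer Sig w) → ℕ}
    (hμ : ∀ D, IsODD D → μ D = layerMeasure b weight D) (hne : (equivODDs F B).Nonempty) :
    RunsIn (minimizeStm b wE).compile (encodeInput eS eQ B F ts) c
      (2 ^ (c * (s * w * 2 ^ w)) * faSize F * K) (OutputsMinimizer eS F B μ) := by
  have hk : 0 < B.length := List.length_pos_of_ne_nil hBodd.ne_nil
  have hb := bounds_wordBound (m := ts.length) hs hw hn hk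
  refine (runs_minimizeStm hw hb hC hts hBodd hF (getD_encodeInput_le hs hw hn hk) hμ hne).runsIn
    (mul_pow_le_mul_faSize eS eQ F hnd hts (C := searchExp b wE + reconExp + 2) ?_ (by omega) hK)
    (mul_pow_le_mul_faSize eS eQ F hnd hts (C := 3) le_rfl
      (by unfold searchExp at hc; omega) hK) hb.two_le (by omega) fun τ h => h
  exact add_le_pow_mul hb.le_L
    (searchTime_le hb.le_L (numColourings_le_sumBound hs hw) hn hk b wE)
    (reconTime_le hb.le_L hn hk) (by unfold searchExp; omega) (by omega) (by omega)

theorem computes_widthE (eS : Sig ≃ Fin s) (k n m : ℕ) :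
    Computes eS k n m (widthWeight (w := w)) widthE :=
  ⟨by simp [widthE, leftE, rightE, wf_combineE], eval_widthE, fun L => widthWeight_le L s⟩

theorem computes_statesE (eS : Sig ≃ Fin s) (k n m : ℕ) :
    Computes eS k n m (statesWeight (w := w)) statesE :=
  ⟨by simp [statesE, leftE, rightE], eval_statesE, fun L => statesWeight_le L s⟩

theorem computes_transE (eS : Sig ≃ Fin s) (k n m : ℕ) :
    Computes eS k n m (transWeight (w := w)) transE :=
  ⟨by simp [transE], eval_transE, transWeight_le eS⟩

end Programs

theorem theorem5p3 :
    ∃ (decideProg widthProg statesProg transProg : Prog) (c : ℕ),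
      ∀ (Sig : Type u) (Q : Type v) (s w n : ℕ), 0 < s → 0 < w → 0 < n →
      -- numberings of the alphabet and of the states, for the encoding of the input
      ∀ (eS : Sig ≃ Fin s) (eQ : Q ≃ Fin n)
        (B : List (Layer Sig w)) (F : NFA (Layer Sig w) Q), IsODD B → IsSOFA F →
      -- a list of the transitions, in any order
      ∀ ts : List (Q × Layer Sig w × Q), ts.Nodup → (∀ t, t ∈ ts ↔ t ∈ faTransitions F) →
        RunsIn decideProg (encodeInput eS eQ B F ts) c
          (2 ^ (c * (s * w * 2 ^ w)) * faSize F * B.length)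
          (fun τ => τ.reg 0 = truthBit (equivODDs F B).Nonempty) ∧
        ((equivODDs F B).Nonempty →
          RunsIn widthProg (encodeInput eS eQ B F ts) c
            (2 ^ (c * (s * w * 2 ^ w)) * faSize F * B.length)
            (OutputsMinimizer eS F B oddWidth) ∧
          RunsIn statesProg (encodeInput eS eQ B F ts) c
            (2 ^ (c * (s * w * 2 ^ w)) * faSize F *
              ((B.length : ℝ) ^ 2 * Real.logb 2 (B.length + 1)))
            (OutputsMinimizer eS F B oddNumStates) ∧
          RunsIn transProg (encodeInput eS eQ B F ts) c
            (2 ^ (c * (s * w * 2 ^ w)) * faSize F *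
              ((B.length : ℝ) ^ 2 * Real.logb 2 (B.length + 1)))
            (OutputsMinimizer eS F B oddNumTrans)) := by
  -- For the decision any weight would do. The constant is the sum of the four individual ones, so
  -- it dominates each of them and depends on the programs only.
  refine ⟨(decideStm false transE).compile, (minimizeStm true widthE).compile,
    (minimizeStm false statesE).compile, (minimizeStm false transE).compile,
    (6 * (searchExp false transE + (Stm.asg 0 (lt (const 0) (var 16))).time + 1) +
      2 * (decideStm false transE).size) +
    (6 * (searchExp true widthE + reconExp + 2) + 2 * (minimizeStm true widthE).size) +
    (6 * (searchExp false statesE + reconExp + 2) + 2 * (minimizeStm false statesE).size) +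
    (6 * (searchExp false transE + reconExp + 2) + 2 * (minimizeStm false transE).size), ?_⟩
  intro Sig Q s w n hs hw hn eS eQ B F hBodd hF ts hnd hts
  have hk := le_sq_mul_logb (List.length_pos_of_ne_nil hBodd.ne_nil)
  refine ⟨runsIn_decideStm hs hw hn (computes_transE eS _ _ _) hnd hts hBodd hF (by omega) le_rfl,
    fun hne => ⟨?_, ?_, ?_⟩⟩
  · exact runsIn_minimizeStm hs hw hn (computes_widthE eS _ _ _) hnd hts hBodd hF (by omega) le_rfl
      (fun _ => IsODD.oddWidth_eq) hne
  · exact runsIn_minimizeStm hs hw hn (computes_statesE eS _ _ _) hnd hts hBodd hF (by omega) hk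
      (fun _ => IsODD.oddNumStates_eq) hne
  · exact runsIn_minimizeStm hs hw hn (computes_transE eS _ _ _) hnd hts hBodd hF (by omega) hk
      (fun D _ => oddNumTrans_eq D) hne
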